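/- Work in the language $L_2$ of second-order arithmetic. Number variables range over the number sort and set variables range over a collection of sets of numbers; a model $(N,S)$ of $\mathsf{ACA}_0$ may have a nonstandard first-order part $N$. Fix the pairing $\langle a,b\rangle=(a+b)^2+a$. A set $W$ is regarded as a coded $\omega$-model, whose sets are the $(W)_k=\{n\mid\langle n,k\rangle\in W\}$ and whose first-order part is that of the surrounding structure; we write $X\in W$ if $X=(W)_k$ for some $k$. For a (code of a) formula $\varphi$ with parameters, $W\vDash\varphi$ means that there is a valuation, i.e. a set that assigns truth values to the instances of the subformulas of $\varphi$ in accordance with Tarski's clauses (set quantifiers ranging over the sets $(W)_k$), under which $\varphi$ is true. All statements below about formulas quantify over codes of formulas inside the theory. Let $\Pi^1_1\text{-}\mathsf{CA}^\varepsilon$ be the statement: for every set $X$ there is a coded $\omega$-model $W$ with $X\in W$ such that $W\vDash\mathsf{ACA}_0$ and such that $W$ contains the set $\{x\mid W\vDash\varphi(x,X)\}$ for every $\Pi^1_1$-formula $\varphi$ with no set parameters other than $X$. Let $\Pi^1_\infty\text{-}\mathsf{TI}$ be the principle of transfinite induction for all formulas $\varphi$ of second-order arithmetic (with number and set parameters):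 if $X$ is a well order (a set coding a linear order for which there is no infinite descending sequence), then $$\forall j\,\bigl(\forall i\,(i<_X j\to\varphi(i))\to\varphi(j)\bigr)\to\forall j\,\varphi(j).$$ In $W\vDash\Pi^1_\infty\text{-}\mathsf{TI}$, this is evaluated in $W$; in particular, $X$, the set parameters and the descending sequences are those that belong to $W$. **Proposition.** The theory $\mathsf{ACA}_0$ proves that $\Pi^1_1\text{-}\mathsf{CA}^\varepsilon$ holds if and only if every set $X$ is contained in a coded $\omega$-model $W$ with $W\vDash\mathsf{ACA}_0$ and $W\vDash\Pi^1_\infty\text{-}\mathsf{TI}$. Equivalently, this equivalence holds in every model $(N,S)$ of $\mathsf{ACA}_0$. -/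

import Mathlib

/-! Second-order arithmetic.  A structure for the language `L₂` of second-order arithmetic is given
by a type `N` of numbers with interpretations of `0, 1, +, ·, <` (no laws are assumed; in particular
`N` may be nonstandard) and a collection `S : Set (Set N)`, the range of the set quantifiers. -/

namespace SOA

/-! ### The theory `ACA₀` and its models -/

/-- Number terms of `L₂`, in de Bruijn style. -/
inductive Term : Type
  | var (i : ℕ) : Term
  | zero : Term
  | one : Term
  | add (t u : Term) : Term
  | mul (t u : Term) : Term

/-- Arithmetical formulas of `L₂`: number quantifiers, free set variables `X_i`, no set
quantifiers. The remaining connectives and `∃` are classical abbreviations. -/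
inductive ArithFormula : Type
  | eq (t u : Term) : ArithFormula
  | lt (t u : Term) : ArithFormula
  | mem (t : Term) (i : ℕ) : ArithFormula
  | not (φ : ArithFormula) : ArithFormula
  | and (φ ψ : ArithFormula) : ArithFormula
  | all (φ : ArithFormula) : ArithFormula

section Models

variable {N : Type*} [Zero N] [One N] [Add N] [Mul N] [LT N]

/-- The assignment `a, e 0, e 1, …`. -/
def push (a : N) (e : ℕ → N) : ℕ → N
  | 0 => a
  | i + 1 => e i

/-- The value of a term. -/
def Term.val : Term → (ℕ → N) → N
  | .var i, e => e i
  | .zero, _ => 0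
  | .one, _ => 1
  | .add t u, e => t.val e + u.val e
  | .mul t u, e => t.val e * u.val e

/-- Truth of an arithmetical formula, with number parameters `e` and set parameters `d`. -/
def ArithFormula.Holds : ArithFormula → (ℕ → N) → (ℕ → Set N) → Prop
  | .eq t u, e, _ => t.val e = u.val e
  | .lt t u, e, _ => t.val e < u.val e
  | .mem t i, e, d => t.val e ∈ d i
  | .not φ, e, d => ¬ φ.Holds e d
  | .and φ ψ, e, d => φ.Holds e d ∧ ψ.Holds e d
  | .all φ, e, d => ∀ a : N, φ.Holds (push a e) d

/-- `(N, S)` is a model of `ACA₀`: the basic axioms, the induction axiom, and comprehension for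
all arithmetical formulas with number and set parameters. -/
structure ModelACA0 (S : Set (Set N)) : Prop where
  nonempty : S.Nonempty
  succ_ne_zero : ∀ n : N, n + 1 ≠ 0
  succ_inj : ∀ m n : N, m + 1 = n + 1 → m = n
  add_zero : ∀ m : N, m + 0 = m
  add_succ : ∀ m n : N, m + (n + 1) = (m + n) + 1
  mul_zero : ∀ m : N, m * 0 = 0
  mul_succ : ∀ m n : N, m * (n + 1) = m * n + m
  not_lt_zero : ∀ m : N, ¬ m < 0
  lt_succ : ∀ m n : N, m < n + 1 ↔ m < n ∨ m = n
  induction : ∀ X ∈ S, (0 : N) ∈ X → (∀ n ∈ X, n + 1 ∈ X) → ∀ n, n ∈ X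
  comprehension : ∀ (φ : ArithFormula) (e : ℕ → N) (d : ℕ → Set N), (∀ i, d i ∈ S) →
    {x | φ.Holds (push x e) d} ∈ S

/-! ### Codes of `L₂`-expressions inside the structure

From here on everything is expressed inside `(N, S)`: numbers range over `N`, sets over `S`.
In particular, codes of terms and formulas are elements of `N`, possibly nonstandard. -/

/-- The standard pairing function `(a, b) ↦ (a + b)² + a`. -/
def pr (a b : N) : N := (a + b) * (a + b) + a

/-- The numeral of `n`. -/
def num : ℕ → N
  | 0 => 0
  | n + 1 => num n + 1

/-- Code of the variable with de Bruijn index `i` (used for number and for set variables). -/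
def cVar (i : N) : N := pr (num 1) i
/-- Code of the term `0`. -/
def cZero : N := pr (num 2) 0
/-- Code of the term `1`. -/
def cOne : N := pr (num 3) 0
/-- Code of `t + u`. -/
def cAdd (t u : N) : N := pr (num 4) (pr t u)
/-- Code of `t · u`. -/
def cMul (t u : N) : N := pr (num 5) (pr t u)

/-- Code of `t = u`. -/
def cEq (t u : N) : N := pr (num 1) (pr t u)
/-- Code of `t < u`. -/
def cLt (t u : N) : N := pr (num 2) (pr t u)
/-- Code of `t ∈ X_i`. -/
def cMem (t i : N) : N := pr (num 3) (pr t i)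
/-- Code of `¬ φ`. -/
def cNot (φ : N) : N := pr (num 4) φ
/-- Code of `φ ∧ ψ`. -/
def cAnd (φ ψ : N) : N := pr (num 5) (pr φ ψ)
/-- Code of the number quantification `∀ x φ`. -/
def cAll (φ : N) : N := pr (num 6) φ
/-- Code of the set quantification `∀ X φ`. -/
def cAllSet (φ : N) : N := pr (num 7) φ

/-- `t` codes a term: it lies in a set of codes that is closed under immediate subterms. (As
subterms have smaller codes, induction shows that only genuine terms qualify.) -/
def IsTerm (S : Set (Set N)) (t : N) : Prop :=
  ∃ P ∈ S, t ∈ P ∧ ∀ r ∈ P,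
    (∃ i, r = cVar i) ∨ r = cZero ∨ r = cOne ∨
    (∃ u ∈ P, ∃ v ∈ P, r = cAdd u v) ∨ (∃ u ∈ P, ∃ v ∈ P, r = cMul u v)

/-- `D` is a set of formula codes that is closed under immediate subformulas. -/
def SubformulaClosed (S : Set (Set N)) (D : Set N) : Prop :=
  ∀ φ ∈ D,
    (∃ t u, IsTerm S t ∧ IsTerm S u ∧ φ = cEq t u) ∨
    (∃ t u, IsTerm S t ∧ IsTerm S u ∧ φ = cLt t u) ∨
    (∃ t i, IsTerm S t ∧ φ = cMem t i) ∨
    (∃ ψ ∈ D, φ = cNot ψ) ∨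
    (∃ ψ ∈ D, ∃ χ ∈ D, φ = cAnd ψ χ) ∨
    (∃ ψ ∈ D, φ = cAll ψ) ∨
    (∃ ψ ∈ D, φ = cAllSet ψ)

/-- `φ` codes an `L₂`-formula. -/
def IsFormula (S : Set (Set N)) (φ : N) : Prop :=
  ∃ D ∈ S, SubformulaClosed S D ∧ φ ∈ D

/-- `φ` codes an arithmetical formula, i.e. one without set quantifiers. -/
def IsArithmetical (S : Set (Set N)) (φ : N) : Prop :=
  ∃ D ∈ S, SubformulaClosed S D ∧ (∀ ψ, cAllSet ψ ∉ D) ∧ φ ∈ D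

/-- `φ` codes a `Π¹₁`-formula `∀ X θ` with `θ` arithmetical. -/
def IsPi11 (S : Set (Set N)) (φ : N) : Prop :=
  ∃ θ, IsArithmetical S θ ∧ φ = cAllSet θ

/-! ### Assignments and evaluation of terms

An assignment is a number `e` that is read as a sequence `e = ⟨e₀, ⟨e₁, ⟨e₂, …⟩⟩⟩`; here
`0 = ⟨0, 0⟩` is the sequence with constant value `0`. -/

/-- `V` is the set of all `⟨t, ⟨e, a⟩⟩` such that the term `t` has value `a` under `e`. -/
def IsTermEvaluation (V : Set N) : Prop :=
  ∀ t e a : N, pr t (pr e a) ∈ V ↔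
    (t = cVar 0 ∧ ∃ r, e = pr a r) ∨
    (∃ i b r, t = cVar (i + 1) ∧ e = pr b r ∧ pr (cVar i) (pr r a) ∈ V) ∨
    (t = cZero ∧ a = 0) ∨
    (t = cOne ∧ a = 1) ∨
    (∃ u v b c, t = cAdd u v ∧ pr u (pr e b) ∈ V ∧ pr v (pr e c) ∈ V ∧ a = b + c) ∨
    (∃ u v b c, t = cMul u v ∧ pr u (pr e b) ∈ V ∧ pr v (pr e c) ∈ V ∧ a = b * c)

/-- The coded term `t` has value `a` under the assignment `e`. -/
def TermVal (S : Set (Set N)) (t e a : N) : Prop :=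
  ∃ V ∈ S, IsTermEvaluation V ∧ pr t (pr e a) ∈ V

/-- `e` assigns a value to every variable. -/
def IsAssignment (S : Set (Set N)) (e : N) : Prop :=
  ∀ i, ∃ a, TermVal S (cVar i) e a

/-! ### Coded `ω`-models -/

/-- The `k`-th set `(W)_k` of the coded `ω`-model `W`. -/
def column (W : Set N) (k : N) : Set N := {n | pr n k ∈ W}

/-- `X` belongs to the coded `ω`-model `W`. -/
def InModel (W X : Set N) : Prop := ∃ k, column W k = X

/-- `T` is a valuation for the formula `φ` in the coded `ω`-model `W`: on a set `D` of formulas that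
contains `φ` and is closed under subformulas, Tarski's clauses hold for the relation
`⟨ψ, ⟨e, d⟩⟩ ∈ T`, read as "`W ⊨ ψ` when the number variables are evaluated by `e` and the set
variable with index `i` denotes `(W)_k` for `k` the `i`-th entry of `d`". -/
def IsValuation (S : Set (Set N)) (W : Set N) (φ : N) (T : Set N) : Prop :=
  T ∈ S ∧ ∃ D ∈ S, SubformulaClosed S D ∧ φ ∈ D ∧ ∀ e d : N,
    (∀ t u, cEq t u ∈ D → (pr (cEq t u) (pr e d) ∈ T ↔
      ∃ a b, TermVal S t e a ∧ TermVal S u e b ∧ a = b)) ∧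
    (∀ t u, cLt t u ∈ D → (pr (cLt t u) (pr e d) ∈ T ↔
      ∃ a b, TermVal S t e a ∧ TermVal S u e b ∧ a < b)) ∧
    (∀ t i, cMem t i ∈ D → (pr (cMem t i) (pr e d) ∈ T ↔
      ∃ a k, TermVal S t e a ∧ TermVal S (cVar i) d k ∧ a ∈ column W k)) ∧
    (∀ ψ, cNot ψ ∈ D → (pr (cNot ψ) (pr e d) ∈ T ↔ ¬ pr ψ (pr e d) ∈ T)) ∧
    (∀ ψ χ, cAnd ψ χ ∈ D → (pr (cAnd ψ χ) (pr e d) ∈ T ↔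
      pr ψ (pr e d) ∈ T ∧ pr χ (pr e d) ∈ T)) ∧
    (∀ ψ, cAll ψ ∈ D → (pr (cAll ψ) (pr e d) ∈ T ↔ ∀ x, pr ψ (pr (pr x e) d) ∈ T)) ∧
    (∀ ψ, cAllSet ψ ∈ D → (pr (cAllSet ψ) (pr e d) ∈ T ↔ ∀ k, pr ψ (pr e (pr k d)) ∈ T))

/-- The coded `ω`-model `W` satisfies `ACA₀`. As the first-order part of `W` is that of the
surrounding structure and its sets belong to `S`, this amounts to comprehension in `W`, for all
arithmetical formulas and all parameters from `W`. -/
def SatACA0 (S : Set (Set N)) (W : Set N) : Prop :=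
  ∀ φ, IsArithmetical S φ → ∃ T, IsValuation S W φ T ∧
    ∀ e d, IsAssignment S e → IsAssignment S d →
      ∃ k, ∀ x, x ∈ column W k ↔ pr φ (pr (pr x e) d) ∈ T

/-- The coded `ω`-model `W` contains `{x | W ⊨ φ(x, X)}` for every `Π¹₁`-formula `φ` without set
parameters other than `X`. The assignment `d` sends every set variable that can occur in `φ` to `X`
(indices of variables in `φ` are smaller than the code `φ`). -/
def SatPi11CA (S : Set (Set N)) (W X : Set N) : Prop :=
  ∀ φ, IsPi11 S φ → ∃ T, IsValuation S W φ T ∧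
    ∀ e d, IsAssignment S e → IsAssignment S d →
      (∀ i, i < φ → ∀ k, TermVal S (cVar i) d k → column W k = X) →
      ∃ k, ∀ x, x ∈ column W k ↔ pr φ (pr (pr x e) d) ∈ T

/-- The strict part `i <_X j` of the relation `i ≤_X j` given by `⟨i, j⟩ ∈ X`. -/
def StrictRel (X : Set N) (i j : N) : Prop := pr i j ∈ X ∧ pr j i ∉ X

/-- `X` codes a (reflexive) linear order on its field `{i | ⟨i, i⟩ ∈ X}`. -/
def IsLinearOrderCode (X : Set N) : Prop :=
  (∀ i j, pr i j ∈ X → pr i i ∈ X ∧ pr j j ∈ X) ∧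
  (∀ i j k, pr i j ∈ X → pr j k ∈ X → pr i k ∈ X) ∧
  (∀ i j, pr i j ∈ X → pr j i ∈ X → i = j) ∧
  (∀ i j, pr i i ∈ X → pr j j ∈ X → pr i j ∈ X ∨ pr j i ∈ X)

/-- The coded `ω`-model `W` satisfies "`X` is a well order": `X` is a linear order, and no function
(given by its graph) in `W` is an infinite descending sequence. -/
def SatWO (W X : Set N) : Prop :=
  IsLinearOrderCode X ∧
  ¬ ∃ F, InModel W F ∧ (∀ n, ∃! y, pr n y ∈ F) ∧
    ∀ n y z, pr n y ∈ F → pr (n + 1) z ∈ F → StrictRel X z y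

/-- The coded `ω`-model `W` satisfies `Π¹_∞-TI`: transfinite induction along any of its well orders,
for every `L₂`-formula with parameters from `W`. -/
def SatTI (S : Set (Set N)) (W : Set N) : Prop :=
  ∀ φ, IsFormula S φ → ∃ T, IsValuation S W φ T ∧
    ∀ X, InModel W X → SatWO W X →
    ∀ e d, IsAssignment S e → IsAssignment S d →
      (∀ j, (∀ i, StrictRel X i j → pr φ (pr (pr i e) d) ∈ T) → pr φ (pr (pr j e) d) ∈ T) →
      ∀ j, pr φ (pr (pr j e) d) ∈ T

/-- The principle `Π¹₁-CA^ε` of pseudo `Π¹₁`-comprehension holds in `(N, S)`. -/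
def Pi11CAEps (S : Set (Set N)) : Prop :=
  ∀ X ∈ S, ∃ W ∈ S, InModel W X ∧ SatACA0 S W ∧ SatPi11CA S W X

/-- `(N, S)` satisfies: every set is contained in a coded `ω`-model of `ACA₀ + Π¹_∞-TI`. -/
def OmegaModelReflectionTI (S : Set (Set N)) : Prop :=
  ∀ X ∈ S, ∃ W ∈ S, InModel W X ∧ SatACA0 S W ∧ SatTI S W

end Models

end SOA

set_option linter.unusedSectionVars false
set_option linter.unusedVariables false
set_option synthInstance.maxHeartbeats 400000
set_option synthInstance.maxSize 2000

namespace SOA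

/-! ### Definability with set parameters, by type class inference -/

/-! The argument runs inside `(N, S)`, where a set may be used as soon as it is arithmetical in sets
already present.

From pseudo-comprehension to transfinite induction. It suffices to find coded ω-models `M ∈ W` of
`ACA₀`, with the given set in `M`, such that any relation of `M` with a descending sequence in `W`
already has one in `M`. If induction for `φ` then failed in `M` along `X`, the failure set would
belong to `W`, because `W` contains the partial satisfaction relations of its member `M`. The
failure set has no least element, so it yields a descending sequence in `W`, hence one in `M`, and
`X` is not a well order of `M` (`satTI_of_descending`). Such an `M` is read off a leftmost path. A
function `R` lists columns `R ⟨n, x+1⟩` and flags `R ⟨n, 0⟩`; flag `0` promises that column `n`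
meets requirement `n`, which concerns columns with smaller index. Depending on its tag, a
requirement asks for a column of `B`, a Boolean combination, a projection with its witnesses, a
preimage, a descending sequence, or the graph of an earlier column. These promises form a closed
condition, hence a tree. Comprehension in `W` gives the set of nodes lying on paths of `W`, so the
leftmost path is in `W`; being leftmost, it sets each flag with nonzero number to `0` whenever some
function of `W` could meet the requirement (`exists_optimal`, `exists_closed_model`).

From transfinite induction to pseudo-comprehension. There is a tree, arithmetical in `X`, whose
paths with first entry `⟨θ, e⟩` code a set `Y` together with Skolemized truth values showing that
`θ(Y, X)` fails at `e`. Let `W` satisfy `ACA₀` and transfinite induction and contain this tree, and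
let `V` consist of the sets definable over `W` by arbitrary coded formulas from fixed set
parameters. Then `V` satisfies `ACA₀`, it contains the set `H` of nodes on paths of `W`, and
induction along well orders of `W` holds for its sets. A label starts a path in `V` exactly if it
starts one in `W`. A path in `W` gives one in `V`, namely the leftmost one computed from `H`.
Conversely, if `W` has no such path, the Kleene–Brouwer order above the label is a well order for
`W`, and a path in `V` would be a definable subset without least element
(`exists_path_of_definable`). So the truth of `∀ Y θ` in `V` is arithmetical in `H ∈ V`, and `V` is
the model sought.

Because codes may be nonstandard, truth is never defined by recursion in the metatheory: a coded
model has a full satisfaction relation in `S` once it is a member of a coded model of `ACA₀`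
(`exists_fullSat`). -/

/-- Renaming of the variables of a term. -/
def Term.rename (ρ : ℕ → ℕ) : Term → Term
  | .var i => .var (ρ i)
  | .zero => .zero
  | .one => .one
  | .add t u => .add (t.rename ρ) (u.rename ρ)
  | .mul t u => .mul (t.rename ρ) (u.rename ρ)

/-- The lift of a renaming under a quantifier. -/
def liftRen (ρ : ℕ → ℕ) : ℕ → ℕ
  | 0 => 0
  | i + 1 => ρ i + 1

/-- Renaming of the number variables (by `ρ`) and the set variables (by `σ`) of a formula. -/
def ArithFormula.rename (σ : ℕ → ℕ) : (ℕ → ℕ) → ArithFormula → ArithFormula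
  | ρ, .eq t u => .eq (t.rename ρ) (u.rename ρ)
  | ρ, .lt t u => .lt (t.rename ρ) (u.rename ρ)
  | ρ, .mem t i => .mem (t.rename ρ) (σ i)
  | ρ, .not φ => .not (φ.rename σ ρ)
  | ρ, .and φ ψ => .and (φ.rename σ ρ) (ψ.rename σ ρ)
  | ρ, .all φ => .all (φ.rename σ (liftRen ρ))

section Definability

variable {N : Type*} [Zero N] [One N] [Add N] [Mul N] [LT N]

theorem Term.val_rename (ρ : ℕ → ℕ) (t : Term) (e : ℕ → N) :
    (t.rename ρ).val e = t.val (fun i => e (ρ i)) := by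
  induction t <;> simp_all [Term.rename, Term.val]

theorem push_liftRen (ρ : ℕ → ℕ) (a : N) (e : ℕ → N) :
    (fun i => push a e (liftRen ρ i)) = push a (fun i => e (ρ i)) := by
  funext i; cases i <;> rfl

theorem ArithFormula.holds_rename (σ : ℕ → ℕ) (φ : ArithFormula) :
    ∀ (ρ : ℕ → ℕ) (e : ℕ → N) (d : ℕ → Set N),
      (φ.rename σ ρ).Holds e d ↔ φ.Holds (fun i => e (ρ i)) (fun i => d (σ i)) := by
  induction φ with
  | all φ ih =>
    intro ρ e d
    simp only [ArithFormula.rename, ArithFormula.Holds, ih, push_liftRen]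
  | _ => intro ρ e d; simp_all [ArithFormula.rename, ArithFormula.Holds, Term.val_rename]

/-- `(N, S)` is a model of `ACA₀`, as a class. -/
class ACA (S : Set (Set N)) : Prop where
  model : ModelACA0 S

/-- `A` belongs to `S`, as a class. -/
class InC (S : Set (Set N)) (A : Set N) : Prop where
  mem : A ∈ S

/-- `P` is defined by an arithmetical formula with set parameters from `S`. -/
class Def (S : Set (Set N)) (P : (ℕ → N) → Prop) : Prop where
  out : ∃ (φ : ArithFormula) (d : ℕ → Set N), (∀ i, d i ∈ S) ∧ ∀ e, φ.Holds e d ↔ P e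

/-- `f` has a definable graph. -/
class TDef (S : Set (Set N)) (f : (ℕ → N) → N) : Prop where
  out : Def S (fun e => e 0 = f (fun i => e (i + 1)))

/-- `B` has a definable membership relation. -/
class SDef (S : Set (Set N)) (B : (ℕ → N) → Set N) : Prop where
  out : Def S (fun e => e 0 ∈ B (fun i => e (i + 1)))

variable {S : Set (Set N)}

theorem Def.congr {P Q : (ℕ → N) → Prop} (h : Def S P) (hPQ : ∀ e, P e ↔ Q e) : Def S Q := by
  obtain ⟨φ, d, hd, h⟩ := h
  exact ⟨φ, d, hd, fun e => (h e).trans (hPQ e)⟩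

theorem Def.rename {P : (ℕ → N) → Prop} (h : Def S P) (ρ : ℕ → ℕ) :
    Def S (fun e => P (fun i => e (ρ i))) := by
  obtain ⟨φ, d, hd, h⟩ := h
  exact ⟨φ.rename id ρ, d, hd, fun e => (φ.holds_rename id ρ e d).trans (h _)⟩

instance Def.not {P : (ℕ → N) → Prop} [h : Def S P] : Def S (fun e => ¬ P e) := by
  obtain ⟨φ, d, hd, h⟩ := h
  exact ⟨φ.not, d, hd, fun e => not_congr (h e)⟩

instance Def.and {P Q : (ℕ → N) → Prop} [hP : Def S P] [hQ : Def S Q] :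
    Def S (fun e => P e ∧ Q e) := by
  obtain ⟨φ, d, hd, h⟩ := hP
  obtain ⟨ψ, d', hd', h'⟩ := hQ
  -- The two lists of set parameters are interleaved: `φ` reads the even indices and `ψ` the odd
  -- ones.
  refine ⟨.and (φ.rename (fun i => 2 * i) id) (ψ.rename (fun i => 2 * i + 1) id),
    fun i => if i % 2 = 0 then d (i / 2) else d' (i / 2), fun i => ?_, fun e => ?_⟩
  · dsimp only; split_ifs <;> simp_all
  · simp only [ArithFormula.Holds, ArithFormula.holds_rename, id]
    refine and_congr (Iff.trans (iff_of_eq ?_) (h e)) (Iff.trans (iff_of_eq ?_) (h' e))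
    · congr 1; funext i; simp
    · congr 1; funext i
      have h1 : (2 * i + 1) / 2 = i := by omega
      simp [h1]

instance Def.all {P : (ℕ → N) → N → Prop} [h : Def S (fun e => P (fun i => e (i + 1)) (e 0))] :
    Def S (fun e => ∀ y, P e y) := by
  obtain ⟨φ, d, hd, h⟩ := h
  refine ⟨φ.all, d, hd, fun e => ?_⟩
  simp only [ArithFormula.Holds, h]
  rfl

instance Def.or {P Q : (ℕ → N) → Prop} [Def S P] [Def S Q] : Def S (fun e => P e ∨ Q e) :=
  Def.congr (P := fun e => ¬ (¬ P e ∧ ¬ Q e)) inferInstance (fun e => by tauto)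

instance Def.imp {P Q : (ℕ → N) → Prop} [Def S P] [Def S Q] : Def S (fun e => P e → Q e) :=
  Def.congr (P := fun e => ¬ (P e ∧ ¬ Q e)) inferInstance (fun e => by tauto)

instance Def.iff {P Q : (ℕ → N) → Prop} [Def S P] [Def S Q] : Def S (fun e => P e ↔ Q e) :=
  Def.congr (P := fun e => (P e → Q e) ∧ (Q e → P e)) inferInstance (fun e => by tauto)

instance Def.ex {P : (ℕ → N) → N → Prop} [Def S (fun e => P (fun i => e (i + 1)) (e 0))] :
    Def S (fun e => ∃ y, P e y) :=
  Def.congr (P := fun e => ¬ ∀ y, ¬ P e y) inferInstance (fun e => by simp)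

variable [hS : ACA S]

theorem exists_param : ∃ d : ℕ → Set N, ∀ i, d i ∈ S :=
  ⟨fun _ => hS.model.nonempty.some, fun _ => hS.model.nonempty.some_mem⟩

instance Def.const {p : Prop} : Def S (fun _ => p) := by
  obtain ⟨d, hd⟩ := exists_param (S := S)
  by_cases hp : p
  · exact ⟨.eq .zero .zero, d, hd, fun e => by simp [ArithFormula.Holds, hp]⟩
  · exact ⟨.not (.eq .zero .zero), d, hd, fun e => by simp [ArithFormula.Holds, hp]⟩

theorem comp (P : N → Prop) [h : Def S (fun e => P (e 0))] : {x | P x} ∈ S := by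
  obtain ⟨φ, d, hd, h⟩ := h
  have := hS.model.comprehension φ (fun _ => 0) d hd
  convert this using 1
  ext x
  exact (h (push x fun _ => 0)).symm

theorem Def.tm_eq (t u : Term) : Def S (fun e => t.val e = u.val e) := by
  obtain ⟨d, hd⟩ := exists_param (S := S)
  exact ⟨.eq t u, d, hd, fun e => Iff.rfl⟩

theorem Def.tm_lt (t u : Term) : Def S (fun e => t.val e < u.val e) := by
  obtain ⟨d, hd⟩ := exists_param (S := S)
  exact ⟨.lt t u, d, hd, fun e => Iff.rfl⟩

theorem Def.tm_mem (t : Term) {A : Set N} (hA : A ∈ S) : Def S (fun e => t.val e ∈ A) :=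
  ⟨.mem t 0, fun _ => A, fun _ => hA, fun e => Iff.rfl⟩

/-- `Def` admits set parameters only; a number parameter `c` enters through the set `{c}`. -/
theorem singleton_mem (c : N) : {x | x = c} ∈ S := by
  obtain ⟨d, hd⟩ := exists_param (S := S)
  exact hS.model.comprehension (.eq (.var 0) (.var 1)) (fun _ => c) d hd

instance TDef.var {k : ℕ} : TDef S (fun e : ℕ → N => e k) :=
  ⟨Def.tm_eq (.var 0) (.var (k + 1))⟩

instance TDef.const {c : N} : TDef S (fun _ => c) :=
  ⟨Def.tm_mem (.var 0) (singleton_mem c)⟩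

theorem TDef.shift {f : (ℕ → N) → N} (h : TDef S f) (ρ : ℕ → ℕ) (k : ℕ) :
    Def S (fun e => e k = f (fun i => e (ρ i))) :=
  h.out.rename (fun i => match i with | 0 => k | i + 1 => ρ i)

/-- Substitution passes through the graph of `f`, so it also serves definable functions that are not
terms. -/
theorem Def.subst {f : (ℕ → N) → N} (hf : TDef S f) {P : (ℕ → N) → N → Prop}
    (h : Def S (fun e => P (fun i => e (i + 1)) (e 0))) : Def S (fun e => P e (f e)) := by
  have h1 := hf.out
  exact Def.congr (P := fun e => ∃ y, y = f e ∧ P e y) inferInstance (fun e => by simp)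

instance Def.eq {f g : (ℕ → N) → N} [hf : TDef S f] [hg : TDef S g] :
    Def S (fun e => f e = g e) := by
  refine Def.subst hf (P := fun e y => y = g e) ?_
  exact hg.out

theorem Def.subst₂ {f g : (ℕ → N) → N} (hf : TDef S f) (hg : TDef S g) {P : N → N → Prop}
    (h : Def S (fun e => P (e 0) (e 1))) : Def S (fun e => P (f e) (g e)) := by
  refine Def.subst hg (P := fun e y => P (f e) y) ?_
  have h1 := hf.shift (fun i => i + 2) 0
  have h2 : Def S (fun e => P (e 0) (e 1)) := h
  exact Def.congr (P := fun e => ∃ y, y = f (fun i => e (i + 1)) ∧ P y (e 0))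
    inferInstance (fun e => by simp)

theorem Def.subst₃ {f g h : (ℕ → N) → N} (hf : TDef S f) (hg : TDef S g) (hh : TDef S h)
    {P : N → N → N → Prop} (hP : Def S (fun e => P (e 0) (e 1) (e 2))) :
    Def S (fun e => P (f e) (g e) (h e)) := by
  have h1 := hf.shift (fun i => i + 3) 0
  have h2 := hg.shift (fun i => i + 2) 0
  have h3 := hh.shift (fun i => i + 1) 0
  exact Def.congr (P := fun e => ∃ z, z = h e ∧ ∃ y, y = g e ∧ ∃ x, x = f e ∧ P x y z)
    inferInstance (fun e => by simp)

instance Def.lt {f g : (ℕ → N) → N} [hf : TDef S f] [hg : TDef S g] :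
    Def S (fun e => f e < g e) :=
  Def.subst₂ hf hg (P := fun x y => x < y) (Def.tm_lt (.var 0) (.var 1))

instance Def.ne {f g : (ℕ → N) → N} [hf : TDef S f] [hg : TDef S g] :
    Def S (fun e => f e ≠ g e) :=
  Def.congr (P := fun e => ¬ f e = g e) inferInstance (fun _ => Iff.rfl)

theorem TDef.of_term (t : Term) : TDef S (fun e : ℕ → N => t.val e) := by
  constructor
  convert Def.tm_eq (S := S) (.var 0) (t.rename Nat.succ) using 2
  rw [Term.val_rename]; rfl

theorem TDef.subst₂ {f g : (ℕ → N) → N} (hf : TDef S f) (hg : TDef S g) {F : N → N → N}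
    (h : TDef S (fun e => F (e 0) (e 1))) : TDef S (fun e => F (f e) (g e)) := by
  constructor
  have h1 := hf.shift (fun i => i + 3) 0
  have h2 := hg.shift (fun i => i + 2) 0
  have h3 : Def S (fun e => e 2 = F (e 0) (e 1)) :=
    h.shift (fun i => i) 2
  exact Def.congr (P := fun e => ∃ y, y = g (fun i => e (i + 1)) ∧
    ∃ x, x = f (fun i => e (i + 1)) ∧ e 0 = F x y) inferInstance (fun e => by simp)

theorem TDef.subst₁ {f : (ℕ → N) → N} (hf : TDef S f) {F : N → N}
    (h : TDef S (fun e => F (e 0))) : TDef S (fun e => F (f e)) :=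
  TDef.subst₂ hf hf (F := fun x _ => F x) h

instance TDef.add {f g : (ℕ → N) → N} [hf : TDef S f] [hg : TDef S g] :
    TDef S (fun e => f e + g e) :=
  TDef.subst₂ hf hg (F := fun x y => x + y) (TDef.of_term (.add (.var 0) (.var 1)))

instance TDef.mul {f g : (ℕ → N) → N} [hf : TDef S f] [hg : TDef S g] :
    TDef S (fun e => f e * g e) :=
  TDef.subst₂ hf hg (F := fun x y => x * y) (TDef.of_term (.mul (.var 0) (.var 1)))

instance TDef.pr {f g : (ℕ → N) → N} [hf : TDef S f] [hg : TDef S g] :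
    TDef S (fun e => pr (f e) (g e)) := by
  unfold SOA.pr; infer_instance

instance SDef.const {A : Set N} [h : InC S A] : SDef S (fun _ => A) :=
  ⟨Def.tm_mem (.var 0) h.mem⟩

instance Def.mem {f : (ℕ → N) → N} {B : (ℕ → N) → Set N} [hf : TDef S f] [hB : SDef S B] :
    Def S (fun e => f e ∈ B e) :=
  Def.subst hf (P := fun e y => y ∈ B e) hB.out

theorem SDef.shift {B : (ℕ → N) → Set N} (h : SDef S B) (ρ : ℕ → ℕ) :
    SDef S (fun e => B (fun i => e (ρ i))) :=
  ⟨h.out.rename (fun i => match i with | 0 => 0 | i + 1 => ρ i + 1)⟩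

theorem TDef.comp_shift {f : (ℕ → N) → N} (h : TDef S f) (ρ : ℕ → ℕ) :
    TDef S (fun e => f (fun i => e (ρ i))) :=
  ⟨h.shift (fun i => ρ i + 1) 0⟩

instance SDef.column {f : (ℕ → N) → N} {B : (ℕ → N) → Set N} [hf : TDef S f] [hB : SDef S B] :
    SDef S (fun e => column (B e) (f e)) := by
  constructor
  have h1 := hf.comp_shift Nat.succ
  have h2 := hB.shift Nat.succ
  exact (inferInstance : Def S (fun e => SOA.pr (e 0) (f (fun i => e (i + 1))) ∈ B (fun i => e (i + 1))))

/-- This is the single induction axiom, applied to a set formed by comprehension. Since `S` is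
arbitrary, it also serves inside `cols W`. -/
theorem ACA.ind (P : N → Prop) [Def S (fun e => P (e 0))] (h0 : P 0)
    (h1 : ∀ n, P n → P (n + 1)) (n : N) : P n :=
  hS.model.induction {x | P x} (comp (S := S) P) h0 h1 n

end Definability

/-! ### Arithmetic in a model of `ACA₀` -/

namespace Raw

section

variable {N : Type*} [Zero N] [One N] [Add N] [Mul N] [LT N] {S : Set (Set N)} (hS : ACA S)

include hS

theorem zero_add (a : N) : 0 + a = a := by
  refine ACA.ind (S := S) (fun a => 0 + a = a) (hS.model.add_zero 0) (fun n h => ?_) a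
  rw [hS.model.add_succ, h]

theorem succ_add (a b : N) : (a + 1) + b = (a + b) + 1 := by
  refine ACA.ind (S := S) (fun b => (a + 1) + b = (a + b) + 1) ?_ (fun n h => ?_) b
  · simp only [hS.model.add_zero]
  · rw [hS.model.add_succ, h, hS.model.add_succ]

theorem add_comm (a b : N) : a + b = b + a := by
  refine ACA.ind (S := S) (fun b => a + b = b + a) ?_ (fun n h => ?_) b
  · rw [hS.model.add_zero, zero_add hS]
  · rw [hS.model.add_succ, h, succ_add hS]

theorem add_assoc (a b c : N) : (a + b) + c = a + (b + c) := by
  refine ACA.ind (S := S) (fun c => (a + b) + c = a + (b + c)) ?_ (fun n h => ?_) c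
  · simp only [hS.model.add_zero]
  · rw [hS.model.add_succ, h, hS.model.add_succ, hS.model.add_succ]

theorem zero_mul (a : N) : 0 * a = 0 := by
  refine ACA.ind (S := S) (fun a => 0 * a = 0) (hS.model.mul_zero 0) (fun n h => ?_) a
  rw [hS.model.mul_succ, h, hS.model.add_zero]

theorem succ_mul (a b : N) : (a + 1) * b = a * b + b := by
  refine ACA.ind (S := S) (fun b => (a + 1) * b = a * b + b) ?_ (fun n h => ?_) b
  · simp only [hS.model.add_zero, hS.model.mul_zero]
  · rw [hS.model.mul_succ, h, hS.model.mul_succ, add_assoc hS, add_assoc hS,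
      hS.model.add_succ n, hS.model.add_succ a, add_comm hS a n]

theorem mul_comm (a b : N) : a * b = b * a := by
  refine ACA.ind (S := S) (fun b => a * b = b * a) ?_ (fun n h => ?_) b
  · rw [hS.model.mul_zero, zero_mul hS]
  · rw [hS.model.mul_succ, h, succ_mul hS]

theorem mul_add (a b c : N) : a * (b + c) = a * b + a * c := by
  refine ACA.ind (S := S) (fun c => a * (b + c) = a * b + a * c) ?_ (fun n h => ?_) c
  · simp only [hS.model.add_zero, hS.model.mul_zero]
  · rw [hS.model.mul_succ, hS.model.add_succ, hS.model.mul_succ, h, add_assoc hS]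

theorem mul_assoc (a b c : N) : (a * b) * c = a * (b * c) := by
  refine ACA.ind (S := S) (fun c => (a * b) * c = a * (b * c)) ?_ (fun n h => ?_) c
  · simp only [hS.model.mul_zero]
  · rw [hS.model.mul_succ, h, hS.model.mul_succ, mul_add hS]

theorem mul_one (a : N) : a * 1 = a := by
  rw [← zero_add hS 1, hS.model.mul_succ, hS.model.mul_zero, zero_add hS]

theorem add_right_cancel (a b c : N) : a + c = b + c → a = b := by
  refine ACA.ind (S := S) (fun c => a + c = b + c → a = b) ?_ (fun n h => ?_) c
  · simp only [hS.model.add_zero]; exact id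
  · rw [hS.model.add_succ, hS.model.add_succ]
    exact fun h' => h (hS.model.succ_inj _ _ h')

theorem zero_or_succ (a : N) : a = 0 ∨ ∃ b, a = b + 1 := by
  refine ACA.ind (S := S) (fun a => a = 0 ∨ ∃ b, a = b + 1) (Or.inl rfl) (fun n _ => ?_) a
  exact Or.inr ⟨n, rfl⟩

/-- The axioms describe `<` only by recursion; the additive form is what the remaining order laws
are derived from. -/
theorem lt_iff (a b : N) : a < b ↔ ∃ c, b = a + c + 1 := by
  refine ACA.ind (S := S) (fun b => a < b ↔ ∃ c, b = a + c + 1) ?_ (fun n h => ?_) b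
  · exact ⟨fun h => (hS.model.not_lt_zero a h).elim,
      fun ⟨c, hc⟩ => (hS.model.succ_ne_zero _ hc.symm).elim⟩
  · rw [hS.model.lt_succ, h]
    constructor
    · rintro (⟨c, rfl⟩ | rfl)
      · exact ⟨c + 1, by rw [hS.model.add_succ]⟩
      · exact ⟨0, by rw [hS.model.add_zero]⟩
    · rintro ⟨c, hc⟩
      have hc := hS.model.succ_inj _ _ hc
      rcases zero_or_succ hS c with rfl | ⟨c, rfl⟩
      · right; rw [hc, hS.model.add_zero]
      · left; exact ⟨c, by rw [hc, hS.model.add_succ]⟩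

theorem lt_irrefl (a : N) : ¬ a < a := by
  rw [lt_iff hS]
  rintro ⟨c, hc⟩
  refine hS.model.succ_ne_zero c (add_right_cancel hS _ _ a ?_)
  rw [zero_add hS, add_comm hS, hS.model.add_succ, ← hc]

theorem lt_trans {a b c : N} (h : a < b) (h' : b < c) : a < c := by
  rw [lt_iff hS] at *
  obtain ⟨x, rfl⟩ := h
  obtain ⟨y, rfl⟩ := h'
  exact ⟨x + 1 + y, by simp only [← add_assoc hS]⟩

theorem zero_le (a : N) : 0 < a ∨ 0 = a := by
  rcases zero_or_succ hS a with rfl | ⟨b, rfl⟩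
  · exact Or.inr rfl
  · exact Or.inl ((lt_iff hS _ _).2 ⟨b, by rw [zero_add hS]⟩)

theorem trichotomy (a b : N) : a < b ∨ a = b ∨ b < a := by
  refine ACA.ind (S := S) (fun b => a < b ∨ a = b ∨ b < a) ?_ (fun n h => ?_) b
  · rcases zero_le hS a with h | h
    · exact Or.inr (Or.inr h)
    · exact Or.inr (Or.inl h.symm)
  · simp only [hS.model.lt_succ]
    rcases h with h | h | h
    · exact Or.inl (Or.inl h)
    · exact Or.inl (Or.inr h)
    · obtain ⟨c, rfl⟩ := (lt_iff hS _ _).1 h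
      rcases zero_or_succ hS c with rfl | ⟨c, rfl⟩
      · right; left; rw [hS.model.add_zero]
      · right; right; rw [lt_iff hS]; exact ⟨c, by simp only [← add_assoc hS, succ_add hS]⟩

/-- The numbers of a model of `ACA₀` form a commutative semiring. -/
@[reducible] def commSemiring : CommSemiring N where
  add_assoc := add_assoc hS
  zero_add := zero_add hS
  add_zero := hS.model.add_zero
  add_comm := add_comm hS
  left_distrib := mul_add hS
  right_distrib a b c := by rw [mul_comm hS, mul_add hS, mul_comm hS c a, mul_comm hS c b]
  zero_mul := zero_mul hS
  mul_zero := hS.model.mul_zero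
  mul_assoc := mul_assoc hS
  one_mul a := by rw [mul_comm hS, mul_one hS]
  mul_one := mul_one hS
  mul_comm := mul_comm hS
  nsmul := nsmulRec
  npow := npowRec

open Classical in
/-- The numbers of a model of `ACA₀` are linearly ordered. -/
@[reducible] noncomputable def linearOrder : LinearOrder N where
  le a b := a < b ∨ a = b
  le_refl a := Or.inr rfl
  le_trans a b c := by
    rintro (h | rfl) (h' | rfl)
    · exact Or.inl (lt_trans hS h h')
    · exact Or.inl h
    · exact Or.inl h'
    · exact Or.inr rfl
  lt_iff_le_not_ge a b := by
    refine ⟨fun h => ⟨Or.inl h, ?_⟩, ?_⟩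
    · rintro (h' | rfl)
      · exact lt_irrefl hS _ (lt_trans hS h h')
      · exact lt_irrefl hS _ h
    · rintro ⟨h | rfl, h'⟩
      · exact h
      · exact (h' (Or.inr rfl)).elim
  le_antisymm a b := by
    rintro (h | rfl) (h' | h')
    · exact (lt_irrefl hS _ (lt_trans hS h h')).elim
    · exact h'.symm
    · rfl
    · rfl
  le_total a b := by
    rcases trichotomy hS a b with h | h | h
    · exact Or.inl (Or.inl h)
    · exact Or.inl (Or.inr h)
    · exact Or.inr (Or.inl h)
  toDecidableLE := Classical.decRel _
  toDecidableEq := Classical.decEq _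
  toDecidableLT := Classical.decRel _

theorem isStrictOrderedRing :
    letI := commSemiring hS; letI := linearOrder hS; IsStrictOrderedRing N := by
  let i1 := commSemiring hS
  let i2 := linearOrder hS
  have key : ∀ a b : N, a < b ↔ ∃ c, b = a + c + 1 := lt_iff hS
  have : Nontrivial N := ⟨0, 1, fun h => hS.model.succ_ne_zero 0 (by rw [zero_add hS]; exact h.symm)⟩
  have : ZeroLEOneClass N := ⟨zero_le hS 1⟩
  have hadd : ∀ a b c : N, a ≤ b → c + a ≤ c + b := by
    intro a b c h
    rcases (h : a < b ∨ a = b) with h | rfl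
    · obtain ⟨x, rfl⟩ := (key _ _).1 h
      exact Or.inl ((key _ _).2 ⟨x, by ring⟩)
    · exact Or.inr rfl
  have hmul : ∀ c : N, 0 < c → ∀ a b : N, a < b → c * a < c * b := by
    intro c hc a b h
    obtain ⟨x, rfl⟩ := (key _ _).1 hc
    obtain ⟨y, rfl⟩ := (key _ _).1 h
    exact (key _ _).2 ⟨x * y + x + y, by ring⟩
  exact
    { add_le_add_left := fun a b h c => by
        rw [add_comm hS a, add_comm hS b]; exact hadd a b c h
      le_of_add_le_add_left := by
        intro a b c h
        rcases trichotomy hS b c with h' | h' | h'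
        · exact Or.inl h'
        · exact Or.inr h'
        · exfalso
          obtain ⟨x, rfl⟩ := (key _ _).1 h'
          have h1 : a + c < a + (c + x + 1) := (key _ _).2 ⟨x, by ring⟩
          exact absurd h (not_le.2 h1)
      mul_lt_mul_of_pos_left := fun c hc a b h => hmul c hc a b h
      mul_lt_mul_of_pos_right := fun c hc a b h => by
        simp only [mul_comm hS _ c]
        exact hmul c hc a b h }

theorem canonicallyOrderedAdd :
    letI := commSemiring hS; letI := linearOrder hS; CanonicallyOrderedAdd N := by
  let i1 := commSemiring hS
  let i2 := linearOrder hS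
  have key : ∀ a b : N, a < b ↔ ∃ c, b = a + c + 1 := lt_iff hS
  have := isStrictOrderedRing hS
  have : ExistsAddOfLE N := by
    constructor
    intro a b h
    rcases (h : a < b ∨ a = b) with h | rfl
    · obtain ⟨x, rfl⟩ := (key _ _).1 h
      exact ⟨x + 1, by ring⟩
    · exact ⟨0, by ring⟩
  have h0 : ∀ a : N, 0 ≤ a := zero_le hS
  exact ⟨fun a b => le_add_of_nonneg_left (h0 b),
    fun a b => le_add_of_nonneg_right (h0 b)⟩

end

end Raw

/-! ### Pairing, finite sets and inductive definitions -/

section Arithmetic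

variable {N : Type*} [CommSemiring N] [LinearOrder N] [IsStrictOrderedRing N]
  [CanonicallyOrderedAdd N] {S : Set (Set N)}

section Order

variable [hS : ACA S]

include hS in
theorem ACA.lt_add_one (a b : N) : a < b + 1 ↔ a ≤ b := by
  rw [hS.model.lt_succ, le_iff_lt_or_eq]

include hS in
theorem ACA.add_one_le {a b : N} : a + 1 ≤ b ↔ a < b := by
  rw [← not_lt, ACA.lt_add_one (S := S), not_le]

instance Def.le {f g : (ℕ → N) → N} [TDef S f] [TDef S g] : Def S (fun e => f e ≤ g e) :=
  Def.congr (P := fun e => ¬ g e < f e) inferInstance (fun e => not_lt)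

theorem ACA.strong_ind (P : N → Prop) [Def S (fun e => P (e 0))]
    (h : ∀ n, (∀ m < n, P m) → P n) (n : N) : P n := by
  refine h n (ACA.ind (S := S) (fun n => ∀ m < n, P m) (fun m hm => ?_) (fun n ih m hm => ?_) n)
  · exact absurd hm not_lt_zero
  · rcases (hS.model.lt_succ _ _).1 hm with h' | rfl
    · exact ih m h'
    · exact h m ih

theorem ACA.exists_least (P : N → Prop) [Def S (fun e => P (e 0))] (h : ∃ n, P n) :
    ∃ n, P n ∧ ∀ m < n, ¬ P m := by
  by_contra hc
  push Not at hc
  obtain ⟨n, hn⟩ := h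
  refine ACA.strong_ind (S := S) (fun n => ¬ P n) (fun n ih hn => ?_) n hn
  obtain ⟨m, hm, hPm⟩ := hc n hn
  exact ih m hm hPm

theorem one_le_of_pos (h : ACA S) {a : N} (ha : a ≠ 0) : 1 ≤ a := by
  rw [← zero_add (1 : N), ACA.add_one_le (S := S)]
  exact pos_iff_ne_zero.2 ha

theorem num_zero : (num 0 : N) = 0 := rfl
theorem num_succ (n : ℕ) : (num (n + 1) : N) = num n + 1 := rfl

theorem num_eq (n : ℕ) : (num n : N) = (n : N) := by
  induction n with
  | zero => simp [num]
  | succ n ih => simp [num, ih]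

theorem num_inj {m n : ℕ} : (num m : N) = num n ↔ m = n := by
  rw [num_eq, num_eq, Nat.cast_inj]

theorem pr_eq (a b : N) : pr a b = (a + b) * (a + b) + a := rfl

/-- One has `(a + b)² ≤ pr a b < (a + b + 1)²`, so the pair determines its sum; injectivity follows.
-/
theorem pr_lt_of_add_lt (h : ACA S) {a b c d : N} (hlt : a + b < c + d) : pr a b < pr c d := by
  have h1 : a + b + 1 ≤ c + d := (ACA.add_one_le (S := S)).2 hlt
  have h2 : (a + b + 1) * (a + b + 1) ≤ (c + d) * (c + d) := mul_le_mul' h1 h1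
  calc pr a b = (a + b) * (a + b) + a := rfl
    _ ≤ (a + b) * (a + b) + (a + b) := by gcongr; exact le_self_add
    _ < (a + b + 1) * (a + b + 1) := by
      have : (a + b + 1) * (a + b + 1) = ((a + b) * (a + b) + (a + b)) + (a + b + 1) := by ring
      rw [this]
      exact lt_add_of_pos_right _ (by positivity)
    _ ≤ (c + d) * (c + d) := h2
    _ ≤ pr c d := le_self_add

theorem pr_inj' (h : ACA S) {a b c d : N} (heq : pr a b = pr c d) : a = c ∧ b = d := by
  rcases lt_trichotomy (a + b) (c + d) with h1 | h1 | h1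
  · exact absurd heq (pr_lt_of_add_lt h h1).ne
  · rw [pr_eq, pr_eq, h1] at heq
    obtain rfl : a = c := add_left_cancel heq
    exact ⟨rfl, add_left_cancel h1⟩
  · exact absurd heq (pr_lt_of_add_lt h h1).ne'

theorem left_le_pr (a b : N) : a ≤ pr a b := le_add_self

theorem right_le_pr (h : ACA S) (a b : N) : b ≤ pr a b := by
  by_cases hb : b = 0
  · simp [hb]
  have : b * 1 ≤ (a + b) * (a + b) := mul_le_mul' le_add_self
    ((one_le_of_pos h hb).trans le_add_self)
  rw [mul_one] at this
  exact this.trans le_self_add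

theorem right_lt_pr (h : ACA S) {a : N} (ha : a ≠ 0) (b : N) : b < pr a b := by
  have h1 : b ≤ (a + b) * (a + b) := by
    by_cases hb : b = 0
    · simp [hb]
    have : b * 1 ≤ (a + b) * (a + b) := mul_le_mul' le_add_self
      ((one_le_of_pos h hb).trans le_add_self)
    rwa [mul_one] at this
  exact lt_of_le_of_lt h1 (lt_add_of_pos_right _ (pos_iff_ne_zero.2 ha))

theorem pr_le_pr {a b c d : N} (h1 : a ≤ c) (h2 : b ≤ d) : pr a b ≤ pr c d := by
  rw [pr_eq, pr_eq]; gcongr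

theorem pr_lt_pr_right {b d : N} (a : N) (h1 : b < d) : pr a b < pr a d := by
  rw [pr_eq, pr_eq]
  have : a + b < a + d := by gcongr
  have : (a + b) * (a + b) < (a + d) * (a + d) := mul_lt_mul'' this this (zero_le) (zero_le)
  gcongr

/-! ### Coded finite sets -/

/-- The number `i` is an element of the finite set with code `(c, d)`. -/
def FMem (c d i : N) : Prop := ∃ q, c = (1 + (i + 1) * d) * q

instance {f g h : (ℕ → N) → N} [hf : TDef S f] [hg : TDef S g] [hh : TDef S h] :
    Def S (fun e => FMem (f e) (g e) (h e)) :=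
  Def.subst₃ hf hg hh (P := FMem) (by unfold FMem; infer_instance)

/-- Subtraction is not available in `N`; comparing `b` with the quotient replaces it. -/
theorem dvd_sub_of_le {p a b : N} (h : p ∣ a + p * b) : p ∣ a := by
  obtain ⟨q, hq⟩ := h
  rcases le_total b q with hle | hle
  · obtain ⟨r, rfl⟩ := exists_add_of_le hle
    refine ⟨r, ?_⟩
    rw [mul_add, add_comm] at hq
    exact add_left_cancel hq
  · obtain ⟨r, rfl⟩ := exists_add_of_le hle
    have : a + p * r = 0 := by
      rw [mul_add] at hq
      have h2 : p * q + (a + p * r) = p * q + 0 := by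
        rw [add_zero, ← add_assoc, add_comm (p * q) a, add_assoc]; exact hq
      exact add_left_cancel h2
    rw [(add_eq_zero.1 this).1]
    exact dvd_zero _

/-- Modulo `1 + (i + 1) d` the product `(i + 1) d` is `-1`, so `d` is invertible and can be
cancelled. -/
theorem dvd_of_dvd_mul_modulus {d i c : N} (h : 1 + (i + 1) * d ∣ c * d) :
    1 + (i + 1) * d ∣ c := by
  refine dvd_sub_of_le (b := c) ?_
  have : c + (1 + (i + 1) * d) * c = (1 + 1) * c + c * d * (i + 1) := by ring
  have h2 : c * (1 + (i + 1) * d) = c + (c * d) * (i + 1) := by ring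
  have h3 : (1 + (i + 1) * d) ∣ c + (c * d) * (i + 1) := h2 ▸ dvd_mul_left _ _
  obtain ⟨q, hq⟩ := h
  rw [hq, mul_assoc] at h3
  exact (dvd_sub_of_le h3).add (dvd_mul_right _ _)

/-- Modulo `1 + (i + 1) d` the factor `1 + (m + 1) d` is `± r d`. As `r ∣ d`, this divides a
multiple of `d²`, and `d` cancels twice. It replaces coprimality of Gödel's moduli. -/
theorem dvd_of_dvd_mul {d i m c r : N} (hr : r ∣ d) (him : m = i + r ∨ i = m + r)
    (h : 1 + (i + 1) * d ∣ c * (1 + (m + 1) * d)) : 1 + (i + 1) * d ∣ c := by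
  have key : 1 + (i + 1) * d ∣ c * r * d := by
    rcases him with rfl | rfl
    · have : c * (1 + (i + r + 1) * d) = c * r * d + (1 + (i + 1) * d) * c := by ring
      rw [this] at h
      exact dvd_sub_of_le h
    · obtain ⟨q, hq⟩ := h
      refine dvd_sub_of_le (b := q) ?_
      rw [← hq]
      exact ⟨c, by ring⟩
  obtain ⟨s, rfl⟩ := hr
  refine dvd_of_dvd_mul_modulus (dvd_of_dvd_mul_modulus ?_)
  have : c * (r * s) * (r * s) = c * r * (r * s) * s := by ring
  rw [this]
  exact key.mul_right _

/-- The number `d` plays the role of `n!` in Gödel's β-function. -/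
theorem exists_dvd_all (hS : ACA S) (n : N) : ∃ d : N, d ≠ 0 ∧ ∀ r ≤ n, r ≠ 0 → r ∣ d := by
  have : ∃ d : N, d ≠ 0 ∧ ∀ r ≤ n, r ≠ 0 → ∃ q, d = r * q := by
    refine ACA.ind (S := S) (fun n => ∃ d : N, d ≠ 0 ∧ ∀ r ≤ n, r ≠ 0 → ∃ q, d = r * q) ?_ ?_ n
    · exact ⟨1, one_ne_zero, fun r hr h => absurd (le_antisymm hr zero_le) h⟩
    · rintro n ⟨d, hd0, hd⟩
      refine ⟨d * (n + 1), ?_, fun r hr h => ?_⟩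
      · have := pos_iff_ne_zero.2 hd0
        positivity
      rcases hr.lt_or_eq with h1 | rfl
      · obtain ⟨q, rfl⟩ := hd r ((ACA.lt_add_one (S := S) _ _).1 h1) h
        exact ⟨q * (n + 1), by ring⟩
      · exact ⟨d, mul_comm _ _⟩
  exact this

theorem modulus_not_unit (h : ACA S) {d i : N} (hd : d ≠ 0) : ¬ (1 + (i + 1) * d) ∣ 1 := by
  rintro ⟨q, hq⟩
  have hq0 : q ≠ 0 := by rintro rfl; simp at hq
  have h1 : 1 + (i + 1) * d ≤ (1 + (i + 1) * d) * q :=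
    le_mul_of_one_le_right (zero_le) (one_le_of_pos h hq0)
  rw [← hq] at h1
  have h2 : 0 < (i + 1) * d := by
    have := pos_iff_ne_zero.2 hd
    positivity
  exact absurd h1 (not_le.2 (lt_add_of_pos_right _ h2))

/-- Every definable bounded set has a code. -/
theorem exists_code (n : N) (P : N → Prop) [hP : Def S (fun e => P (e 0))] :
    ∃ c d : N, ∀ i < n, FMem c d i ↔ P i := by
  obtain ⟨d, hd0, hd⟩ := exists_dvd_all hS n
  have hPl : ∃ A ∈ S, ∀ i, i ∈ A ↔ P i := ⟨{x | P x}, comp P, fun i => Iff.rfl⟩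
  obtain ⟨A, hA, hAP⟩ := hPl
  have : InC S A := ⟨hA⟩
  -- The code is the product of the moduli of those elements of `A` that are below `m`, built up by
  -- induction on `m`.
  have key : ∃ c, ∀ i < n, FMem c d i ↔ i < n ∧ i ∈ A := by
    refine ACA.ind (S := S)
      (fun m => m ≤ n → ∃ c, ∀ i < n, FMem c d i ↔ i < m ∧ i ∈ A) ?_ ?_ n le_rfl
    · refine fun _ => ⟨1, fun i hi => ?_⟩
      simp only [not_lt_zero, false_and, iff_false]
      exact modulus_not_unit hS hd0
    · intro m ih hmn
      obtain ⟨c, hc⟩ := ih (le_self_add.trans hmn)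
      have hlt : m < n := (ACA.add_one_le (S := S)).1 hmn
      by_cases hm : m ∈ A
      · refine ⟨c * (1 + (m + 1) * d), fun i hi => ?_⟩
        rw [ACA.lt_add_one (S := S)]
        constructor
        · intro h
          by_cases him : i = m
          · exact ⟨him.le, him ▸ hm⟩
          have h3 : FMem c d i := by
            rcases lt_or_gt_of_ne him with h1 | h1
            · obtain ⟨r, rfl⟩ := exists_add_of_le h1.le
              exact dvd_of_dvd_mul (hd r (le_add_self.trans hlt.le) (by rintro rfl; simp at h1))
                (Or.inl rfl) h
            · obtain ⟨r, rfl⟩ := exists_add_of_le h1.le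
              exact dvd_of_dvd_mul (hd r (le_add_self.trans hi.le) (by rintro rfl; simp at h1))
                (Or.inr rfl) h
          exact ⟨((hc i hi).1 h3).1.le, ((hc i hi).1 h3).2⟩
        · rintro ⟨h1, h2⟩
          rcases h1.lt_or_eq with h1 | rfl
          · obtain ⟨q, rfl⟩ := (hc i hi).2 ⟨h1, h2⟩
            exact ⟨q * (1 + (m + 1) * d), by ring⟩
          · exact ⟨c, mul_comm _ _⟩
      · refine ⟨c, fun i hi => (hc i hi).trans ?_⟩
        rw [ACA.lt_add_one (S := S)]
        refine and_congr_left fun h => ?_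
        constructor
        · exact le_of_lt
        · intro h1
          exact lt_of_le_of_ne h1 (by rintro rfl; exact hm h)
  obtain ⟨c, hc⟩ := key
  exact ⟨c, d, fun i hi => by rw [hc i hi, hAP]; exact and_iff_right hi⟩

/-! ### Inductive definitions with finite derivations -/

/-- `z` belongs to the least set that contains `B` and is closed under the rules `R x y z`, which
allow to infer `z` from `x` and `y`: there is a coded finite derivation. -/
def Deriv (B : N → Prop) (R : N → N → N → Prop) (z : N) : Prop :=
  ∃ c d n, z < n ∧ FMem c d z ∧ ∀ w < n, FMem c d w →
    B w ∨ ∃ x < n, ∃ y < n, FMem c d x ∧ FMem c d y ∧ R x y w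

instance Def.deriv {B : (ℕ → N) → N → Prop} {R : (ℕ → N) → N → N → N → Prop} {f : (ℕ → N) → N}
    [hB : Def S (fun e => B (fun i => e (i + 1)) (e 0))]
    [hR : Def S (fun e => R (fun i => e (i + 3)) (e 0) (e 1) (e 2))] [hf : TDef S f] :
    Def S (fun e => Deriv (B e) (R e) (f e)) := by
  refine Def.subst hf (P := fun e z => Deriv (B e) (R e) z) ?_
  have hB' : Def S (fun e => B (fun i => e (i + 5)) (e 0)) :=
    hB.rename (fun i => match i with | 0 => 0 | i + 1 => i + 5)
  have hR' : Def S (fun e => R (fun i => e (i + 7)) (e 1) (e 0) (e 2)) :=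
    hR.rename (fun i => match i with | 0 => 1 | 1 => 0 | 2 => 2 | i + 3 => i + 7)
  unfold Deriv
  infer_instance

-- This joins two finite derivations and appends a conclusion `z`.
include hS in
theorem exists_code_union (c d n c' d' n' z : N) : ∃ c₁ d₁ n₁, z < n₁ ∧ n ≤ n₁ ∧ n' ≤ n₁ ∧
    ∀ i < n₁, FMem c₁ d₁ i ↔ ((i < n ∧ FMem c d i) ∨ (i < n' ∧ FMem c' d' i)) ∨ i = z := by
  obtain ⟨c₁, d₁, h⟩ := exists_code (S := S) (n + n' + z + 1)
    (fun i => ((i < n ∧ FMem c d i) ∨ (i < n' ∧ FMem c' d' i)) ∨ i = z)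
  refine ⟨c₁, d₁, n + n' + z + 1, ?_, ?_, ?_, h⟩
  · rw [ACA.lt_add_one (S := S)]; exact le_add_self
  · rw [add_assoc, add_assoc]; exact le_self_add
  · rw [add_comm n n', add_assoc, add_assoc]; exact le_self_add

include hS in
/-- The set defined by `Deriv` is a fixed point. -/
theorem deriv_iff (B : N → Prop) (R : N → N → N → Prop) (z : N) :
    Deriv B R z ↔ B z ∨ ∃ x y, Deriv B R x ∧ Deriv B R y ∧ R x y z := by
  constructor
  · rintro ⟨c, d, n, hz, hc, h⟩
    rcases h z hz hc with h1 | ⟨x, hx, y, hy, hx', hy', hR⟩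
    · exact Or.inl h1
    · exact Or.inr ⟨x, y, ⟨c, d, n, hx, hx', h⟩, ⟨c, d, n, hy, hy', h⟩, hR⟩
  · rintro (h | ⟨x, y, ⟨c, d, n, hx, hx', h⟩, ⟨c', d', n', hy, hy', h'⟩, hR⟩)
    · obtain ⟨c₁, d₁, n₁, hz, -, -, h1⟩ := exists_code_union (S := S) 0 0 (0 : N) 0 0 0 z
      refine ⟨c₁, d₁, n₁, hz, (h1 z hz).2 (Or.inr rfl), fun w hw hw' => ?_⟩
      rcases (h1 w hw).1 hw' with (h2 | h2) | rfl
      · exact absurd h2.1 not_lt_zero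
      · exact absurd h2.1 not_lt_zero
      · exact Or.inl h
    · obtain ⟨c₁, d₁, n₁, hz, hn, hn', h1⟩ := exists_code_union (S := S) c d n c' d' n' z
      have k : ∀ w < n, FMem c d w → w < n₁ ∧ FMem c₁ d₁ w := fun w hw hw' =>
        ⟨hw.trans_le hn, (h1 w (hw.trans_le hn)).2 (Or.inl (Or.inl ⟨hw, hw'⟩))⟩
      have k' : ∀ w < n', FMem c' d' w → w < n₁ ∧ FMem c₁ d₁ w := fun w hw hw' =>
        ⟨hw.trans_le hn', (h1 w (hw.trans_le hn')).2 (Or.inl (Or.inr ⟨hw, hw'⟩))⟩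
      refine ⟨c₁, d₁, n₁, hz, (h1 z hz).2 (Or.inr rfl), fun w hw hw' => ?_⟩
      rcases (h1 w hw).1 hw' with (⟨h2, h3⟩ | ⟨h2, h3⟩) | rfl
      · rcases h w h2 h3 with h4 | ⟨u, hu, v, hv, hu', hv', hR'⟩
        · exact Or.inl h4
        · exact Or.inr ⟨u, (k u hu hu').1, v, (k v hv hv').1, (k u hu hu').2, (k v hv hv').2, hR'⟩
      · rcases h' w h2 h3 with h4 | ⟨u, hu, v, hv, hu', hv', hR'⟩
        · exact Or.inl h4
        · exact Or.inr ⟨u, (k' u hu hu').1, v, (k' v hv hv').1, (k' u hu hu').2, (k' v hv hv').2,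
            hR'⟩
      · exact Or.inr ⟨x, (k x hx hx').1, y, (k' y hy hy').1, (k x hx hx').2, (k' y hy hy').2, hR⟩

end Order

end Arithmetic

/-! ### Codes of terms and formulas -/

/-- `N` is the first-order part of some model of `ACA₀`. -/
class ACANumbers (N : Type*) [Zero N] [One N] [Add N] [Mul N] [LT N] : Prop where
  exists_model : ∃ S : Set (Set N), ACA S

section Codes

variable {N : Type*} [CommSemiring N] [LinearOrder N] [IsStrictOrderedRing N]
  [CanonicallyOrderedAdd N] [hN : ACANumbers N]

theorem lt_add_one_iff {a b : N} : a < b + 1 ↔ a ≤ b := by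
  obtain ⟨S, hS⟩ := hN.exists_model
  exact ACA.lt_add_one (S := S) a b

theorem add_one_le_iff {a b : N} : a + 1 ≤ b ↔ a < b := by
  obtain ⟨S, hS⟩ := hN.exists_model
  exact ACA.add_one_le (S := S)

@[simp] theorem pr_inj {a b c d : N} : pr a b = pr c d ↔ a = c ∧ b = d := by
  obtain ⟨S, hS⟩ := hN.exists_model
  exact ⟨pr_inj' hS, fun ⟨h, h'⟩ => by rw [h, h']⟩

attribute [simp] num_inj

theorem le_pr_right (a b : N) : b ≤ pr a b := by
  obtain ⟨S, hS⟩ := hN.exists_model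
  exact right_le_pr hS a b

theorem lt_pr_right {a : N} (ha : a ≠ 0) (b : N) : b < pr a b := by
  obtain ⟨S, hS⟩ := hN.exists_model
  exact right_lt_pr hS ha b

theorem lt_pr_num (k : ℕ) (b : N) : b < pr (num (k + 1)) b :=
  lt_pr_right (by rw [num_succ]; exact (lt_of_le_of_lt zero_le (lt_add_one _)).ne') b

theorem lt_pr_num_left (k : ℕ) (a b : N) : a < pr (num (k + 1)) (pr a b) :=
  (left_le_pr a b).trans_lt (lt_pr_num k _)

theorem lt_pr_num_right (k : ℕ) (a b : N) : b < pr (num (k + 1)) (pr a b) :=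
  (le_pr_right a b).trans_lt (lt_pr_num k _)

@[simp] theorem pr_zero_zero : pr (0 : N) 0 = 0 := by simp [pr]

theorem pr_eq_zero {a b : N} : pr a b = 0 ↔ a = 0 ∧ b = 0 := by
  conv_lhs => rw [← pr_zero_zero, pr_inj]

/-- The value relation for coded terms, defined by finite derivations. -/
def TV (t e a : N) : Prop :=
  Deriv
    (fun z => (∃ a r, z = pr (cVar 0) (pr (pr a r) a)) ∨ (∃ e, z = pr cZero (pr e 0)) ∨
      ∃ e, z = pr cOne (pr e 1))
    (fun x y z =>
      (∃ i b r a, z = pr (cVar (i + 1)) (pr (pr b r) a) ∧ x = pr (cVar i) (pr r a)) ∨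
      (∃ u v e b c, z = pr (cAdd u v) (pr e (b + c)) ∧ x = pr u (pr e b) ∧ y = pr v (pr e c)) ∨
      (∃ u v e b c, z = pr (cMul u v) (pr e (b * c)) ∧ x = pr u (pr e b) ∧ y = pr v (pr e c)))
    (pr t (pr e a))

section Inst

variable {S : Set (Set N)} [ACA S]

instance {f g h : (ℕ → N) → N} [hf : TDef S f] [hg : TDef S g] [hh : TDef S h] :
    Def S (fun e => TV (f e) (g e) (h e)) :=
  Def.subst₃ hf hg hh (P := TV) (by unfold TV cVar cZero cOne cAdd cMul; infer_instance)

end Inst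

theorem tv_iff (t e a : N) : TV t e a ↔
    (t = cVar 0 ∧ ∃ r, e = pr a r) ∨
    (∃ i b r, t = cVar (i + 1) ∧ e = pr b r ∧ TV (cVar i) r a) ∨
    (t = cZero ∧ a = 0) ∨
    (t = cOne ∧ a = 1) ∨
    (∃ u v b c, t = cAdd u v ∧ TV u e b ∧ TV v e c ∧ a = b + c) ∨
    (∃ u v b c, t = cMul u v ∧ TV u e b ∧ TV v e c ∧ a = b * c) := by
  obtain ⟨S, hS⟩ := hN.exists_model
  rw [TV, deriv_iff (S := S)]
  constructor
  · rintro ((⟨a', r, h⟩ | ⟨e', h⟩ | ⟨e', h⟩) | ⟨x, y, hx, hy, ⟨i, b, r, a', h, rfl⟩ |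
      ⟨u, v, e', b, c, h, rfl, rfl⟩ | ⟨u, v, e', b, c, h, rfl, rfl⟩⟩)
    all_goals
      simp only [pr_inj] at h
      obtain ⟨rfl, rfl, rfl⟩ := h
    · exact Or.inl ⟨rfl, r, rfl⟩
    · exact Or.inr (Or.inr (Or.inl ⟨rfl, rfl⟩))
    · exact Or.inr (Or.inr (Or.inr (Or.inl ⟨rfl, rfl⟩)))
    · exact Or.inr (Or.inl ⟨i, b, r, rfl, rfl, hx⟩)
    · exact Or.inr (Or.inr (Or.inr (Or.inr (Or.inl ⟨u, v, b, c, rfl, hx, hy, rfl⟩))))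
    · exact Or.inr (Or.inr (Or.inr (Or.inr (Or.inr ⟨u, v, b, c, rfl, hx, hy, rfl⟩))))
  · rintro (⟨rfl, r, rfl⟩ | ⟨i, b, r, rfl, rfl, hx⟩ | ⟨rfl, rfl⟩ | ⟨rfl, rfl⟩ |
      ⟨u, v, b, c, rfl, hx, hy, rfl⟩ | ⟨u, v, b, c, rfl, hx, hy, rfl⟩)
    · exact Or.inl (Or.inl ⟨a, r, rfl⟩)
    · exact Or.inr ⟨_, _, hx, hx, Or.inl ⟨i, b, r, a, rfl, rfl⟩⟩
    · exact Or.inl (Or.inr (Or.inl ⟨e, rfl⟩))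
    · exact Or.inl (Or.inr (Or.inr ⟨e, rfl⟩))
    · exact Or.inr ⟨_, _, hx, hy, Or.inr (Or.inl ⟨u, v, e, b, c, rfl, rfl, rfl⟩)⟩
    · exact Or.inr ⟨_, _, hx, hy, Or.inr (Or.inr ⟨u, v, e, b, c, rfl, rfl, rfl⟩)⟩

theorem succ_ne_zero' (a : N) : a + 1 ≠ 0 := (lt_of_le_of_lt zero_le (lt_add_one _)).ne'

theorem tv_var_zero {e a : N} : TV (cVar 0) e a ↔ ∃ r, e = pr a r := by
  rw [tv_iff]
  simp [cVar, cZero, cOne, cAdd, cMul, (succ_ne_zero' _).symm]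

theorem tv_var_succ {i e a : N} :
    TV (cVar (i + 1)) e a ↔ ∃ b r, e = pr b r ∧ TV (cVar i) r a := by
  rw [tv_iff]
  simp [cVar, cZero, cOne, cAdd, cMul]

theorem tv_zero {e a : N} : TV cZero e a ↔ a = 0 := by
  rw [tv_iff]
  simp [cVar, cZero, cOne, cAdd, cMul]

theorem tv_one {e a : N} : TV cOne e a ↔ a = 1 := by
  rw [tv_iff]
  simp [cVar, cZero, cOne, cAdd, cMul]

theorem tv_add {u v e a : N} :
    TV (cAdd u v) e a ↔ ∃ b c, TV u e b ∧ TV v e c ∧ a = b + c := by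
  rw [tv_iff]
  simp [cVar, cZero, cOne, cAdd, cMul]

theorem tv_mul {u v e a : N} :
    TV (cMul u v) e a ↔ ∃ b c, TV u e b ∧ TV v e c ∧ a = b * c := by
  rw [tv_iff]
  simp [cVar, cZero, cOne, cAdd, cMul]

theorem lt_cVar_succ (i : N) : cVar i < cVar (i + 1) := pr_lt_pr_right _ (lt_add_one i)

/-- Each clause refers only to terms with smaller codes, although possibly under another assignment.
Strong induction on the code, for all assignments at once, therefore leaves no freedom for `V`. -/
theorem mem_termEvaluation_iff {S : Set (Set N)} [hS : ACA S] {V : Set N} (hV : V ∈ S)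
    (h : IsTermEvaluation V) (t : N) : ∀ e a, pr t (pr e a) ∈ V ↔ TV t e a := by
  have : InC S V := ⟨hV⟩
  refine ACA.strong_ind (S := S) (fun t => ∀ e a, pr t (pr e a) ∈ V ↔ TV t e a)
    (fun t ih e a => ?_) t
  rw [h t e a, tv_iff]
  refine or_congr Iff.rfl (or_congr ?_ (or_congr Iff.rfl (or_congr Iff.rfl (or_congr ?_ ?_))))
  · refine exists_congr fun i => exists_congr fun b => exists_congr fun r =>
      and_congr_right fun ht => and_congr_right fun _ => ih _ ?_ _ _
    rw [ht]; exact lt_cVar_succ i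
  all_goals
    refine exists_congr fun u => exists_congr fun v => exists_congr fun b => exists_congr fun c =>
      and_congr_right fun ht => ?_
    subst ht
    rw [ih u (lt_pr_num_left _ _ _), ih v (lt_pr_num_right _ _ _)]

/-- The quantifier over evaluations in `S` disappears: `TV` is arithmetical and does not mention
`S`, so all models over `N` share it. -/
theorem termVal_iff {S : Set (Set N)} [hS : ACA S] {t e a : N} : TermVal S t e a ↔ TV t e a := by
  constructor
  · rintro ⟨V, hV, h, h'⟩
    exact (mem_termEvaluation_iff hV h t e a).1 h'
  · intro h
    refine ⟨{z | ∃ t e a, z = pr t (pr e a) ∧ TV t e a}, comp _, ?_, ⟨t, e, a, rfl, h⟩⟩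
    have key : ∀ t e a : N, pr t (pr e a) ∈ {z | ∃ t e a, z = pr t (pr e a) ∧ TV t e a} ↔
        TV t e a := by
      intro t e a
      constructor
      · rintro ⟨t', e', a', h, h'⟩
        simp only [pr_inj] at h
        obtain ⟨rfl, rfl, rfl⟩ := h
        exact h'
      · exact fun h => ⟨t, e, a, rfl, h⟩
    intro t e a
    simp only [key]
    exact tv_iff t e a

theorem tv_functional {t e a b : N} (h : TV t e a) (h' : TV t e b) : a = b := by
  obtain ⟨S, hS⟩ := hN.exists_model
  refine ACA.strong_ind (S := S) (fun t => ∀ e a b, TV t e a → TV t e b → a = b)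
    (fun t ih e a b h h' => ?_) t e a b h h'
  rw [tv_iff] at h
  rcases h with ⟨rfl, r, rfl⟩ | ⟨i, b', r, rfl, rfl, hx⟩ | ⟨rfl, rfl⟩ | ⟨rfl, rfl⟩ |
      ⟨u, v, b, c, rfl, hx, hy, rfl⟩ | ⟨u, v, b, c, rfl, hx, hy, rfl⟩
  · rw [tv_var_zero] at h'
    obtain ⟨r', h'⟩ := h'
    exact (pr_inj.1 h').1
  · rw [tv_var_succ] at h'
    obtain ⟨b'', r', h', h''⟩ := h'
    obtain ⟨rfl, rfl⟩ := pr_inj.1 h'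
    exact ih _ (lt_cVar_succ i) _ _ _ hx h''
  · exact (tv_zero.1 h').symm
  · exact (tv_one.1 h').symm
  · obtain ⟨b', c', h1, h2, rfl⟩ := tv_add.1 h'
    rw [ih _ (lt_pr_num_left _ _ _) _ _ _ hx h1, ih _ (lt_pr_num_right _ _ _) _ _ _ hy h2]
  · obtain ⟨b', c', h1, h2, rfl⟩ := tv_mul.1 h'
    rw [ih _ (lt_pr_num_left _ _ _) _ _ _ hx h1, ih _ (lt_pr_num_right _ _ _) _ _ _ hy h2]

/-! ### Assignments -/

/-- `e` codes an assignment. -/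
def Asg (e : N) : Prop := ∀ i, ∃ a, TV (cVar i) e a

theorem isAssignment_iff {S : Set (Set N)} [hS : ACA S] {e : N} : IsAssignment S e ↔ Asg e := by
  simp only [IsAssignment, termVal_iff, Asg]

instance {S : Set (Set N)} [ACA S] {f : (ℕ → N) → N} [hf : TDef S f] :
    Def S (fun e => Asg (f e)) :=
  Def.subst hf (P := fun _ x => Asg x) (by unfold Asg cVar; infer_instance)

theorem tv_cVar_zero (i : N) : TV (cVar i) 0 0 := by
  obtain ⟨S, hS⟩ := hN.exists_model
  refine ACA.ind (S := S) (fun i => TV (pr (num 1) i) 0 0) ?_ (fun n h => ?_) i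
  · exact tv_var_zero.2 ⟨0, by simp⟩
  · exact tv_var_succ.2 ⟨0, 0, by simp, h⟩

theorem asg_zero : Asg (0 : N) := fun i => ⟨0, tv_cVar_zero i⟩

theorem Asg.pr {a e : N} (h : Asg e) : Asg (pr a e) := by
  intro i
  obtain ⟨S, hS⟩ := hN.exists_model
  rcases Raw.zero_or_succ hS i with rfl | ⟨i, rfl⟩
  · exact ⟨a, tv_var_zero.2 ⟨e, rfl⟩⟩
  · obtain ⟨b, hb⟩ := h i
    exact ⟨b, tv_var_succ.2 ⟨a, e, rfl, hb⟩⟩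

theorem Asg.exists_eq {e : N} (h : Asg e) : ∃ a r, e = SOA.pr a r ∧ Asg r := by
  obtain ⟨a, h0⟩ := h 0
  obtain ⟨r, rfl⟩ := tv_var_zero.1 h0
  refine ⟨a, r, rfl, fun i => ?_⟩
  obtain ⟨b, hb⟩ := h (i + 1)
  obtain ⟨b', r', h1, h2⟩ := tv_var_succ.1 hb
  obtain ⟨rfl, rfl⟩ := pr_inj.1 h1
  exact ⟨b, h2⟩

open Classical in
/-- The components of a pair. -/
noncomputable def unpr (z : N) : N × N :=
  if h : ∃ p : N × N, z = pr p.1 p.2 then h.choose else (0, 0)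

theorem unpr_pr (a b : N) : unpr (pr a b) = (a, b) := by
  have h : ∃ p : N × N, pr a b = pr p.1 p.2 := ⟨(a, b), rfl⟩
  rw [unpr, dif_pos h]
  have := pr_inj.1 h.choose_spec
  exact Prod.ext this.1.symm this.2.symm

/-- The standard part of the sequence coded by `e`. -/
noncomputable def dec (e : N) : ℕ → N
  | 0 => (unpr e).1
  | i + 1 => dec (unpr e).2 i

@[simp] theorem dec_pr_zero (a e : N) : dec (pr a e) 0 = a := by
  simp only [dec, unpr_pr]

@[simp] theorem dec_pr_succ (a e : N) (i : ℕ) : dec (pr a e) (i + 1) = dec e i := by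
  simp only [dec, unpr_pr]

@[simp] theorem dec_pr_one (a e : N) : dec (pr a e) 1 = dec e 0 := dec_pr_succ a e 0

theorem dec_pr (a e : N) : dec (pr a e) = push a (dec e) := by
  funext i; cases i <;> simp [push]

theorem tv_var {e : N} (h : Asg e) (i : ℕ) {a : N} : TV (cVar (num i)) e a ↔ a = dec e i := by
  induction i generalizing e with
  | zero =>
    obtain ⟨b, r, rfl, h⟩ := h.exists_eq
    rw [num_zero, tv_var_zero]
    simp [eq_comm]
  | succ i ih =>
    obtain ⟨b, r, rfl, hr⟩ := h.exists_eq
    rw [num_succ, tv_var_succ]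
    simp [ih hr]

/-- The code of a standard term. -/
def Term.code : Term → N
  | .var i => cVar (num i)
  | .zero => cZero
  | .one => cOne
  | .add t u => cAdd t.code u.code
  | .mul t u => cMul t.code u.code

theorem tv_code {e : N} (h : Asg e) (t : Term) {a : N} :
    TV t.code e a ↔ a = t.val (dec e) := by
  induction t generalizing a with
  | var i => exact tv_var h i
  | zero => exact tv_zero
  | one => exact tv_one
  | add t u ih ih' => simp [Term.code, Term.val, tv_add, ih, ih']
  | mul t u ih ih' => simp [Term.code, Term.val, tv_mul, ih, ih']

/-- `t` codes a term. -/
def Tm (t : N) : Prop :=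
  Deriv (fun z => (∃ i, z = cVar i) ∨ z = cZero ∨ z = cOne)
    (fun x y z => z = cAdd x y ∨ z = cMul x y) t

instance {S : Set (Set N)} [ACA S] {f : (ℕ → N) → N} [hf : TDef S f] :
    Def S (fun e => Tm (f e)) :=
  Def.subst hf (P := fun _ x => Tm x)
    (by unfold Tm cVar cZero cOne cAdd cMul; infer_instance)

theorem tm_iff {t : N} : Tm t ↔ ((∃ i, t = cVar i) ∨ t = cZero ∨ t = cOne) ∨
    ∃ x y, Tm x ∧ Tm y ∧ (t = cAdd x y ∨ t = cMul x y) := by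
  obtain ⟨S, hS⟩ := hN.exists_model
  exact deriv_iff (S := S) _ _ _

theorem Tm.isTerm {S : Set (Set N)} [ACA S] {t : N} (h : Tm t) : IsTerm S t := by
  refine ⟨{t | Tm t}, comp _, h, fun r hr => ?_⟩
  rcases tm_iff.1 hr with (h | h | h) | ⟨x, y, hx, hy, h | h⟩
  · exact Or.inl h
  · exact Or.inr (Or.inl h)
  · exact Or.inr (Or.inr (Or.inl h))
  · exact Or.inr (Or.inr (Or.inr (Or.inl ⟨x, hx, y, hy, h⟩)))
  · exact Or.inr (Or.inr (Or.inr (Or.inr ⟨x, hx, y, hy, h⟩)))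

theorem Term.tm_code (t : Term) : Tm (t.code : N) := by
  induction t with
  | var i => exact tm_iff.2 (Or.inl (Or.inl ⟨_, rfl⟩))
  | zero => exact tm_iff.2 (Or.inl (Or.inr (Or.inl rfl)))
  | one => exact tm_iff.2 (Or.inl (Or.inr (Or.inr rfl)))
  | add t u ih ih' => exact tm_iff.2 (Or.inr ⟨_, _, ih, ih', Or.inl rfl⟩)
  | mul t u ih ih' => exact tm_iff.2 (Or.inr ⟨_, _, ih, ih', Or.inr rfl⟩)

/-- `c` codes a formula; set quantifiers are allowed if `b` holds. -/
def Fm (b : Prop) (c : N) : Prop :=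
  Deriv
    (fun z => (∃ t u, Tm t ∧ Tm u ∧ z = cEq t u) ∨ (∃ t u, Tm t ∧ Tm u ∧ z = cLt t u) ∨
      ∃ t i, Tm t ∧ z = cMem t i)
    (fun x y z => z = cNot x ∨ z = cAnd x y ∨ z = cAll x ∨ (b ∧ z = cAllSet x)) c

instance {S : Set (Set N)} [ACA S] {b : Prop} {f : (ℕ → N) → N} [hf : TDef S f] :
    Def S (fun e => Fm b (f e)) :=
  Def.subst hf (P := fun _ x => Fm b x)
    (by unfold Fm cEq cLt cMem cNot cAnd cAll cAllSet; infer_instance)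

theorem fm_iff {b : Prop} {c : N} : Fm b c ↔
    ((∃ t u, Tm t ∧ Tm u ∧ c = cEq t u) ∨ (∃ t u, Tm t ∧ Tm u ∧ c = cLt t u) ∨
      ∃ t i, Tm t ∧ c = cMem t i) ∨
    ∃ x y, Fm b x ∧ Fm b y ∧ (c = cNot x ∨ c = cAnd x y ∨ c = cAll x ∨ (b ∧ c = cAllSet x)) := by
  obtain ⟨S, hS⟩ := hN.exists_model
  exact deriv_iff (S := S) _ _ _

theorem subformulaClosed_fm (S : Set (Set N)) [ACA S] (b : Prop) :
    SubformulaClosed S {c : N | Fm b c} := by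
  intro c hc
  rcases fm_iff.1 hc with (⟨t, u, ht, hu, h⟩ | ⟨t, u, ht, hu, h⟩ | ⟨t, i, ht, h⟩) |
    ⟨x, y, hx, hy, h | h | h | ⟨-, h⟩⟩
  · exact Or.inl ⟨t, u, ht.isTerm, hu.isTerm, h⟩
  · exact Or.inr (Or.inl ⟨t, u, ht.isTerm, hu.isTerm, h⟩)
  · exact Or.inr (Or.inr (Or.inl ⟨t, i, ht.isTerm, h⟩))
  · exact Or.inr (Or.inr (Or.inr (Or.inl ⟨x, hx, h⟩)))
  · exact Or.inr (Or.inr (Or.inr (Or.inr (Or.inl ⟨x, hx, y, hy, h⟩))))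
  · exact Or.inr (Or.inr (Or.inr (Or.inr (Or.inr (Or.inl ⟨x, hx, h⟩)))))
  · exact Or.inr (Or.inr (Or.inr (Or.inr (Or.inr (Or.inr ⟨x, hx, h⟩)))))

theorem not_fm_allSet {φ : N} : ¬ Fm False (cAllSet φ) := by
  rw [fm_iff]
  simp [cEq, cLt, cMem, cNot, cAnd, cAll, cAllSet]

theorem Fm.isFormula {S : Set (Set N)} [ACA S] {b : Prop} {c : N} (h : Fm b c) :
    IsFormula S c :=
  ⟨{c | Fm b c}, comp _, subformulaClosed_fm S b, h⟩

theorem Fm.isArithmetical {S : Set (Set N)} [ACA S] {c : N} (h : Fm False c) :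
    IsArithmetical S c :=
  ⟨{c | Fm False c}, comp _, subformulaClosed_fm S False, fun _ => not_fm_allSet, h⟩

end Codes

/-! ### Satisfaction in coded `ω`-models -/

section Satisfaction

variable {N : Type*} [CommSemiring N] [LinearOrder N] [IsStrictOrderedRing N]
  [CanonicallyOrderedAdd N] [hN : ACANumbers N]

/-- Tarski's clauses for the satisfaction relation `T` of the coded `ω`-model `M`. -/
def Clause (M T : Set N) (c e d : N) : Prop :=
  (∃ t u, c = cEq t u ∧ ∃ a, TV t e a ∧ TV u e a) ∨
  (∃ t u, c = cLt t u ∧ ∃ a b, TV t e a ∧ TV u e b ∧ a < b) ∨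
  (∃ t i, c = cMem t i ∧ ∃ a k, TV t e a ∧ TV (cVar i) d k ∧ pr a k ∈ M) ∨
  (∃ ψ, c = cNot ψ ∧ pr ψ (pr e d) ∉ T) ∨
  (∃ ψ χ, c = cAnd ψ χ ∧ pr ψ (pr e d) ∈ T ∧ pr χ (pr e d) ∈ T) ∨
  (∃ ψ, c = cAll ψ ∧ ∀ x, pr ψ (pr (pr x e) d) ∈ T) ∨
  (∃ ψ, c = cAllSet ψ ∧ ∀ k, pr ψ (pr e (pr k d)) ∈ T)

instance {S : Set (Set N)} [ACA S] {A B : (ℕ → N) → Set N} {f g h : (ℕ → N) → N}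
    [hA : SDef S A] [hB : SDef S B] [hf : TDef S f] [hg : TDef S g] [hh : TDef S h] :
    Def S (fun e => Clause (A e) (B e) (f e) (g e) (h e)) := by
  have := fun ρ => hA.shift ρ
  have := fun ρ => hB.shift ρ
  have := fun ρ => hf.comp_shift ρ
  have := fun ρ => hg.comp_shift ρ
  have := fun ρ => hh.comp_shift ρ
  unfold Clause cEq cLt cMem cNot cAnd cAll cAllSet cVar
  infer_instance

section

variable {M T : Set N} {e d : N}

theorem clause_eq {t u : N} : Clause M T (cEq t u) e d ↔ ∃ a, TV t e a ∧ TV u e a := by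
  simp [Clause, cEq, cLt, cMem, cNot, cAnd, cAll, cAllSet]

theorem clause_lt {t u : N} :
    Clause M T (cLt t u) e d ↔ ∃ a b, TV t e a ∧ TV u e b ∧ a < b := by
  simp [Clause, cEq, cLt, cMem, cNot, cAnd, cAll, cAllSet]

theorem clause_mem {t i : N} :
    Clause M T (cMem t i) e d ↔ ∃ a k, TV t e a ∧ TV (cVar i) d k ∧ pr a k ∈ M := by
  simp [Clause, cEq, cLt, cMem, cNot, cAnd, cAll, cAllSet]

theorem clause_not {ψ : N} : Clause M T (cNot ψ) e d ↔ pr ψ (pr e d) ∉ T := by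
  simp [Clause, cEq, cLt, cMem, cNot, cAnd, cAll, cAllSet]

theorem clause_and {ψ χ : N} :
    Clause M T (cAnd ψ χ) e d ↔ pr ψ (pr e d) ∈ T ∧ pr χ (pr e d) ∈ T := by
  simp [Clause, cEq, cLt, cMem, cNot, cAnd, cAll, cAllSet]

theorem clause_all {ψ : N} : Clause M T (cAll ψ) e d ↔ ∀ x, pr ψ (pr (pr x e) d) ∈ T := by
  simp [Clause, cEq, cLt, cMem, cNot, cAnd, cAll, cAllSet]

theorem clause_allSet {ψ : N} :
    Clause M T (cAllSet ψ) e d ↔ ∀ k, pr ψ (pr e (pr k d)) ∈ T := by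
  simp [Clause, cEq, cLt, cMem, cNot, cAnd, cAll, cAllSet]

theorem lt_cNot (ψ : N) : ψ < cNot ψ := lt_pr_num _ _
theorem lt_cAnd_left (ψ χ : N) : ψ < cAnd ψ χ := lt_pr_num_left _ _ _
theorem lt_cAnd_right (ψ χ : N) : χ < cAnd ψ χ := lt_pr_num_right _ _ _
theorem lt_cAll (ψ : N) : ψ < cAll ψ := lt_pr_num _ _
theorem lt_cAllSet (ψ : N) : ψ < cAllSet ψ := lt_pr_num _ _
theorem lt_cMem_right (t i : N) : i < cMem t i := lt_pr_num_right _ _ _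

/-- The satisfaction clauses for `c` depend on smaller formulas only. -/
theorem clause_congr {T' : Set N} {c : N}
    (h : ∀ c' < c, ∀ e d, pr c' (pr e d) ∈ T ↔ pr c' (pr e d) ∈ T') :
    Clause M T c e d ↔ Clause M T' c e d := by
  unfold Clause
  refine or_congr Iff.rfl (or_congr Iff.rfl (or_congr Iff.rfl (or_congr ?_ (or_congr ?_
    (or_congr ?_ ?_)))))
  · refine exists_congr fun ψ => and_congr_right fun hc => ?_
    subst hc; rw [h _ (lt_cNot ψ)]
  · refine exists_congr fun ψ => exists_congr fun χ => and_congr_right fun hc => ?_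
    subst hc; rw [h _ (lt_cAnd_left ψ χ), h _ (lt_cAnd_right ψ χ)]
  · refine exists_congr fun ψ => and_congr_right fun hc => forall_congr' fun x => ?_
    subst hc; rw [h _ (lt_cAll ψ)]
  · refine exists_congr fun ψ => and_congr_right fun hc => forall_congr' fun x => ?_
    subst hc; rw [h _ (lt_cAllSet ψ)]

end

/-- `T` satisfies Tarski's clauses for codes below `n`. -/
def Tarski (M T : Set N) (n : N) : Prop :=
  ∀ c < n, ∀ e d, pr c (pr e d) ∈ T ↔ Clause M T c e d

instance {S : Set (Set N)} [ACA S] {A B : (ℕ → N) → Set N} {f : (ℕ → N) → N}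
    [hA : SDef S A] [hB : SDef S B] [hf : TDef S f] :
    Def S (fun e => Tarski (A e) (B e) (f e)) := by
  have := fun ρ => hA.shift ρ
  have := fun ρ => hB.shift ρ
  have := fun ρ => hf.comp_shift ρ
  unfold Tarski
  infer_instance

/-- `T` is the full satisfaction relation of `M`. -/
def FullSat (M T : Set N) : Prop := ∀ c e d, pr c (pr e d) ∈ T ↔ Clause M T c e d

/-- The sets of the coded `ω`-model `W`. -/
def cols (W : Set N) : Set (Set N) := {Y | InModel W Y}

theorem column_mem_cols (W : Set N) (k : N) : column W k ∈ cols W := ⟨k, rfl⟩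

instance (W : Set N) (k : N) : InC (cols W) (column W k) := ⟨column_mem_cols W k⟩

theorem column_mem {S : Set (Set N)} [ACA S] {W : Set N} (hW : W ∈ S) (k : N) :
    column W k ∈ S := by
  have : InC S W := ⟨hW⟩
  exact comp (fun x => pr x k ∈ W)

theorem cols_subset {S : Set (Set N)} [ACA S] {W : Set N} (hW : W ∈ S) : cols W ⊆ S := by
  rintro Y ⟨k, rfl⟩
  exact column_mem hW k

theorem tarski_unique {S : Set (Set N)} [ACA S] {M T T' : Set N} (hM : M ∈ S) (hT : T ∈ S)
    (hT' : T' ∈ S) {n n' : N} (h : Tarski M T n) (h' : Tarski M T' n') :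
    ∀ c, c < n → c < n' → ∀ e d, pr c (pr e d) ∈ T ↔ pr c (pr e d) ∈ T' := by
  have : InC S T := ⟨hT⟩
  have : InC S T' := ⟨hT'⟩
  refine ACA.strong_ind (S := S) (fun c => c < n → c < n' → ∀ e d,
    pr c (pr e d) ∈ T ↔ pr c (pr e d) ∈ T') fun c ih hc hc' e d => ?_
  rw [h c hc, h' c hc']
  exact clause_congr fun c' hc'' => ih c' hc'' (hc''.trans hc) (hc''.trans hc')

/-- Partial satisfaction relations for an element of a coded `ω`-model of `ACA₀` exist in it. -/
theorem tarski_exists {S : Set (Set N)} [ACA S] {W M : Set N} (hW : W ∈ S) [hWA : ACA (cols W)]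
    (hM : M ∈ cols W) (n : N) : ∃ k, Tarski M (column W k) n := by
  have : InC S W := ⟨hW⟩
  have : InC S M := ⟨cols_subset hW hM⟩
  refine ACA.ind (S := S) (fun n => ∃ k, Tarski M (column W k) n) ?_ ?_ n
  · exact ⟨0, fun c hc => absurd hc not_lt_zero⟩
  · rintro n ⟨k, hk⟩
    have : InC (cols W) M := ⟨hM⟩
    -- The clauses for the code `n` are added to a relation that is correct below `n`; comprehension
    -- in `W` keeps the result among its columns.
    have : {z | ∃ c e d, z = pr c (pr e d) ∧ ((c ≠ n ∧ pr c (pr e d) ∈ column W k) ∨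
      (c = n ∧ Clause M (column W k) c e d))} ∈ cols W := comp _
    obtain ⟨k', hk'⟩ := this
    have key : ∀ c e d, pr c (pr e d) ∈ column W k' ↔ ((c ≠ n ∧ pr c (pr e d) ∈ column W k) ∨
      (c = n ∧ Clause M (column W k) c e d)) := by
      intro c e d
      rw [hk']
      constructor
      · rintro ⟨c', e', d', h, h'⟩
        simp only [pr_inj] at h
        obtain ⟨rfl, rfl, rfl⟩ := h
        exact h'
      · exact fun h => ⟨c, e, d, rfl, h⟩
    have hlt : ∀ c < n, ∀ e d, pr c (pr e d) ∈ column W k' ↔ pr c (pr e d) ∈ column W k := by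
      intro c hc e d
      rw [key]
      simp [hc.ne]
    refine ⟨k', fun c hc e d => ?_⟩
    rw [lt_add_one_iff] at hc
    have h2 : Clause M (column W k') c e d ↔ Clause M (column W k) c e d :=
      clause_congr fun c' hc' => hlt c' (hc'.trans_le hc)
    rw [h2]
    rcases hc.lt_or_eq with h | rfl
    · rw [hlt c h, hk c h]
    · rw [key]
      simp

/-- The full satisfaction relation of `M` exists if `M` lies in a coded `ω`-model of `ACA₀`. -/
theorem exists_fullSat {S : Set (Set N)} [ACA S] {W M : Set N} (hW : W ∈ S) [hWA : ACA (cols W)]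
    (hM : M ∈ cols W) : ∃ T ∈ S, FullSat M T := by
  have : InC S W := ⟨hW⟩
  have : InC S M := ⟨cols_subset hW hM⟩
  -- All partial satisfaction relations found in `W` are glued together. The definition quantifies
  -- over the columns of `W`, so the result lies in `S` but not necessarily in `W`.
  have hTS : {z | ∃ c e d, z = pr c (pr e d) ∧ ∃ k, Tarski M (column W k) (c + 1) ∧
    z ∈ column W k} ∈ S := comp _
  refine ⟨_, hTS, ?_⟩
  have key : ∀ k n c e d, c < n → Tarski M (column W k) n →
      (pr c (pr e d) ∈ {z | ∃ c e d, z = pr c (pr e d) ∧ ∃ k, Tarski M (column W k) (c + 1) ∧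
        z ∈ column W k} ↔ pr c (pr e d) ∈ column W k) := by
    intro k n c e d hc hk
    constructor
    · rintro ⟨c', e', d', h, k', hk', h'⟩
      simp only [pr_inj] at h
      obtain ⟨rfl, rfl, rfl⟩ := h
      exact (tarski_unique (cols_subset hW hM) (column_mem hW k') (column_mem hW k) hk' hk c
        (lt_add_one c) hc e d).1 h'
    · intro h
      exact ⟨c, e, d, rfl, k, fun c' hc' => hk c' (hc'.trans_le (add_one_le_iff.2 hc)), h⟩
  intro c e d
  obtain ⟨k, hk⟩ := tarski_exists hW hM (c + 1)
  rw [key k _ c e d (lt_add_one c) hk, hk c (lt_add_one c)]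
  exact clause_congr fun c' hc' e d => (key k _ c' e d (hc'.trans (lt_add_one c)) hk).symm

/-! ### Valuations -/

/-- Tarski's clauses on a set of codes. -/
def TarskiOn (D M T : Set N) : Prop :=
  ∀ c ∈ D, ∀ e d, pr c (pr e d) ∈ T ↔ Clause M T c e d

theorem FullSat.tarskiOn {M T : Set N} (h : FullSat M T) (D : Set N) : TarskiOn D M T :=
  fun c _ => h c

theorem isValuation_iff {S : Set (Set N)} [ACA S] {M T : Set N} {φ : N} :
    IsValuation S M φ T ↔
      T ∈ S ∧ ∃ D ∈ S, SubformulaClosed S D ∧ φ ∈ D ∧ TarskiOn D M T := by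
  unfold IsValuation
  refine and_congr_right fun hT => exists_congr fun D => and_congr_right fun hD =>
    and_congr_right fun hcl => and_congr_right fun hφ => ?_
  simp only [termVal_iff]
  constructor
  · intro h c hc e d
    obtain ⟨h1, h2, h3, h4, h5, h6, h7⟩ := h e d
    rcases hcl c hc with ⟨t, u, -, -, rfl⟩ | ⟨t, u, -, -, rfl⟩ | ⟨t, i, -, rfl⟩ | ⟨ψ, -, rfl⟩ |
      ⟨ψ, -, χ, -, rfl⟩ | ⟨ψ, -, rfl⟩ | ⟨ψ, -, rfl⟩
    · rw [h1 _ _ hc, clause_eq]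
      constructor
      · rintro ⟨a, b, ha, hb, rfl⟩; exact ⟨a, ha, hb⟩
      · rintro ⟨a, ha, hb⟩; exact ⟨a, a, ha, hb, rfl⟩
    · rw [h2 _ _ hc, clause_lt]
    · rw [h3 _ _ hc, clause_mem]; rfl
    · rw [h4 _ hc, clause_not]
    · rw [h5 _ _ hc, clause_and]
    · rw [h6 _ hc, clause_all]
    · rw [h7 _ hc, clause_allSet]
  · intro h e d
    refine ⟨fun t u hc => ?_, fun t u hc => ?_, fun t i hc => ?_, fun ψ hc => ?_,
      fun ψ χ hc => ?_, fun ψ hc => ?_, fun ψ hc => ?_⟩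
    · rw [h _ hc, clause_eq]
      constructor
      · rintro ⟨a, ha, hb⟩; exact ⟨a, a, ha, hb, rfl⟩
      · rintro ⟨a, b, ha, hb, rfl⟩; exact ⟨a, ha, hb⟩
    · rw [h _ hc, clause_lt]
    · rw [h _ hc, clause_mem]; rfl
    · rw [h _ hc, clause_not]
    · rw [h _ hc, clause_and]
    · rw [h _ hc, clause_all]
    · rw [h _ hc, clause_allSet]

section Closed

variable {S : Set (Set N)} {D : Set N} (hD : SubformulaClosed S D)

include hD

theorem SubformulaClosed.not {ψ : N} (h : cNot ψ ∈ D) : ψ ∈ D := by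
  have := hD _ h
  simp [cEq, cLt, cMem, cNot, cAnd, cAll, cAllSet] at this
  exact this

theorem SubformulaClosed.and {ψ χ : N} (h : cAnd ψ χ ∈ D) : ψ ∈ D ∧ χ ∈ D := by
  have := hD _ h
  simp [cEq, cLt, cMem, cNot, cAnd, cAll, cAllSet] at this
  exact this

theorem SubformulaClosed.all {ψ : N} (h : cAll ψ ∈ D) : ψ ∈ D := by
  have := hD _ h
  simp [cEq, cLt, cMem, cNot, cAnd, cAll, cAllSet] at this
  exact this

theorem SubformulaClosed.allSet {ψ : N} (h : cAllSet ψ ∈ D) : ψ ∈ D := by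
  have := hD _ h
  simp [cEq, cLt, cMem, cNot, cAnd, cAll, cAllSet] at this
  exact this

end Closed

/-- Valuations are unique on subformula-closed domains, by induction on codes; truth under any given
valuation can thus be computed with the full satisfaction relation. -/
theorem TarskiOn.eq_fullSat {S : Set (Set N)} [ACA S] {D M T T' : Set N} (hDS : D ∈ S)
    (hTS : T ∈ S) (hTS' : T' ∈ S) (hD : SubformulaClosed S D) (hT : TarskiOn D M T)
    (hT' : FullSat M T') : ∀ c ∈ D, ∀ e d, pr c (pr e d) ∈ T ↔ pr c (pr e d) ∈ T' := by
  have : InC S T := ⟨hTS⟩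
  have : InC S T' := ⟨hTS'⟩
  have : InC S D := ⟨hDS⟩
  refine ACA.strong_ind (S := S) (fun c => c ∈ D → ∀ e d,
    pr c (pr e d) ∈ T ↔ pr c (pr e d) ∈ T') fun c ih hc e d => ?_
  rw [hT c hc, hT' c]
  rcases hD c hc with ⟨t, u, -, -, rfl⟩ | ⟨t, u, -, -, rfl⟩ | ⟨t, i, -, rfl⟩ | ⟨ψ, h, rfl⟩ |
      ⟨ψ, h, χ, h', rfl⟩ | ⟨ψ, h, rfl⟩ | ⟨ψ, h, rfl⟩
  · simp only [clause_eq]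
  · simp only [clause_lt]
  · simp only [clause_mem]
  · rw [clause_not, clause_not, ih _ (lt_cNot _) h]
  · rw [clause_and, clause_and, ih _ (lt_cAnd_left _ _) h, ih _ (lt_cAnd_right _ _) h']
  · simp only [clause_all, ih _ (lt_cAll _) h]
  · simp only [clause_allSet, ih _ (lt_cAllSet _) h]

/-! ### Standard formulas -/

/-- Formulas of second-order arithmetic, in which (possibly nonstandard) codes of formulas may occur
as atoms. -/
inductive Form (N : Type*) : Type _
  | eq (t u : Term) : Form N
  | lt (t u : Term) : Form N
  | mem (t : Term) (i : ℕ) : Form N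
  | not (φ : Form N) : Form N
  | and (φ ψ : Form N) : Form N
  | all (φ : Form N) : Form N
  | allSet (φ : Form N) : Form N
  | hole (c : N) : Form N

/-- The code of a formula. -/
def Form.code : Form N → N
  | .eq t u => cEq t.code u.code
  | .lt t u => cLt t.code u.code
  | .mem t i => cMem t.code (num i)
  | .not φ => cNot φ.code
  | .and φ ψ => cAnd φ.code ψ.code
  | .all φ => cAll φ.code
  | .allSet φ => cAllSet φ.code
  | .hole c => c

/-- Truth of a formula in the coded `ω`-model `W`, where `T` is used to evaluate coded formulas. -/
def Form.Holds (W T : Set N) : Form N → N → N → Prop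
  | .eq t u, e, _ => t.val (dec e) = u.val (dec e)
  | .lt t u, e, _ => t.val (dec e) < u.val (dec e)
  | .mem t i, e, d => t.val (dec e) ∈ column W (dec d i)
  | .not φ, e, d => ¬ φ.Holds W T e d
  | .and φ ψ, e, d => φ.Holds W T e d ∧ ψ.Holds W T e d
  | .all φ, e, d => ∀ x, φ.Holds W T (pr x e) d
  | .allSet φ, e, d => ∀ k, φ.Holds W T e (pr k d)
  | .hole c, e, d => pr c (pr e d) ∈ T

/-- This is the bridge from coded truth to truth in Lean. The induction runs over standard syntax
only and stops at a hole, whose code may be nonstandard. -/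
theorem Form.holds_iff {S : Set (Set N)} {D W T : Set N} (hD : SubformulaClosed S D)
    (hT : TarskiOn D W T) (φ : Form N) : ∀ {e d : N}, Asg e → Asg d → φ.code ∈ D →
    (pr φ.code (pr e d) ∈ T ↔ φ.Holds W T e d) := by
  induction φ with
  | eq t u =>
    intro e d he hd h
    rw [hT _ h, Form.code, clause_eq, Form.Holds]
    simp only [tv_code he]
    exact ⟨fun ⟨a, h, h'⟩ => h.symm.trans h', fun h => ⟨_, rfl, h⟩⟩
  | lt t u =>
    intro e d he hd h
    rw [hT _ h, Form.code, clause_lt, Form.Holds]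
    simp only [tv_code he]
    exact ⟨fun ⟨a, b, h, h', h''⟩ => h ▸ h' ▸ h'', fun h => ⟨_, _, rfl, rfl, h⟩⟩
  | mem t i =>
    intro e d he hd h
    rw [hT _ h, Form.code, clause_mem, Form.Holds]
    simp only [tv_code he, tv_var hd]
    exact ⟨fun ⟨a, b, h, h', h''⟩ => h ▸ h' ▸ h'', fun h => ⟨_, _, rfl, rfl, h⟩⟩
  | not φ ih =>
    intro e d he hd h
    rw [hT _ h, Form.code, clause_not, Form.Holds, ih he hd (hD.not h)]
  | and φ ψ ih ih' =>
    intro e d he hd h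
    rw [hT _ h, Form.code, clause_and, Form.Holds, ih he hd (hD.and h).1, ih' he hd (hD.and h).2]
  | all φ ih =>
    intro e d he hd h
    rw [hT _ h, Form.code, clause_all, Form.Holds]
    exact forall_congr' fun x => ih he.pr hd (hD.all h)
  | allSet φ ih =>
    intro e d he hd h
    rw [hT _ h, Form.code, clause_allSet, Form.Holds]
    exact forall_congr' fun x => ih he hd.pr (hD.allSet h)
  | hole c => intro e d he hd h; rfl

/-- The coded formulas in `φ` are genuine formulas. -/
def Form.Ok (b : Prop) : Form N → Prop
  | .not φ => φ.Ok b
  | .and φ ψ => φ.Ok b ∧ ψ.Ok b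
  | .all φ => φ.Ok b
  | .allSet φ => b ∧ φ.Ok b
  | .hole c => Fm b c
  | _ => True

theorem Form.Ok.fm {b : Prop} {φ : Form N} (h : φ.Ok b) : Fm b φ.code := by
  induction φ with
  | eq t u => exact fm_iff.2 (Or.inl (Or.inl ⟨_, _, t.tm_code, u.tm_code, rfl⟩))
  | lt t u => exact fm_iff.2 (Or.inl (Or.inr (Or.inl ⟨_, _, t.tm_code, u.tm_code, rfl⟩)))
  | mem t i => exact fm_iff.2 (Or.inl (Or.inr (Or.inr ⟨_, _, t.tm_code, rfl⟩)))
  | not φ ih => exact fm_iff.2 (Or.inr ⟨_, _, ih h, ih h, Or.inl rfl⟩)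
  | and φ ψ ih ih' => exact fm_iff.2 (Or.inr ⟨_, _, ih h.1, ih' h.2, Or.inr (Or.inl rfl)⟩)
  | all φ ih => exact fm_iff.2 (Or.inr ⟨_, _, ih h, ih h, Or.inr (Or.inr (Or.inl rfl))⟩)
  | allSet φ ih =>
    exact fm_iff.2 (Or.inr ⟨_, _, ih h.2, ih h.2, Or.inr (Or.inr (Or.inr ⟨h.1, rfl⟩))⟩)
  | hole c => exact h

/-- Arithmetical formulas as formulas. -/
def Form.ofArith : ArithFormula → Form N
  | .eq t u => .eq t u
  | .lt t u => .lt t u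
  | .mem t i => .mem t i
  | .not φ => .not (ofArith φ)
  | .and φ ψ => .and (ofArith φ) (ofArith ψ)
  | .all φ => .all (ofArith φ)

theorem Form.ok_ofArith (b : Prop) (φ : ArithFormula) : (Form.ofArith φ : Form N).Ok b := by
  induction φ <;> simp_all [Form.ofArith, Form.Ok]

theorem Form.holds_ofArith (W T : Set N) (φ : ArithFormula) : ∀ e d : N,
    (Form.ofArith φ).Holds W T e d ↔ φ.Holds (dec e) (fun i => column W (dec d i)) := by
  induction φ with
  | all φ ih => intro e d; simp only [Form.ofArith, Form.Holds, ArithFormula.Holds, ih, dec_pr]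
  | _ => intro e d; simp_all [Form.ofArith, Form.Holds, ArithFormula.Holds]

/-! ### Finite support -/

theorem Term.val_congr (t : Term) : ∃ n, ∀ e e' : ℕ → N, (∀ i < n, e i = e' i) →
    t.val e = t.val e' := by
  induction t with
  | var i => exact ⟨i + 1, fun e e' h => h i (Nat.lt_succ_self i)⟩
  | zero => exact ⟨0, fun _ _ _ => rfl⟩
  | one => exact ⟨0, fun _ _ _ => rfl⟩
  | add t u ih ih' =>
    obtain ⟨n, hn⟩ := ih
    obtain ⟨m, hm⟩ := ih'
    refine ⟨n + m, fun e e' h => ?_⟩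
    rw [Term.val, Term.val, hn e e' fun i hi => h i (by omega), hm e e' fun i hi => h i (by omega)]
  | mul t u ih ih' =>
    obtain ⟨n, hn⟩ := ih
    obtain ⟨m, hm⟩ := ih'
    refine ⟨n + m, fun e e' h => ?_⟩
    rw [Term.val, Term.val, hn e e' fun i hi => h i (by omega), hm e e' fun i hi => h i (by omega)]

/-- An external sequence `ℕ → N` need not be coded in `N`. A standard formula looks only at a finite
part of it, and `exists_asg` codes that part. -/
theorem ArithFormula.holds_congr (φ : ArithFormula) : ∃ n, ∀ (e e' : ℕ → N) (d d' : ℕ → Set N),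
    (∀ i < n, e i = e' i) → (∀ i < n, d i = d' i) → (φ.Holds e d ↔ φ.Holds e' d') := by
  induction φ with
  | eq t u =>
    obtain ⟨n, hn⟩ := t.val_congr (N := N)
    obtain ⟨m, hm⟩ := u.val_congr (N := N)
    refine ⟨n + m, fun e e' d d' h _ => ?_⟩
    rw [Holds, Holds, hn e e' fun i hi => h i (by omega), hm e e' fun i hi => h i (by omega)]
  | lt t u =>
    obtain ⟨n, hn⟩ := t.val_congr (N := N)
    obtain ⟨m, hm⟩ := u.val_congr (N := N)
    refine ⟨n + m, fun e e' d d' h _ => ?_⟩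
    rw [Holds, Holds, hn e e' fun i hi => h i (by omega), hm e e' fun i hi => h i (by omega)]
  | mem t i =>
    obtain ⟨n, hn⟩ := t.val_congr (N := N)
    refine ⟨n + i + 1, fun e e' d d' h h' => ?_⟩
    rw [Holds, Holds, hn e e' fun i hi => h i (by omega), h' i (by omega)]
  | not φ ih =>
    obtain ⟨n, hn⟩ := ih
    exact ⟨n, fun e e' d d' h h' => not_congr (hn e e' d d' h h')⟩
  | and φ ψ ih ih' =>
    obtain ⟨n, hn⟩ := ih
    obtain ⟨m, hm⟩ := ih'
    exact ⟨n + m, fun e e' d d' h h' => and_congr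
      (hn e e' d d' (fun i hi => h i (by omega)) (fun i hi => h' i (by omega)))
      (hm e e' d d' (fun i hi => h i (by omega)) (fun i hi => h' i (by omega)))⟩
  | all φ ih =>
    obtain ⟨n, hn⟩ := ih
    refine ⟨n, fun e e' d d' h h' => forall_congr' fun x => hn _ _ _ _ (fun i hi => ?_) h'⟩
    cases i with
    | zero => rfl
    | succ i => exact h i (by omega)

theorem exists_asg (f : ℕ → N) (n : ℕ) : ∃ e : N, Asg e ∧ ∀ i < n, dec e i = f i := by
  induction n generalizing f with
  | zero => exact ⟨0, asg_zero, fun i hi => by omega⟩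
  | succ n ih =>
    obtain ⟨e, he, h⟩ := ih (fun i => f (i + 1))
    refine ⟨pr (f 0) e, he.pr, fun i hi => ?_⟩
    cases i with
    | zero => simp
    | succ i => simpa using h i (by omega)

/-- The sets of a coded `ω`-model that satisfies `ACA₀` form a model of `ACA₀`. -/
theorem SatACA0.aca {S : Set (Set N)} [hS : ACA S] {W : Set N} (hW : W ∈ S) (h : SatACA0 S W) :
    ACA (cols W) := by
  refine ⟨⟨⟨_, column_mem_cols W 0⟩, hS.model.succ_ne_zero, hS.model.succ_inj, hS.model.add_zero,
    hS.model.add_succ, hS.model.mul_zero, hS.model.mul_succ, hS.model.not_lt_zero,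
    hS.model.lt_succ, fun X hX => hS.model.induction X (cols_subset hW hX), fun φ e d hd => ?_⟩⟩
  choose k hk using hd
  obtain ⟨n, hn⟩ := φ.holds_congr (N := N)
  obtain ⟨e', he', he⟩ := exists_asg e n
  obtain ⟨d', hd', hd⟩ := exists_asg k n
  have hok := Form.ok_ofArith (N := N) False φ
  obtain ⟨T, hT, hT'⟩ := h _ (hok.fm.isArithmetical (S := S))
  obtain ⟨hTS, D, hDS, hD, hφ, hTD⟩ := isValuation_iff.1 hT
  obtain ⟨j, hj⟩ := hT' e' d' (isAssignment_iff.2 he') (isAssignment_iff.2 hd')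
  refine ⟨j, ?_⟩
  ext x
  rw [hj, Form.holds_iff hD hTD _ he'.pr hd' hφ, Form.holds_ofArith, dec_pr]
  refine hn _ _ _ _ (fun i hi => ?_) (fun i hi => ?_)
  · cases i with
    | zero => rfl
    | succ i => exact he i (by omega)
  · rw [hd i hi, hk]

end Satisfaction

/-! ### Closure conditions for `ACA₀` -/

section Closure

variable {N : Type*} [CommSemiring N] [LinearOrder N] [IsStrictOrderedRing N]
  [CanonicallyOrderedAdd N] [hN : ACANumbers N]

/-- If the sets of `M` form a model of `ACA₀`, then comprehension holds in `M` for all codes of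
arithmetical formulas. -/
theorem satACA0_of_aca {S : Set (Set N)} [hS : ACA S] {M T : Set N} (hM : M ∈ S)
    [hMA : ACA (cols M)] (hTS : T ∈ S) (hT : FullSat M T) : SatACA0 S M := by
  rintro φ ⟨D, hDS, hD, hDs, hφ⟩
  refine ⟨T, isValuation_iff.2 ⟨hTS, D, hDS, hD, hφ, hT.tarskiOn D⟩, fun e d he hd => ?_⟩
  rw [isAssignment_iff] at hd
  have : InC S T := ⟨hTS⟩
  have : InC S D := ⟨hDS⟩
  have : InC S M := ⟨hM⟩
  -- A column collects all number assignments satisfying `c` at once, which makes the quantifier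
  -- clause a comprehension over one column. The set assignment `d` can stay fixed because set
  -- quantifiers do not occur in `D`.
  have key : ∀ c, c ∈ D → ∃ k, ∀ e, e ∈ column M k ↔ pr c (pr e d) ∈ T := by
    refine ACA.strong_ind (S := S) (fun c => c ∈ D → ∃ k, ∀ e, e ∈ column M k ↔
      pr c (pr e d) ∈ T) fun c ih hc => ?_
    suffices h : {e | pr c (pr e d) ∈ T} ∈ cols M by
      obtain ⟨k, hk⟩ := h
      exact ⟨k, fun e => by rw [hk]; rfl⟩
    rcases hD c hc with ⟨t, u, -, -, rfl⟩ | ⟨t, u, -, -, rfl⟩ | ⟨t, i, -, rfl⟩ | ⟨ψ, h, rfl⟩ |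
      ⟨ψ, h, χ, h', rfl⟩ | ⟨ψ, h, rfl⟩ | ⟨ψ, h, rfl⟩
    · simp only [hT _ _ _, clause_eq]
      exact comp _
    · simp only [hT _ _ _, clause_lt]
      exact comp _
    · obtain ⟨k, hk⟩ := hd i
      have h1 : ∀ e, pr (cMem t i) (pr e d) ∈ T ↔ ∃ a, TV t e a ∧ a ∈ column M k := by
        intro e
        rw [hT, clause_mem]
        constructor
        · rintro ⟨a, k', ha, hk', h⟩
          obtain rfl := tv_functional hk hk'
          exact ⟨a, ha, h⟩
        · rintro ⟨a, ha, h⟩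
          exact ⟨a, k, ha, hk, h⟩
      simp only [h1]
      exact comp _
    · obtain ⟨k, hk⟩ := ih _ (lt_cNot ψ) h
      simp only [hT (cNot ψ), clause_not]
      simp only [← hk]
      exact comp _
    · obtain ⟨k, hk⟩ := ih _ (lt_cAnd_left _ _) h
      obtain ⟨k', hk'⟩ := ih _ (lt_cAnd_right _ _) h'
      simp only [hT (cAnd ψ χ), clause_and]
      simp only [← hk, ← hk']
      exact comp _
    · obtain ⟨k, hk⟩ := ih _ (lt_cAll _) h
      simp only [hT (cAll ψ), clause_all]
      simp only [← hk]
      exact comp _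
    · exact absurd hc (hDs ψ)
  obtain ⟨k, hk⟩ := key φ hφ
  have h1 : {x | pr x e ∈ column M k} ∈ cols M := comp _
  obtain ⟨j, hj⟩ := h1
  exact ⟨j, fun x => by rw [hj, ← hk]; rfl⟩

@[simp] theorem pr_num_ne_zero (k : ℕ) (b : N) : pr (num (k + 1)) b ≠ 0 :=
  ((zero_le).trans_lt (lt_pr_num k b)).ne'

/-- The columns of `B` contain the graphs and relations that are needed to evaluate atomic
formulas. -/
structure Rich (B : Set N) : Prop where
  slice : ∀ p, ∃ c, ∀ x z, pr x z ∈ column B c ↔ z = pr x p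
  term : ∀ t : Term, ∃ c, ∀ e a, pr e a ∈ column B c ↔ TV t.code e a
  eq : ∀ t u : Term, ∃ c, ∀ e, e ∈ column B c ↔ ∃ a, TV t.code e a ∧ TV u.code e a
  lt : ∀ t u : Term, ∃ c, ∀ e, e ∈ column B c ↔ ∃ a b, TV t.code e a ∧ TV u.code e b ∧ a < b

theorem exists_rich {S : Set (Set N)} [hS : ACA S] {U X : Set N} (hU : U ∈ S) (hX : X ∈ S) :
    ∃ B ∈ S, Rich B ∧ column B 0 = U ∧ ∃ c, column B c = X := by
  have : InC S U := ⟨hU⟩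
  have : InC S X := ⟨hX⟩
  -- Column `0` is reserved for `U`. The other columns carry tagged indices, which are nonzero: tags
  -- 1 to 4 for the slices, term graphs and atomic relations, tag 5 for `X`.
  have h : {w | ∃ z c, w = pr z c ∧ ((c = 0 ∧ z ∈ U) ∨
    (∃ p x, c = pr (num 1) p ∧ z = pr x (pr x p)) ∨
    (∃ t e a, c = pr (num 2) t ∧ z = pr e a ∧ TV t e a) ∨
    (∃ t u a, c = pr (num 3) (pr t u) ∧ TV t z a ∧ TV u z a) ∨
    (∃ t u a b, c = pr (num 4) (pr t u) ∧ TV t z a ∧ TV u z b ∧ a < b) ∨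
    (c = pr (num 5) 0 ∧ z ∈ X))} ∈ S := comp _
  refine ⟨_, h, ⟨fun p => ⟨pr (num 1) p, fun x z => ?_⟩, fun t => ⟨pr (num 2) t.code, fun e a => ?_⟩,
    fun t u => ⟨pr (num 3) (pr t.code u.code), fun e => ?_⟩,
    fun t u => ⟨pr (num 4) (pr t.code u.code), fun e => ?_⟩⟩, ?_, pr (num 5) 0, ?_⟩
  · simp [column]
  · simp [column]
  · simp [column]
  · simp [column]
  · ext z; simp [column, (pr_num_ne_zero _ _).symm]
  · ext z; simp [column]

/-- A closure criterion for models of `ACA₀`. -/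
theorem aca_of_closed {S C : Set (Set N)} [hS : ACA S] (hC : C ⊆ S) {B : Set N} (hB : Rich B)
    (base : ∀ p, column B p ∈ C)
    (nand : ∀ A ∈ C, ∀ A' ∈ C, {x | ¬ (x ∈ A ∧ x ∈ A')} ∈ C)
    (ex : ∀ A ∈ C, {e | ∃ x, pr x e ∈ A} ∈ C)
    (pull : ∀ c, (∀ x a b, pr x a ∈ column B c → pr x b ∈ column B c → a = b) → ∀ A ∈ C,
      ∃ A' ∈ C, ∀ x a, pr x a ∈ column B c → (x ∈ A' ↔ a ∈ A)) : ACA C := by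
  have compl : ∀ A ∈ C, {x | x ∉ A} ∈ C := by
    intro A hA
    have := nand A hA A hA
    simpa only [and_self] using this
  -- A formula defines a set of coded assignments, so that `∀` becomes complementation and
  -- projection; only the elements satisfying `Asg` matter.
  have key : ∀ (φ : ArithFormula) (d : ℕ → Set N), (∀ i, d i ∈ C) →
      ∃ A ∈ C, ∀ e, Asg e → (e ∈ A ↔ φ.Holds (dec e) d) := by
    intro φ d hd
    induction φ with
    | eq t u =>
      obtain ⟨c, hc⟩ := hB.eq t u
      refine ⟨_, base c, fun e he => ?_⟩
      rw [hc]
      simp only [tv_code he, ArithFormula.Holds]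
      exact ⟨fun ⟨a, h, h'⟩ => h.symm.trans h', fun h => ⟨_, rfl, h⟩⟩
    | lt t u =>
      obtain ⟨c, hc⟩ := hB.lt t u
      refine ⟨_, base c, fun e he => ?_⟩
      rw [hc]
      simp only [tv_code he, ArithFormula.Holds]
      exact ⟨fun ⟨a, b, h, h', h''⟩ => h ▸ h' ▸ h'', fun h => ⟨_, _, rfl, rfl, h⟩⟩
    -- Membership of a term value is the preimage of `d i` under the graph of the term, a column of
    -- `B`.
    | mem t i =>
      obtain ⟨c, hc⟩ := hB.term t
      obtain ⟨A', hA', h⟩ := pull c (fun x a b h h' => tv_functional ((hc _ _).1 h) ((hc _ _).1 h'))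
        (d i) (hd i)
      refine ⟨A', hA', fun e he => ?_⟩
      exact h e _ ((hc _ _).2 ((tv_code he t).2 rfl))
    | not φ ih =>
      obtain ⟨A, hA, h⟩ := ih
      exact ⟨_, compl A hA, fun e he => not_congr (h e he)⟩
    | and φ ψ ih ih' =>
      obtain ⟨A, hA, h⟩ := ih
      obtain ⟨A', hA', h'⟩ := ih'
      refine ⟨_, compl _ (nand A hA A' hA'), fun e he => ?_⟩
      simp only [Set.mem_ofPred_eq, not_not, ArithFormula.Holds, h e he, h' e he]
    | all φ ih =>
      obtain ⟨A, hA, h⟩ := ih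
      refine ⟨_, compl _ (ex _ (compl A hA)), fun e he => ?_⟩
      simp only [Set.mem_ofPred_eq, not_exists, not_not, ArithFormula.Holds, h _ he.pr, dec_pr]
  refine ⟨⟨⟨_, base 0⟩, hS.model.succ_ne_zero, hS.model.succ_inj, hS.model.add_zero,
    hS.model.add_succ, hS.model.mul_zero, hS.model.mul_succ, hS.model.not_lt_zero,
    hS.model.lt_succ, fun X hX => hS.model.induction X (hC hX), fun φ e d hd => ?_⟩⟩
  obtain ⟨n, hn⟩ := φ.holds_congr (N := N)
  obtain ⟨p, hp, he⟩ := exists_asg e n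
  obtain ⟨A, hA, h⟩ := key φ d hd
  -- The number parameters are coded by `p`. Pulling `A` back along `x ↦ ⟨x, p⟩` inserts them and
  -- leaves `x` as the only variable.
  obtain ⟨c, hc⟩ := hB.slice p
  obtain ⟨A', hA', h'⟩ := pull c (fun x a b h h' => by rw [hc] at h h'; rw [h, h']) A hA
  convert hA' using 1
  ext x
  rw [h' x _ ((hc _ _).2 rfl), h _ hp.pr, dec_pr]
  refine hn _ _ _ _ (fun i hi => ?_) (fun i hi => rfl)
  cases i with
  | zero => rfl
  | succ i => exact (he i (by omega)).symm

end Closure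

/-! ### Finite sequences, trees and paths -/

section Sequences

variable {N : Type*} [CommSemiring N] [LinearOrder N] [IsStrictOrderedRing N]
  [CanonicallyOrderedAdd N] [hN : ACANumbers N]

/-- The extension of the sequence `s` by a last entry `v`; the empty sequence is `0`. -/
def cons (v s : N) : N := pr v s + 1

instance {S : Set (Set N)} [ACA S] {f g : (ℕ → N) → N} [hf : TDef S f] [hg : TDef S g] :
    TDef S (fun e => cons (f e) (g e)) := by unfold cons; infer_instance

@[simp] theorem cons_inj {v s w t : N} : cons v s = cons w t ↔ v = w ∧ s = t := by
  rw [cons, cons, add_left_inj, pr_inj]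

@[simp] theorem cons_ne_zero (v s : N) : cons v s ≠ 0 := succ_ne_zero' _
@[simp] theorem zero_ne_cons (v s : N) : 0 ≠ cons v s := (cons_ne_zero v s).symm

theorem lt_cons (v s : N) : s < cons v s := lt_add_one_iff.2 (le_pr_right v s)

/-- `s` codes a sequence of length `m`. -/
def Len (s m : N) : Prop :=
  Deriv (fun z => z = pr 0 0)
    (fun x y z => ∃ s m v, x = pr s m ∧ z = pr (cons v s) (m + 1)) (pr s m)

instance {S : Set (Set N)} [ACA S] {f g : (ℕ → N) → N} [hf : TDef S f] [hg : TDef S g] :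
    Def S (fun e => Len (f e) (g e)) :=
  Def.subst₂ hf hg (P := Len) (by unfold Len; infer_instance)

theorem len_iff {s m : N} : Len s m ↔
    (s = 0 ∧ m = 0) ∨ ∃ s' m' v, Len s' m' ∧ s = cons v s' ∧ m = m' + 1 := by
  obtain ⟨S, hS⟩ := hN.exists_model
  rw [Len, deriv_iff (S := S), pr_inj]
  refine or_congr Iff.rfl ⟨?_, ?_⟩
  · rintro ⟨x, y, hx, hy, s', m', v, rfl, h⟩
    exact ⟨s', m', v, hx, pr_inj.1 h⟩
  · rintro ⟨s', m', v, h, rfl, rfl⟩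
    exact ⟨_, _, h, h, s', m', v, rfl, rfl⟩

@[simp] theorem len_zero {m : N} : Len 0 m ↔ m = 0 := by
  rw [len_iff]; simp

@[simp] theorem len_cons {v s m : N} : Len (cons v s) m ↔ ∃ m', m = m' + 1 ∧ Len s m' := by
  rw [len_iff]; simp only [cons_ne_zero, false_and, false_or, cons_inj]
  constructor
  · rintro ⟨s', m', v', h, ⟨rfl, rfl⟩, rfl⟩; exact ⟨m', rfl, h⟩
  · rintro ⟨m', rfl, h⟩; exact ⟨s, m', v, h, ⟨rfl, rfl⟩, rfl⟩

/-- `s` codes a sequence. -/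
def IsSeq (s : N) : Prop := ∃ m, Len s m

instance {S : Set (Set N)} [ACA S] {f : (ℕ → N) → N} [hf : TDef S f] :
    Def S (fun e => IsSeq (f e)) :=
  Def.subst hf (P := fun _ x => IsSeq x) (by unfold IsSeq; infer_instance)

@[simp] theorem isSeq_zero : IsSeq (0 : N) := ⟨0, len_zero.2 rfl⟩

@[simp] theorem isSeq_cons {v s : N} : IsSeq (cons v s) ↔ IsSeq s := by
  simp [IsSeq, exists_comm]

theorem isSeq_cases {s : N} (h : IsSeq s) : s = 0 ∨ ∃ v t, s = cons v t ∧ IsSeq t := by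
  obtain ⟨m, hm⟩ := h
  rcases len_iff.1 hm with ⟨h, -⟩ | ⟨t, m', v, h, rfl, -⟩
  · exact Or.inl h
  · exact Or.inr ⟨v, t, rfl, m', h⟩

theorem seq_ind {S : Set (Set N)} [ACA S] (P : N → Prop) [Def S (fun e => P (e 0))] (h0 : P 0)
    (h1 : ∀ s v, IsSeq s → P s → P (cons v s)) (s : N) (hs : IsSeq s) : P s := by
  refine ACA.strong_ind (S := S) (fun s => IsSeq s → P s) (fun s ih hs => ?_) s hs
  rcases isSeq_cases hs with rfl | ⟨v, t, rfl, ht⟩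
  · exact h0
  · exact h1 t v ht (ih t (lt_cons v t) ht)

/-- The sequence `s` has the entry `v` at position `i`. -/
def At (s i v : N) : Prop :=
  Deriv (fun z => ∃ s v m, z = pr (cons v s) (pr m v) ∧ Len s m)
    (fun x y z => ∃ s w k, x = pr s k ∧ z = pr (cons w s) k) (pr s (pr i v))

instance {S : Set (Set N)} [ACA S] {f g h : (ℕ → N) → N} [hf : TDef S f] [hg : TDef S g]
    [hh : TDef S h] : Def S (fun e => At (f e) (g e) (h e)) :=
  Def.subst₃ hf hg hh (P := At) (by unfold At; infer_instance)

theorem at_iff {s i v : N} : At s i v ↔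
    (∃ s', s = cons v s' ∧ Len s' i) ∨ ∃ s' w, s = cons w s' ∧ At s' i v := by
  obtain ⟨S, hS⟩ := hN.exists_model
  rw [At, deriv_iff (S := S)]
  refine or_congr ⟨?_, ?_⟩ ⟨?_, ?_⟩
  · rintro ⟨s', v', m, h, h'⟩
    simp only [pr_inj] at h
    obtain ⟨rfl, rfl, rfl⟩ := h
    exact ⟨s', rfl, h'⟩
  · rintro ⟨s', rfl, h⟩
    exact ⟨s', v, i, rfl, h⟩
  · rintro ⟨x, y, hx, hy, s', w, k, rfl, h⟩
    obtain ⟨rfl, rfl⟩ := pr_inj.1 h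
    exact ⟨s', w, rfl, hx⟩
  · rintro ⟨s', w, rfl, h⟩
    exact ⟨_, _, h, h, s', w, _, rfl, rfl⟩

@[simp] theorem not_at_zero {i v : N} : ¬ At 0 i v := by
  rw [at_iff]; simp

theorem at_cons {w s i v : N} : At (cons w s) i v ↔ (v = w ∧ Len s i) ∨ At s i v := by
  rw [at_iff]
  simp only [cons_inj]
  refine or_congr ⟨?_, ?_⟩ ⟨?_, ?_⟩
  · rintro ⟨s', ⟨rfl, rfl⟩, h⟩; exact ⟨rfl, h⟩
  · rintro ⟨rfl, h⟩; exact ⟨s, ⟨rfl, rfl⟩, h⟩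
  · rintro ⟨s', w', ⟨rfl, rfl⟩, h⟩; exact h
  · intro h; exact ⟨s, w, ⟨rfl, rfl⟩, h⟩

theorem len_functional {s m n : N} (h : Len s m) (h' : Len s n) : m = n := by
  obtain ⟨S, hS⟩ := hN.exists_model
  refine seq_ind (S := S) (fun s => ∀ m n, Len s m → Len s n → m = n) ?_ ?_ s ⟨m, h⟩ m n h h'
  · intro m n h h'
    rw [len_zero.1 h, len_zero.1 h']
  · rintro s v - ih m n h h'
    obtain ⟨m', rfl, h1⟩ := len_cons.1 h
    obtain ⟨n', rfl, h2⟩ := len_cons.1 h'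
    rw [ih m' n' h1 h2]

theorem exists_at_iff {s m : N} (h : Len s m) (i : N) : (∃ v, At s i v) ↔ i < m := by
  obtain ⟨S, hS⟩ := hN.exists_model
  refine seq_ind (S := S) (fun s => ∀ m i, Len s m → ((∃ v, At s i v) ↔ i < m)) ?_ ?_ s ⟨m, h⟩ m i h
  · intro m i h
    rw [len_zero.1 h]
    simp
  · rintro s v - ih m i h
    obtain ⟨m', rfl, hl⟩ := len_cons.1 h
    rw [lt_add_one_iff, le_iff_lt_or_eq, ← ih m' i hl]
    simp only [at_cons]
    constructor
    · rintro ⟨w, ⟨rfl, h'⟩ | h'⟩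
      · exact Or.inr (len_functional h' hl)
      · exact Or.inl ⟨w, h'⟩
    · rintro (⟨w, h'⟩ | rfl)
      · exact ⟨w, Or.inr h'⟩
      · exact ⟨v, Or.inl ⟨rfl, hl⟩⟩

theorem At.lt {s i v m : N} (h : At s i v) (hm : Len s m) : i < m :=
  (exists_at_iff hm i).1 ⟨v, h⟩

theorem At.isSeq {s i v : N} (h : At s i v) : IsSeq s := by
  obtain ⟨S, hS⟩ := hN.exists_model
  refine ACA.strong_ind (S := S) (fun s => At s i v → IsSeq s) (fun s ih h => ?_) s h
  rcases at_iff.1 h with ⟨t, rfl, h1⟩ | ⟨t, w, rfl, h1⟩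
  · exact isSeq_cons.2 ⟨i, h1⟩
  · exact isSeq_cons.2 (ih t (lt_cons w t) h1)

theorem at_functional {s i v w : N} (h : At s i v) (h' : At s i w) : v = w := by
  obtain ⟨S, hS⟩ := hN.exists_model
  refine seq_ind (S := S) (fun s => At s i v → At s i w → v = w) ?_ ?_ s h.isSeq h h'
  · intro h; exact absurd h not_at_zero
  · rintro s u - ih h h'
    rcases at_cons.1 h with ⟨rfl, h1⟩ | h1 <;> rcases at_cons.1 h' with ⟨rfl, h2⟩ | h2
    · rfl
    · exact absurd (h2.lt h1) (lt_irrefl i)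
    · exact absurd (h1.lt h2) (lt_irrefl i)
    · exact ih h1 h2

theorem seq_ext {s t m : N} (hs : Len s m) (ht : Len t m) (h : ∀ i v, At s i v → At t i v) :
    s = t := by
  obtain ⟨S, hS⟩ := hN.exists_model
  refine seq_ind (S := S) (fun s => ∀ t m, Len s m → Len t m → (∀ i v, At s i v → At t i v) →
    s = t) ?_ ?_ s ⟨m, hs⟩ t m hs ht h
  · intro t m hs ht h
    rw [len_zero.1 hs] at ht
    rcases len_iff.1 ht with ⟨h, -⟩ | ⟨t, m', v, h, rfl, h'⟩
    · exact h.symm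
    · exact absurd h'.symm (succ_ne_zero' _)
  · rintro s v - ih t m hs ht h
    obtain ⟨m', rfl, hs'⟩ := len_cons.1 hs
    rcases len_iff.1 ht with ⟨-, h'⟩ | ⟨t, m'', w, ht', rfl, h'⟩
    · exact absurd h' (succ_ne_zero' _)
    obtain rfl := add_right_cancel h'
    have h1 : At (cons w t) m' v := h _ _ (at_cons.2 (Or.inl ⟨rfl, hs'⟩))
    rcases at_cons.1 h1 with ⟨rfl, -⟩ | h1
    · rw [ih t m' hs' ht' fun i u hu => ?_]
      rcases at_cons.1 (h i u (at_cons.2 (Or.inr hu))) with ⟨-, h3⟩ | h3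
      · exact absurd (hu.lt hs') (by rw [len_functional h3 ht']; exact lt_irrefl _)
      · exact h3
    · exact absurd (h1.lt ht') (lt_irrefl _)

/-- `P` is the set of initial segments of an infinite path through `U`. -/
def IsPath (U P : Set N) : Prop :=
  0 ∈ P ∧ (∀ t, t ∈ P → t ∈ U) ∧ (∀ t, t ∈ P → ∃ v, cons v t ∈ P) ∧
  (∀ t v w, cons v t ∈ P → cons w t ∈ P → v = w) ∧ ∀ v t, cons v t ∈ P → t ∈ P

/-- The function whose initial segments form the path `P`. -/
def PathFun (P : Set N) (m v : N) : Prop := ∃ t ∈ P, Len t m ∧ cons v t ∈ P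

instance {S : Set (Set N)} [ACA S] {A : (ℕ → N) → Set N} {f g : (ℕ → N) → N} [hA : SDef S A]
    [hf : TDef S f] [hg : TDef S g] : Def S (fun e => PathFun (A e) (f e) (g e)) := by
  have := fun ρ => hA.shift ρ
  have := fun ρ => hf.comp_shift ρ
  have := fun ρ => hg.comp_shift ρ
  unfold PathFun
  infer_instance

section Path

variable {C : Set (Set N)} [hC : ACA C] {U P : Set N} (hPC : P ∈ C) (h : IsPath U P)

include hPC h

theorem IsPath.exists_len (m : N) : ∃ t ∈ P, Len t m := by
  have : InC C P := ⟨hPC⟩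
  refine ACA.ind (S := C) (fun m => ∃ t ∈ P, Len t m) ⟨0, h.1, len_zero.2 rfl⟩ ?_ m
  rintro n ⟨t, ht, hl⟩
  obtain ⟨v, hv⟩ := h.2.2.1 t ht
  exact ⟨_, hv, len_cons.2 ⟨n, rfl, hl⟩⟩

theorem IsPath.len_inj {s t m : N} (hs : s ∈ P) (ht : t ∈ P) (hsm : Len s m) (htm : Len t m) :
    s = t := by
  have : InC C P := ⟨hPC⟩
  refine seq_ind (S := C) (fun s => ∀ t m, s ∈ P → t ∈ P → Len s m → Len t m → s = t) ?_ ?_ s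
    ⟨m, hsm⟩ t m hs ht hsm htm
  · intro t m hs ht hsm htm
    rw [len_zero.1 hsm] at htm
    rcases len_iff.1 htm with ⟨h, -⟩ | ⟨t, m', v, h, rfl, h'⟩
    · exact h.symm
    · exact absurd h'.symm (succ_ne_zero' _)
  · rintro s v - ih t m hs ht hsm htm
    obtain ⟨m', rfl, hsm'⟩ := len_cons.1 hsm
    rcases len_iff.1 htm with ⟨-, h'⟩ | ⟨t, m'', w, ht', rfl, h'⟩
    · exact absurd h' (succ_ne_zero' _)
    obtain rfl := add_right_cancel h'
    obtain rfl := ih t m' (h.2.2.2.2 _ _ hs) (h.2.2.2.2 _ _ ht) hsm' ht'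
    rw [h.2.2.2.1 _ _ _ hs ht]

theorem IsPath.fun_total (m : N) : ∃ v, PathFun P m v := by
  obtain ⟨t, ht, hl⟩ := h.exists_len hPC m
  obtain ⟨v, hv⟩ := h.2.2.1 t ht
  exact ⟨v, t, ht, hl, hv⟩

theorem IsPath.fun_unique {m v w : N} (hv : PathFun P m v) (hw : PathFun P m w) : v = w := by
  obtain ⟨t, ht, hl, hv⟩ := hv
  obtain ⟨t', ht', hl', hw⟩ := hw
  obtain rfl := h.len_inj hPC ht ht' hl hl'
  exact h.2.2.2.1 _ _ _ hv hw

theorem IsPath.fun_of_at {t i v : N} (ht : t ∈ P) (hat : At t i v) : PathFun P i v := by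
  have : InC C P := ⟨hPC⟩
  refine seq_ind (S := C) (fun t => t ∈ P → At t i v → PathFun P i v) ?_ ?_ t hat.isSeq ht hat
  · intro _ h; exact absurd h not_at_zero
  · rintro s w - ih hs hat
    rcases at_cons.1 hat with ⟨rfl, h1⟩ | h1
    · exact ⟨s, h.2.2.2.2 _ _ hs, h1, hs⟩
    · exact ih (h.2.2.2.2 _ _ hs) h1

theorem IsPath.at_of_fun {t i v m : N} (ht : t ∈ P) (hm : Len t m) (hi : i < m)
    (hv : PathFun P i v) : At t i v := by
  obtain ⟨w, hw⟩ := (exists_at_iff hm i).2 hi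
  rwa [h.fun_unique hPC hv (h.fun_of_at hPC ht hw)]

end Path

/-- Closed conditions on functions. -/
class IsClosedCond (Con : (N → N → Prop) → Prop) : Prop where
  mono : ∀ R R' : N → N → Prop, (∀ i v, R' i v → R i v) → Con R → Con R'
  cont : ∀ R : N → N → Prop, (∀ m, Con (fun i v => i < m ∧ R i v)) → Con R

/-- The tree of a closed condition. -/
def condTree (Con : (N → N → Prop) → Prop) : Set N := {s | IsSeq s ∧ Con (At s)}

/-- The part of the path function below `m` is contained in a node of length `m`; `mono` carries the
condition over from that node, and `cont` passes to the limit. -/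
theorem IsPath.cond {C : Set (Set N)} [hC : ACA C] {P : Set N} (hPC : P ∈ C)
    {Con : (N → N → Prop) → Prop} (hCon : IsClosedCond Con) (h : IsPath (condTree Con) P) :
    Con (PathFun P) := by
  refine hCon.cont _ fun m => ?_
  obtain ⟨t, ht, hl⟩ := h.exists_len hPC m
  exact hCon.mono _ _ (fun i v hv => h.at_of_fun hPC ht hl hv.1 hv.2) (h.2.1 t ht).2

/-- The set of initial segments of a function. -/
def initSegs (G : N → N → Prop) : Set N := {t | IsSeq t ∧ ∀ i v, At t i v → G i v}

theorem isPath_initSegs {G : N → N → Prop} (h1 : ∀ i, ∃ v, G i v)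
    (h2 : ∀ i v w, G i v → G i w → v = w) {Con : (N → N → Prop) → Prop}
    (hCon : IsClosedCond Con) (h : Con G) : IsPath (condTree Con) (initSegs G) := by
  refine ⟨⟨isSeq_zero, fun i v h => absurd h not_at_zero⟩,
    fun t ht => ⟨ht.1, hCon.mono _ _ ht.2 h⟩, fun t ht => ?_, fun t v w hv hw => ?_,
    fun v t ht => ⟨isSeq_cons.1 ht.1, fun i w hw => ht.2 i w (at_cons.2 (Or.inr hw))⟩⟩
  · obtain ⟨m, hm⟩ := ht.1
    obtain ⟨v, hv⟩ := h1 m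
    refine ⟨v, isSeq_cons.2 ht.1, fun i w hw => ?_⟩
    rcases at_cons.1 hw with ⟨rfl, h3⟩ | h3
    · rwa [len_functional h3 hm]
    · exact ht.2 i w h3
  · obtain ⟨m, hm⟩ := isSeq_cons.1 hv.1
    exact h2 m _ _ (hv.2 m v (at_cons.2 (Or.inl ⟨rfl, hm⟩)))
      (hw.2 m w (at_cons.2 (Or.inl ⟨rfl, hm⟩)))

theorem initSegs_mem {C : Set (Set N)} [hC : ACA C] (G : N → N → Prop)
    [hG : Def C (fun e => G (e 0) (e 1))] : initSegs G ∈ C := by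
  have h1 : {z | ∃ i v, z = pr i v ∧ G i v} ∈ C := by
    have h2 : Def C (fun e => G (e 1) (e 0)) :=
      hG.rename (fun i => match i with | 0 => 1 | 1 => 0 | i + 2 => i + 2)
    exact comp _
  have h3 : InC C {z | ∃ i v, z = pr i v ∧ G i v} := ⟨h1⟩
  have h4 : initSegs G =
      {t | IsSeq t ∧ ∀ i v, At t i v → pr i v ∈ {z | ∃ i v, z = pr i v ∧ G i v}} := by
    ext t
    simp only [initSegs, Set.mem_ofPred_eq, pr_inj]
    refine and_congr_right fun _ => forall_congr' fun i => forall_congr' fun v =>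
      imp_congr_right fun _ => ⟨fun h => ⟨i, v, ⟨rfl, rfl⟩, h⟩, ?_⟩
    rintro ⟨i', v', ⟨rfl, rfl⟩, h⟩
    exact h
  rw [h4]
  -- With the graph as an opaque parameter, type class inference can establish definability.
  generalize {z | ∃ i v, z = pr i v ∧ G i v} = A at h3
  exact comp _

/-- The leftmost path above a node of length one in a set of extendible nodes. -/
theorem exists_leftmost {C : Set (Set N)} [hC : ACA C] {U H : Set N} (hHC : H ∈ C) (hHU : H ⊆ U)
    (h0 : 0 ∈ U) {w : N} (hw : cons w 0 ∈ H)
    (hH : ∀ s ∈ H, s ≠ 0 → ∃ v, cons v s ∈ H) :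
    ∃ P ∈ C, IsPath U P ∧ cons w 0 ∈ P ∧ (∀ t ∈ P, t ≠ 0 → t ∈ H) ∧
      ∀ t v, t ≠ 0 → cons v t ∈ P → ∀ v' < v, cons v' t ∉ H := by
  have : InC C H := ⟨hHC⟩
  -- The first entry is prescribed; from then on each node is extended by the least entry that stays
  -- in `H`. The condition `x ≠ 0` protects the first entry.
  have hP : {t | Deriv (fun z => z = 0 ∨ z = cons w 0)
    (fun x y z => x ≠ 0 ∧ ∃ v, z = cons v x ∧ z ∈ H ∧ ∀ v' < v, cons v' x ∉ H) t} ∈ C := comp _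
  obtain ⟨P, hPdef⟩ : ∃ P, P = {t | Deriv (fun z => z = 0 ∨ z = cons w 0)
    (fun x y z => x ≠ 0 ∧ ∃ v, z = cons v x ∧ z ∈ H ∧ ∀ v' < v, cons v' x ∉ H) t} := ⟨_, rfl⟩
  rw [← hPdef] at hP
  have hmem : ∀ t, t ∈ P ↔ (t = 0 ∨ t = cons w 0) ∨
      ∃ x v, x ∈ P ∧ x ≠ 0 ∧ t = cons v x ∧ t ∈ H ∧ ∀ v' < v, cons v' x ∉ H := by
    intro t
    subst hPdef
    refine (deriv_iff (S := C) _ _ _).trans (or_congr Iff.rfl ⟨?_, ?_⟩)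
    · rintro ⟨x, y, hx, hy, h, v, h'⟩; exact ⟨x, v, hx, h, h'⟩
    · rintro ⟨x, v, hx, h, h'⟩; exact ⟨x, x, hx, hx, h, v, h'⟩
  have hPH : ∀ t ∈ P, t ≠ 0 → t ∈ H := by
    intro t ht h
    rcases (hmem t).1 ht with (rfl | rfl) | ⟨x, v, -, -, -, h, -⟩
    · exact absurd rfl h
    · exact hw
    · exact h
  have hstep : ∀ t v, cons v t ∈ P ↔ (t = 0 ∧ v = w) ∨
      (t ∈ P ∧ t ≠ 0 ∧ cons v t ∈ H ∧ ∀ v' < v, cons v' t ∉ H) := by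
    intro t v
    rw [hmem]
    simp only [cons_ne_zero, false_or, cons_inj]
    refine or_congr and_comm ⟨?_, ?_⟩
    · rintro ⟨x, v', hx, hx0, ⟨rfl, rfl⟩, h, h'⟩; exact ⟨hx, hx0, h, h'⟩
    · rintro ⟨hx, hx0, h, h'⟩; exact ⟨t, v, hx, hx0, ⟨rfl, rfl⟩, h, h'⟩
  refine ⟨P, hP, ⟨(hmem 0).2 (Or.inl (Or.inl rfl)), fun t ht => ?_, fun t ht => ?_,
    fun t v v' hv hv' => ?_, fun v t ht => ?_⟩, (hmem _).2 (Or.inl (Or.inr rfl)), hPH,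
    fun t v ht hv => ?_⟩
  · by_cases h : t = 0
    · rwa [h]
    · exact hHU (hPH t ht h)
  · by_cases h : t = 0
    · exact ⟨w, (hstep _ _).2 (Or.inl ⟨h, rfl⟩)⟩
    · obtain ⟨v, hv, hv'⟩ := ACA.exists_least (S := C) (fun v => cons v t ∈ H)
        (hH t (hPH t ht h) h)
      exact ⟨v, (hstep _ _).2 (Or.inr ⟨ht, h, hv, hv'⟩)⟩
  · rcases (hstep _ _).1 hv with ⟨h1, h2⟩ | ⟨-, h1, h2, h3⟩ <;>
      rcases (hstep _ _).1 hv' with ⟨h1', h2'⟩ | ⟨-, h1', h2', h3'⟩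
    · rw [h2, h2']
    · exact absurd h1 h1'
    · exact absurd h1' h1
    · exact le_antisymm (not_lt.1 fun h => h3 _ h h2') (not_lt.1 fun h => h3' _ h h2)
  · rcases (hstep _ _).1 ht with ⟨h1, h2⟩ | ⟨h, -⟩
    · rw [h1]; exact (hmem 0).2 (Or.inl (Or.inl rfl))
    · exact h
  · rcases (hstep _ _).1 hv with ⟨h1, h2⟩ | ⟨-, h1, h2, h3⟩
    · exact absurd h1 ht
    · exact h3

/-! ### The formula that defines paths -/

/-- The term for the pair of two terms. -/
def prTm (t u : Term) : Term := .add (.mul (.add t u) (.add t u)) t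

theorem val_prTm (t u : Term) (e : ℕ → N) : (prTm t u).val e = pr (t.val e) (u.val e) := rfl

/-- The term for the extension of a sequence. -/
def consTm (t u : Term) : Term := .add (prTm t u) .one

theorem val_consTm (t u : Term) (e : ℕ → N) :
    (consTm t u).val e = cons (t.val e) (u.val e) := rfl

/-- The existential quantifier. -/
def ArithFormula.ex (φ : ArithFormula) : ArithFormula := .not (.all (.not φ))

/-- The implication. -/
def ArithFormula.imp (φ ψ : ArithFormula) : ArithFormula := .not (.and φ (.not ψ))

theorem ArithFormula.holds_ex {φ : ArithFormula} {e : ℕ → N} {d : ℕ → Set N} :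
    φ.ex.Holds e d ↔ ∃ x, φ.Holds (push x e) d := by
  simp [ex, Holds]

theorem ArithFormula.holds_imp {φ ψ : ArithFormula} {e : ℕ → N} {d : ℕ → Set N} :
    (φ.imp ψ).Holds e d ↔ (φ.Holds e d → ψ.Holds e d) := by
  simp [imp, Holds]

/-- The formula which says that the set with index `0` is a path through the tree `(X)₀` for the set
`X` with index `1`, and that it contains the number with index `0`. -/
def pathForm : ArithFormula :=
  .and (.mem .zero 0) <| .and (.all (.imp (.mem (.var 0) 0) (.mem (prTm (.var 0) .zero) 1))) <|
  .and (.all (.imp (.mem (.var 0) 0) (.ex (.mem (consTm (.var 0) (.var 1)) 0)))) <|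
  .and (.all (.all (.all (.imp (.mem (consTm (.var 1) (.var 2)) 0)
    (.imp (.mem (consTm (.var 0) (.var 2)) 0) (.eq (.var 1) (.var 0))))))) <|
  .and (.all (.all (.imp (.mem (consTm (.var 1) (.var 0)) 0) (.mem (.var 0) 0)))) <|
  .mem (.var 0) 0

theorem holds_pathForm {e : ℕ → N} {d : ℕ → Set N} :
    pathForm.Holds e d ↔ IsPath (column (d 1) 0) (d 0) ∧ e 0 ∈ d 0 := by
  simp only [pathForm, ArithFormula.Holds, ArithFormula.holds_ex, ArithFormula.holds_imp,
    val_consTm, val_prTm, Term.val, push, IsPath, column, Set.mem_ofPred_eq, and_assoc]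

end Sequences

/-! ### Trees of requirements and their leftmost paths -/

section Reflection

variable {N : Type*} [CommSemiring N] [LinearOrder N] [IsStrictOrderedRing N]
  [CanonicallyOrderedAdd N] [hN : ACANumbers N]

/-! ### Closed conditions -/

instance IsClosedCond.const {p : Prop} : IsClosedCond (fun _ : N → N → Prop => p) :=
  ⟨fun _ _ _ h => h, fun _ h => h 0⟩

instance IsClosedCond.all {ι : Sort*} {P : ι → (N → N → Prop) → Prop}
    [h : ∀ x, IsClosedCond (P x)] : IsClosedCond (fun R : N → N → Prop => ∀ x, P x R) :=
  ⟨fun R R' hR hP x => (h x).mono R R' hR (hP x),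
    fun R hR x => (h x).cont R fun m => hR m x⟩

instance IsClosedCond.and {P Q : (N → N → Prop) → Prop} [hP : IsClosedCond P]
    [hQ : IsClosedCond Q] : IsClosedCond (fun R : N → N → Prop => P R ∧ Q R) :=
  ⟨fun R R' hR h => ⟨hP.mono R R' hR h.1, hQ.mono R R' hR h.2⟩,
    fun R hR => ⟨hP.cont R fun m => (hR m).1, hQ.cont R fun m => (hR m).2⟩⟩

instance IsClosedCond.imp {p : Prop} {P : (N → N → Prop) → Prop} [hP : IsClosedCond P] :
    IsClosedCond (fun R : N → N → Prop => p → P R) :=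
  ⟨fun R R' hR h hp => hP.mono R R' hR (h hp), fun R hR hp => hP.cont R fun m => hR m hp⟩

/-- A value of `R` may appear as a hypothesis, since it is visible in every sufficiently long
segment. As a demand it would not be monotone, so all conditions below mention `R` in hypotheses
only. -/
instance IsClosedCond.atom {i v : N} {P : (N → N → Prop) → Prop} [hP : IsClosedCond P] :
    IsClosedCond (fun R : N → N → Prop => R i v → P R) := by
  refine ⟨fun R R' hR h h' => hP.mono R R' hR (h (hR i v h')), fun R hR h => hP.cont R fun m => ?_⟩
  -- The bound `m + (i + 1)` exceeds `i`, so the hypothesis is seen, and it is at least `m`.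
  refine hP.mono _ _ (fun j w hj => ⟨hj.1.trans_le le_self_add, hj.2⟩) (hR (m + (i + 1)) ⟨?_, h⟩)
  exact (lt_add_one i).trans_le le_add_self

/-- The requirement with number `n` on a function `F`, relative to the columns of `R`. -/
def Op (B : Set N) (R F : N → N → Prop) (n : N) : Prop :=
  (∀ p x v, n = pr (num 1) p → F x v → (v ≠ 0 ↔ pr x p ∈ B)) ∧
  (∀ i j x v u w, n = pr (num 2) (pr i j) → F x v → R (pr i (x + 1)) u → R (pr j (x + 1)) w →
    (v ≠ 0 ↔ ¬ (u ≠ 0 ∧ w ≠ 0))) ∧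
  (∀ i x y u, n = pr (num 3) i → F x 0 → R (pr i (pr y x + 1)) u → u = 0) ∧
  (∀ i x w u, n = pr (num 3) i → F x (w + 1) → R (pr i (pr w x + 1)) u → u ≠ 0) ∧
  (∀ c i x a v u, n = pr (num 4) (pr c i) → pr x a ∈ column B c → F x v →
    R (pr i (a + 1)) u → (v ≠ 0 ↔ u ≠ 0)) ∧
  (∀ i x v w u u', n = pr (num 5) i → F x v → F (x + 1) w → R (pr i (pr w v + 1)) u →
    R (pr i (pr v w + 1)) u' → u ≠ 0 ∧ u' = 0) ∧
  (∀ i x y v u, n = pr (num 6) i → F (pr x y) v → R (pr i (x + 1)) u → (v ≠ 0 ↔ u = y))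

/-- `R` and `F` occur in hypotheses only, and requirement `n` inspects only columns whose index is a
component of `n`, hence smaller than `n`. -/
theorem Op.mono {B : Set N} {R F R' F' : N → N → Prop} {n : N} (h : Op B R F n)
    (hR : ∀ i < n, ∀ x v, R' (pr i x) v → R (pr i x) v) (hF : ∀ x v, F' x v → F x v) :
    Op B R' F' n := by
  obtain ⟨h1, h2, h3, h4, h5, h6, h7⟩ := h
  refine ⟨fun p x v hn hv => h1 p x v hn (hF _ _ hv), fun i j x v u w hn hv hu hw => ?_,
    fun i x y u hn hv hu => ?_, fun i x w u hn hv hu => ?_, fun c i x a v u hn ha hv hu => ?_,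
    fun i x v w u u' hn hv hw hu hu' => ?_, fun i x y v u hn hv hu => ?_⟩
  · exact h2 i j x v u w hn (hF _ _ hv) (hR _ (hn ▸ lt_pr_num_left _ _ _) _ _ hu)
      (hR _ (hn ▸ lt_pr_num_right _ _ _) _ _ hw)
  · exact h3 i x y u hn (hF _ _ hv) (hR _ (hn ▸ lt_pr_num _ _) _ _ hu)
  · exact h4 i x w u hn (hF _ _ hv) (hR _ (hn ▸ lt_pr_num _ _) _ _ hu)
  · exact h5 c i x a v u hn ha (hF _ _ hv) (hR _ (hn ▸ lt_pr_num_right _ _ _) _ _ hu)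
  · exact h6 i x v w u u' hn (hF _ _ hv) (hF _ _ hw) (hR _ (hn ▸ lt_pr_num _ _) _ _ hu)
      (hR _ (hn ▸ lt_pr_num _ _) _ _ hu')
  · exact h7 i x y v u hn (hF _ _ hv) (hR _ (hn ▸ lt_pr_num _ _) _ _ hu)

/-- In the function `R`, each column with flag `0` satisfies its requirement. -/
def OpCond (B : Set N) (R : N → N → Prop) : Prop :=
  ∀ n, R (pr n 0) 0 → Op B R (fun x v => R (pr n (x + 1)) v) n

instance isClosedCond_opCond (B : Set N) : IsClosedCond (OpCond B) := by
  unfold OpCond Op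
  infer_instance

instance {S : Set (Set N)} [ACA S] {B : Set N} [InC S B] {f : (ℕ → N) → N} [hf : TDef S f] :
    Def S (fun e => OpCond B (At (f e))) :=
  Def.subst hf (P := fun _ x => OpCond B (At x)) (by unfold OpCond Op; infer_instance)

theorem condTree_opCond_mem {S : Set (Set N)} [ACA S] {B : Set N} (hB : B ∈ S) :
    condTree (OpCond B) ∈ S := by
  have : InC S B := ⟨hB⟩
  exact comp _

/-- The nodes through which there is a path in `C`. -/
def extendible (C : Set (Set N)) (U : Set N) : Set N := {s | ∃ P ∈ C, IsPath U P ∧ s ∈ P}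

theorem extendible_subset (C : Set (Set N)) (U : Set N) : extendible C U ⊆ U := by
  rintro s ⟨P, -, hP, hs⟩
  exact hP.2.1 s hs

theorem extendible_step {C : Set (Set N)} {U : Set N} : ∀ s ∈ extendible C U, s ≠ 0 →
    ∃ v, cons v s ∈ extendible C U := by
  rintro s ⟨P, hPC, hP, hs⟩ -
  obtain ⟨v, hv⟩ := hP.2.2.1 s hs
  exact ⟨v, P, hPC, hP, hv⟩

/-- The code of even a standard formula bounds the variable indices by an element of `N`, so the
constant assignment is built by induction inside the model. -/
theorem exists_const_asg (k n : N) : ∃ d, Asg d ∧ ∀ i < n, TV (cVar i) d k := by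
  obtain ⟨S, hS⟩ := hN.exists_model
  refine ACA.ind (S := S) (fun n => ∃ d, Asg d ∧ ∀ i < n, TV (pr (num 1) i) d k) ?_ ?_ n
  · exact ⟨0, asg_zero, fun i hi => absurd hi not_lt_zero⟩
  · rintro n ⟨d, hd, h⟩
    refine ⟨pr k d, hd.pr, fun i hi => ?_⟩
    rcases Raw.zero_or_succ hS i with rfl | ⟨i, rfl⟩
    · exact tv_var_zero.2 ⟨d, rfl⟩
    · exact tv_var_succ.2 ⟨k, d, rfl, h i (lt_of_add_lt_add_right hi)⟩

/-- `Π¹₁`-comprehension yields the set of extendible nodes of a tree. -/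
theorem extendible_mem_of_pi11 {S : Set (Set N)} [hS : ACA S] {W X : Set N} (hX : X ∈ cols W)
    (h : SatPi11CA S W X) [ACA (cols W)] : extendible (cols W) (column X 0) ∈ cols W := by
  obtain ⟨k, rfl⟩ := hX
  have hok := Form.ok_ofArith (N := N) False (.not pathForm)
  obtain ⟨T, hT, hT'⟩ := h (cAllSet (Form.ofArith (.not pathForm)).code)
    ⟨_, hok.fm.isArithmetical, rfl⟩
  obtain ⟨hTS, D, hDS, hD, hφ, hTD⟩ := isValuation_iff.1 hT
  obtain ⟨d, hd, hdk⟩ := exists_const_asg k (cAllSet (Form.ofArith (.not pathForm)).code)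
  obtain ⟨j, hj⟩ := hT' 0 d (isAssignment_iff.2 asg_zero) (isAssignment_iff.2 hd) (by
    intro i hi k' hk'
    rw [tv_functional (termVal_iff.1 hk') (hdk i hi)])
  -- Under the set quantifier the index `0` denotes the path and the index `1` is entry `0` of `d`,
  -- that is, `X`.
  have hd0 : dec d 0 = k := ((tv_var hd 0).1 (hdk 0 ((zero_le).trans_lt (lt_cAllSet _)))).symm
  have key : ∀ x, x ∈ column W j ↔ x ∉ extendible (cols W) (column (column W k) 0) := by
    intro x
    have h2 := Form.holds_iff hD hTD (.allSet (Form.ofArith (.not pathForm))) (e := pr x 0) (d := d)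
      asg_zero.pr hd hφ
    rw [hj]
    refine h2.trans ?_
    simp only [Form.Holds, Form.holds_ofArith, ArithFormula.Holds, holds_pathForm, dec_pr_zero,
      dec_pr_one, hd0]
    constructor
    · rintro h ⟨P, ⟨k', rfl⟩, hP, hx⟩
      exact h k' ⟨hP, hx⟩
    · rintro h k' ⟨hP, hx⟩
      exact h ⟨_, ⟨k', rfl⟩, hP, hx⟩
  have h3 : {x | x ∉ column W j} ∈ cols W := comp _
  convert h3 using 1
  ext x
  simp [key]

/-! ### Descending sequences -/

instance {S : Set (Set N)} [ACA S] {A : (ℕ → N) → Set N} {f g : (ℕ → N) → N} [hA : SDef S A]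
    [hf : TDef S f] [hg : TDef S g] : Def S (fun e => StrictRel (A e) (f e) (g e)) := by
  have := fun ρ => hA.shift ρ
  have := fun ρ => hf.comp_shift ρ
  have := fun ρ => hg.comp_shift ρ
  unfold StrictRel
  infer_instance

/-- Choosing at each step the numerically least element of `A` below the current one makes the
sequence arithmetical; no choice principle is needed. -/
theorem exists_descending {C : Set (Set N)} [hC : ACA C] {X A : Set N} (hX : X ∈ C) (hA : A ∈ C)
    {j : N} (hj : j ∈ A) (h : ∀ j ∈ A, ∃ i ∈ A, StrictRel X i j) :
    ∃ F ∈ C, (∀ n, ∃! y, pr n y ∈ F) ∧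
      ∀ n y z, pr n y ∈ F → pr (n + 1) z ∈ F → StrictRel X z y := by
  have : InC C X := ⟨hX⟩
  have : InC C A := ⟨hA⟩
  have hF : {z | Deriv (fun z => z = pr 0 j) (fun x y z => ∃ n y' y'', x = pr n y' ∧
    z = pr (n + 1) y'' ∧ (y'' ∈ A ∧ StrictRel X y'' y') ∧
      ∀ w < y'', ¬ (w ∈ A ∧ StrictRel X w y')) z} ∈ C := comp _
  obtain ⟨F, hFdef⟩ : ∃ F, F = {z | Deriv (fun z => z = pr 0 j) (fun x y z => ∃ n y' y'',
    x = pr n y' ∧ z = pr (n + 1) y'' ∧ (y'' ∈ A ∧ StrictRel X y'' y') ∧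
      ∀ w < y'', ¬ (w ∈ A ∧ StrictRel X w y')) z} := ⟨_, rfl⟩
  rw [← hFdef] at hF
  have : InC C F := ⟨hF⟩
  have hmem : ∀ n z, pr n z ∈ F ↔ (n = 0 ∧ z = j) ∨ ∃ m y, n = m + 1 ∧ pr m y ∈ F ∧
      (z ∈ A ∧ StrictRel X z y) ∧ ∀ w < z, ¬ (w ∈ A ∧ StrictRel X w y) := by
    intro n z
    subst hFdef
    refine (deriv_iff (S := C) _ _ _).trans (or_congr pr_inj ⟨?_, ?_⟩)
    · rintro ⟨x, y, hx, hy, m, y', y'', rfl, h', h''⟩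
      obtain ⟨rfl, rfl⟩ := pr_inj.1 h'
      exact ⟨m, y', rfl, hx, h''⟩
    · rintro ⟨m, y, rfl, hx, h'⟩
      exact ⟨_, _, hx, hx, m, y, z, rfl, rfl, h'⟩
  have h0 : ∀ z, pr 0 z ∈ F ↔ z = j := by
    intro z
    rw [hmem]
    simp [(succ_ne_zero' _).symm]
  have hs : ∀ n z, pr (n + 1) z ∈ F ↔ ∃ y, pr n y ∈ F ∧
      (z ∈ A ∧ StrictRel X z y) ∧ ∀ w < z, ¬ (w ∈ A ∧ StrictRel X w y) := by
    intro n z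
    rw [hmem]
    simp only [succ_ne_zero', false_and, false_or, add_left_inj]
    exact ⟨fun ⟨m, y, h1, h2⟩ => ⟨y, h1 ▸ h2⟩, fun ⟨y, h⟩ => ⟨n, y, rfl, h⟩⟩
  have hex : ∀ n, ∃ y, pr n y ∈ F ∧ y ∈ A := by
    refine ACA.ind (S := C) (fun n => ∃ y, pr n y ∈ F ∧ y ∈ A) ⟨j, (h0 j).2 rfl, hj⟩ ?_
    rintro n ⟨y, hy, hyA⟩
    obtain ⟨z, hz, hz'⟩ := ACA.exists_least (S := C) (fun z => z ∈ A ∧ StrictRel X z y) (h y hyA)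
    exact ⟨z, (hs n z).2 ⟨y, hy, hz, hz'⟩, hz.1⟩
  have huniq : ∀ n y z, pr n y ∈ F → pr n z ∈ F → y = z := by
    refine ACA.ind (S := C) (fun n => ∀ y z, pr n y ∈ F → pr n z ∈ F → y = z) ?_ ?_
    · intro y z hy hz
      rw [(h0 y).1 hy, (h0 z).1 hz]
    · intro n ih y z hy hz
      obtain ⟨y', h1, h2, h3⟩ := (hs n y).1 hy
      obtain ⟨z', h1', h2', h3'⟩ := (hs n z).1 hz
      obtain rfl := ih y' z' h1 h1'
      exact le_antisymm (not_lt.1 fun h => h3 _ h h2') (not_lt.1 fun h => h3' _ h h2)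
  refine ⟨F, hF, fun n => ?_, fun n y z hy hz => ?_⟩
  · obtain ⟨y, hy, -⟩ := hex n
    exact ⟨y, hy, fun z hz => huniq n z y hz hy⟩
  · obtain ⟨y', h1, h2, -⟩ := (hs n z).1 hz
    rw [huniq n y y' hy h1]
    exact h2.2

/-! ### The leftmost solution of the requirements -/

/-- On the leftmost path a flag is `1` only if `0` is impossible there. If some `F` in `C` meets
requirement `n` relative to the earlier columns of the path, then changing the path from position
`⟨n, 0⟩` on gives another path in `C` with flag `0`, so leftmostness forces `0`. The case `n = 0` is
excluded because its flag is the prescribed first entry. -/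
theorem exists_optimal {C : Set (Set N)} [hC : ACA C] {B : Set N} (hB : B ∈ C)
    (hH : extendible C (condTree (OpCond B)) ∈ C) :
    ∃ g : N → N, Def C (fun e => e 1 = g (e 0)) ∧ OpCond B (fun a v => v = g a) ∧
      ∀ n ≠ 0, ∀ F : N → N → Prop, Def C (fun e => F (e 0) (e 1)) → (∀ x, ∃ v, F x v) →
        (∀ x v w, F x v → F x w → v = w) → Op B (fun a v => v = g a) F n → g (pr n 0) = 0 := by
  have : InC C B := ⟨hB⟩
  have hsucc : ∀ a : N, a + 1 ≠ 0 := succ_ne_zero'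
  -- With every flag `1` except the first, only requirement `0` is promised; it is vacuous because
  -- requirement numbers are tagged pairs, which are never `0`.
  have hroot : cons 0 0 ∈ extendible C (condTree (OpCond B)) := by
    let R : N → N → Prop := fun a v =>
      ((∃ n, n ≠ 0 ∧ a = pr n 0) ∧ v = 1) ∨ (¬ (∃ n, n ≠ 0 ∧ a = pr n 0) ∧ v = 0)
    have hR : Def C (fun e => R (e 0) (e 1)) := by
      simp only [R]
      infer_instance
    refine ⟨initSegs R, initSegs_mem R, isPath_initSegs ?_ ?_ inferInstance ?_, ?_⟩
    · intro i
      by_cases hi : ∃ n, n ≠ 0 ∧ i = pr n 0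
      · exact ⟨1, Or.inl ⟨hi, rfl⟩⟩
      · exact ⟨0, Or.inr ⟨hi, rfl⟩⟩
    · rintro i v w (⟨h, rfl⟩ | ⟨h, rfl⟩) (⟨h', rfl⟩ | ⟨h', rfl⟩)
      · rfl
      · exact absurd h h'
      · exact absurd h' h
      · rfl
    · intro n hn
      rcases hn with ⟨-, h⟩ | ⟨h, -⟩
      · exact absurd h zero_ne_one
      · have hn : n = 0 := by
          by_contra hn
          exact h ⟨n, hn, rfl⟩
        subst hn
        simp [Op, (pr_num_ne_zero _ _).symm]
    · refine ⟨isSeq_cons.2 isSeq_zero, fun i v hv => ?_⟩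
      rcases at_cons.1 hv with ⟨rfl, h⟩ | h
      · rw [len_zero] at h
        subst h
        refine Or.inr ⟨?_, rfl⟩
        rintro ⟨n, hn, h⟩
        exact hn (pr_eq_zero.1 h.symm).1
      · exact absurd h not_at_zero
  obtain ⟨P, hPC, hP, hwP, hPH, hleft⟩ := exists_leftmost hH (extendible_subset _ _)
    (extendible_subset _ _ ⟨_, hroot.choose_spec.1, hroot.choose_spec.2.1,
      hroot.choose_spec.2.1.1⟩) hroot extendible_step
  have : InC C P := ⟨hPC⟩
  have hcond : OpCond B (PathFun P) := hP.cond hPC inferInstance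
  choose g hg using hP.fun_total hPC
  have hgiff : ∀ a v, PathFun P a v ↔ v = g a :=
    fun a v => ⟨fun h => hP.fun_unique hPC h (hg a), fun h => h ▸ hg a⟩
  have hgeq : PathFun P = fun a v => v = g a := by
    funext a v; exact propext (hgiff a v)
  have hgdef : Def C (fun e => e 1 = g (e 0)) :=
    Def.congr (P := fun e => PathFun P (e 0) (e 1)) inferInstance fun e => hgiff _ _
  refine ⟨g, hgdef, hgeq ▸ hcond, ?_⟩
  rw [← hgeq]
  intro n hn F hF hF1 hF2 hop
  -- The competitor has flag `n` equal to `0`, column `n` equal to `F` and all later flags equal to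
  -- `1`; elsewhere it agrees with the path.
  let R : N → N → Prop := fun a v =>
    (a = pr n 0 ∧ v = 0) ∨ (∃ x, a = pr n (x + 1) ∧ F x v) ∨ ((∃ m, n < m ∧ a = pr m 0) ∧ v = 1) ∨
    ((¬ a = pr n 0 ∧ (¬ ∃ x, a = pr n (x + 1)) ∧ ¬ ∃ m, n < m ∧ a = pr m 0) ∧ PathFun P a v)
  have hF' : Def C (fun e => F (e 0) (e 2)) := hF.rename (fun i => if i = 0 then 0 else i + 1)
  have hR : Def C (fun e => R (e 0) (e 1)) := by
    simp only [R]
    infer_instance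
  have hR1 : ∀ a, ∃ v, R a v := by
    intro a
    by_cases h1 : a = pr n 0
    · exact ⟨0, Or.inl ⟨h1, rfl⟩⟩
    by_cases h2 : ∃ x, a = pr n (x + 1)
    · obtain ⟨x, rfl⟩ := h2
      obtain ⟨v, hv⟩ := hF1 x
      exact ⟨v, Or.inr (Or.inl ⟨x, rfl, hv⟩)⟩
    by_cases h3 : ∃ m, n < m ∧ a = pr m 0
    · exact ⟨1, Or.inr (Or.inr (Or.inl ⟨h3, rfl⟩))⟩
    · exact ⟨g a, Or.inr (Or.inr (Or.inr ⟨⟨h1, h2, h3⟩, hg a⟩))⟩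
  have hR0 : ∀ v, R (pr n 0) v → v = 0 := by
    rintro v (⟨-, h⟩ | ⟨x, h, -⟩ | ⟨⟨m, hm, h⟩, -⟩ | ⟨⟨h, -⟩, -⟩)
    · exact h
    · exact absurd (pr_inj.1 h).2.symm (hsucc x)
    · exact absurd (pr_inj.1 h).1 hm.ne
    · exact absurd rfl h
  have hRn : ∀ x v, R (pr n (x + 1)) v → F x v := by
    rintro x v (⟨h, -⟩ | ⟨x', h, h'⟩ | ⟨⟨m, hm, h⟩, -⟩ | ⟨⟨-, h, -⟩, -⟩)
    · exact absurd (pr_inj.1 h).2 (hsucc x)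
    · rwa [add_right_cancel (pr_inj.1 h).2]
    · exact absurd (pr_inj.1 h).1 hm.ne
    · exact absurd ⟨x, rfl⟩ h
  have hRm : ∀ m, n < m → ∀ v, R (pr m 0) v → v = 1 := by
    rintro m hm v (⟨h, -⟩ | ⟨x', h, h'⟩ | ⟨-, h⟩ | ⟨⟨-, -, h⟩, -⟩)
    · exact absurd (pr_inj.1 h).1 hm.ne'
    · exact absurd (pr_inj.1 h).1 hm.ne'
    · exact h
    · exact absurd ⟨m, hm, rfl⟩ h
  have hRP : ∀ a v, R a v → a ≠ pr n 0 → (∀ x, a ≠ pr n (x + 1)) → (∀ m, n < m → a ≠ pr m 0) →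
      PathFun P a v := by
    rintro a v (⟨h, -⟩ | ⟨x', h, -⟩ | ⟨⟨m, hm, h⟩, -⟩ | ⟨-, h⟩) h1 h2 h3
    · exact absurd h h1
    · exact absurd h (h2 x')
    · exact absurd h (h3 m hm)
    · exact h
  have hRi : ∀ i < n, ∀ x v, R (pr i x) v → PathFun P (pr i x) v := by
    intro i hi x v h
    refine hRP _ _ h ?_ ?_ ?_
    · exact fun h => hi.ne (pr_inj.1 h).1
    · exact fun x h => hi.ne (pr_inj.1 h).1
    · exact fun m hm h => (hi.trans hm).ne (pr_inj.1 h).1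
  have hR2 : ∀ a v w, R a v → R a w → v = w := by
    intro a v w hv hw
    by_cases h1 : a = pr n 0
    · subst h1; rw [hR0 v hv, hR0 w hw]
    by_cases h2 : ∃ x, a = pr n (x + 1)
    · obtain ⟨x, rfl⟩ := h2
      exact hF2 x v w (hRn x v hv) (hRn x w hw)
    by_cases h3 : ∃ m, n < m ∧ a = pr m 0
    · obtain ⟨m, hm, rfl⟩ := h3
      rw [hRm m hm v hv, hRm m hm w hw]
    · push Not at h2 h3
      exact hP.fun_unique hPC (hRP a v hv h1 h2 h3) (hRP a w hw h1 h2 h3)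
  -- Before `n` nothing relevant has changed, at `n` the function `F` meets the requirement, and
  -- after `n` nothing is promised.
  have hRcond : OpCond B R := by
    intro m hm
    rcases lt_trichotomy m n with h | rfl | h
    · exact (hcond m (hRi m h _ _ hm)).mono (fun i hi => hRi i (hi.trans h)) fun x v => hRi m h _ _
    · exact hop.mono hRi hRn
    · exact absurd (hRm m h 0 hm) zero_ne_one
  -- All changes occur at positions `≥ ⟨n, 0⟩`, so the competitor shares with the path the node `t`
  -- just before the flag.
  obtain ⟨t, ht, hl⟩ := hP.exists_len hPC (pr n 0)
  have ht0 : t ≠ 0 := by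
    rintro rfl
    exact hn (pr_eq_zero.1 (len_zero.1 hl)).1
  have hext : cons 0 t ∈ extendible C (condTree (OpCond B)) := by
    refine ⟨initSegs R, initSegs_mem R, isPath_initSegs hR1 hR2 inferInstance hRcond,
      isSeq_cons.2 ⟨_, hl⟩, fun a v ha => ?_⟩
    rcases at_cons.1 ha with ⟨rfl, h⟩ | h
    · obtain rfl := len_functional h hl
      exact Or.inl ⟨rfl, rfl⟩
    · have hlt := h.lt hl
      refine Or.inr (Or.inr (Or.inr ⟨⟨hlt.ne, ?_, ?_⟩, hP.fun_of_at hPC ht h⟩))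
      · rintro ⟨x, rfl⟩
        exact absurd hlt (not_lt.2 (pr_le_pr le_rfl zero_le))
      · rintro ⟨m, hm, rfl⟩
        exact absurd hlt (not_lt.2 (pr_le_pr hm.le le_rfl))
  obtain ⟨v, hv⟩ := hP.2.2.1 t ht
  have hv0 : v = 0 := by
    by_contra h
    exact hleft t v ht0 hv 0 (pos_iff_ne_zero.2 h) hext
  rw [← (hgiff (pr n 0) 0).1 ⟨t, ht, hl, hv0 ▸ hv⟩]

end Reflection

/-! ### From pseudo-comprehension to models of transfinite induction -/

section TransfiniteInduction

variable {N : Type*} [CommSemiring N] [LinearOrder N] [IsStrictOrderedRing N]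
  [CanonicallyOrderedAdd N] [hN : ACANumbers N]

/-- `F` is the graph of an infinite descending sequence for `X`. -/
def Descending (X F : Set N) : Prop :=
  (∀ n, ∃! y, pr n y ∈ F) ∧ ∀ n y z, pr n y ∈ F → pr (n + 1) z ∈ F → StrictRel X z y

/-- For requirements that only ask whether a value is nonzero, a characteristic function is a
solution. -/
theorem op_two_valued {B : Set N} {g : N → N} {Q : N → Prop} {n : N}
    (h : ∀ F : N → N → Prop, (∀ x v, F x v → (v ≠ 0 ↔ Q x)) → Op B (fun a v => v = g a) F n) :
    Op B (fun a v => v = g a) (fun x v => (Q x ∧ v = 1) ∨ (¬ Q x ∧ v = 0)) n := by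
  refine h _ fun x v hv => ?_
  rcases hv with ⟨hQ, rfl⟩ | ⟨hQ, rfl⟩ <;> simp [hQ]

/-- The model consists of the columns of the leftmost solution `g`. Each closure property of `M` is
a requirement solvable in `W`, so its flag is `0` and the column meets it. -/
theorem exists_closed_model {S : Set (Set N)} [hS : ACA S] {W B : Set N} (hW : W ∈ S)
    [hWA : ACA (cols W)] (hB : B ∈ cols W) (hR : Rich B)
    (hH : extendible (cols W) (condTree (OpCond B)) ∈ cols W) :
    ∃ M ∈ cols W, ACA (cols M) ∧ (∀ c, column B c ∈ cols M) ∧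
      ∀ X ∈ cols M, (∃ F ∈ cols W, Descending X F) → ∃ F ∈ cols M, Descending X F := by
  obtain ⟨g, hg, hcond, hopt⟩ := exists_optimal hB hH
  have : InC (cols W) B := ⟨hB⟩
  have hg0 : TDef (cols W) (fun e => g (e 0)) :=
    ⟨hg.rename (fun i => match i with | 0 => 1 | 1 => 0 | i + 2 => i + 2)⟩
  have hgi : ∀ (f : (ℕ → N) → N) [TDef (cols W) f], TDef (cols W) (fun e => g (f e)) :=
    fun f hf => TDef.subst₁ hf hg0
  have hMW : {z | ∃ x n, z = pr x n ∧ g (pr n (x + 1)) ≠ 0} ∈ cols W := comp _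
  obtain ⟨M, hMdef⟩ : ∃ M, M = {z | ∃ x n, z = pr x n ∧ g (pr n (x + 1)) ≠ 0} := ⟨_, rfl⟩
  rw [← hMdef] at hMW
  have hmem : ∀ n x, x ∈ column M n ↔ g (pr n (x + 1)) ≠ 0 := by
    intro n x
    simp [column, hMdef]
  -- A solution in `W` forces the flag to be `0`. The column is then itself a solution, though not
  -- necessarily the given one.
  have sol : ∀ n ≠ 0, ∀ F : N → N → Prop, Def (cols W) (fun e => F (e 0) (e 1)) →
      (∀ x, ∃ v, F x v) → (∀ x v w, F x v → F x w → v = w) → Op B (fun a v => v = g a) F n →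
      Op B (fun a v => v = g a) (fun x v => v = g (pr n (x + 1))) n :=
    fun n hn F h1 h2 h3 h4 => hcond n (hopt n hn F h1 h2 h3 h4).symm
  have solB : ∀ n ≠ 0, ∀ Q : N → Prop, Def (cols W) (fun e => Q (e 0)) →
      (∀ F : N → N → Prop, (∀ x v, F x v → (v ≠ 0 ↔ Q x)) → Op B (fun a v => v = g a) F n) →
      Op B (fun a v => v = g a) (fun x v => v = g (pr n (x + 1))) n := by
    intro n hn Q hQ h
    refine sol n hn _ inferInstance (fun x => ?_) (fun x v w hv hw => ?_) (op_two_valued h)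
    · by_cases hx : Q x
      · exact ⟨1, Or.inl ⟨hx, rfl⟩⟩
      · exact ⟨0, Or.inr ⟨hx, rfl⟩⟩
    · rcases hv with ⟨hx, rfl⟩ | ⟨hx, rfl⟩ <;> rcases hw with ⟨hx', rfl⟩ | ⟨hx', rfl⟩
      · rfl
      · exact absurd hx hx'
      · exact absurd hx' hx
      · rfl
  have base : ∀ c, column B c ∈ cols M := by
    intro c
    refine ⟨pr (num 1) c, ?_⟩
    have := solB (pr (num 1) c) (pr_num_ne_zero _ _) (fun x => x ∈ column B c) inferInstance
      (fun F hF => by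
        simp only [Op, pr_inj, num_inj]
        simp +contextual
        rintro p x v rfl hv
        exact hF _ _ hv)
    ext x
    rw [hmem]
    exact this.1 c x _ rfl rfl
  have nand : ∀ A ∈ cols M, ∀ A' ∈ cols M, {x | ¬ (x ∈ A ∧ x ∈ A')} ∈ cols M := by
    rintro _ ⟨i, rfl⟩ _ ⟨j, rfl⟩
    refine ⟨pr (num 2) (pr i j), ?_⟩
    have := solB (pr (num 2) (pr i j)) (pr_num_ne_zero _ _)
      (fun x => ¬ (g (pr i (x + 1)) ≠ 0 ∧ g (pr j (x + 1)) ≠ 0)) inferInstance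
      (fun F hF => by
        simp only [Op, pr_inj, num_inj]
        refine ⟨by simp, ?_, by simp, by simp, by simp, by simp, by simp⟩
        rintro i' j' x v u w ⟨-, rfl, rfl⟩ hv rfl rfl
        exact hF _ _ hv)
    ext x
    rw [hmem]
    simp only [Set.mem_ofPred_eq, hmem]
    exact this.2.1 i j x _ _ _ rfl rfl rfl rfl
  have ex : ∀ A ∈ cols M, {e | ∃ x, pr x e ∈ A} ∈ cols M := by
    rintro _ ⟨i, rfl⟩
    refine ⟨pr (num 3) i, ?_⟩
    -- The solution takes the value `w + 1` for the least witness `w`, and `0` if there is none.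
    -- Storing the witness turns projection into a closed condition.
    have := sol (pr (num 3) i) (pr_num_ne_zero _ _)
      (fun x v => (∃ w, v = w + 1 ∧ g (pr i (pr w x + 1)) ≠ 0 ∧
        ∀ w' < w, g (pr i (pr w' x + 1)) = 0) ∨ (v = 0 ∧ ∀ w, g (pr i (pr w x + 1)) = 0))
      inferInstance
      (fun x => by
        by_cases hx : ∃ w, g (pr i (pr w x + 1)) ≠ 0
        · obtain ⟨w, hw, hw'⟩ := ACA.exists_least (S := cols W) _ hx
          exact ⟨w + 1, Or.inl ⟨w, rfl, hw, fun w' h => not_not.1 (hw' w' h)⟩⟩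
        · push Not at hx
          exact ⟨0, Or.inr ⟨rfl, hx⟩⟩)
      (by
        rintro x v v' (⟨w, rfl, h1, h2⟩ | ⟨rfl, h⟩) (⟨w', rfl, h3, h4⟩ | ⟨rfl, h'⟩)
        · congr 1
          exact le_antisymm (not_lt.1 fun h => h3 (h2 _ h)) (not_lt.1 fun h => h1 (h4 _ h))
        · exact absurd (h' _) h1
        · exact absurd (h _) h3
        · rfl)
      (by
        simp only [Op, pr_inj, num_inj]
        refine ⟨by simp, by simp, ?_, ?_, by simp, by simp, by simp⟩
        · rintro i' x y u ⟨-, rfl⟩ (⟨w, h, -⟩ | ⟨-, h⟩) rfl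
          · exact absurd h.symm (succ_ne_zero' _)
          · exact h y
        · rintro i' x w u ⟨-, rfl⟩ (⟨w', h, h', -⟩ | ⟨h, -⟩) rfl
          · rwa [add_right_cancel h]
          · exact absurd h (succ_ne_zero' _))
    ext x
    rw [hmem]
    simp only [Set.mem_ofPred_eq, hmem]
    constructor
    · intro h
      rcases Raw.zero_or_succ hS (g (pr (pr (num 3) i) (x + 1))) with h' | ⟨w, h'⟩
      · exact absurd h' h
      · exact ⟨w, this.2.2.2.1 i x w _ rfl h'.symm rfl⟩
    · rintro ⟨y, hy⟩ h
      exact hy (this.2.2.1 i x y _ rfl h.symm rfl)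
  have pull : ∀ c, (∀ x a b, pr x a ∈ column B c → pr x b ∈ column B c → a = b) →
      ∀ A ∈ cols M, ∃ A' ∈ cols M, ∀ x a, pr x a ∈ column B c → (x ∈ A' ↔ a ∈ A) := by
    rintro c hc _ ⟨i, rfl⟩
    refine ⟨_, column_mem_cols M (pr (num 4) (pr c i)), ?_⟩
    have := solB (pr (num 4) (pr c i)) (pr_num_ne_zero _ _)
      (fun x => ∃ a, pr x a ∈ column B c ∧ g (pr i (a + 1)) ≠ 0) inferInstance
      (fun F hF => by
        simp only [Op, pr_inj, num_inj]
        refine ⟨by simp, by simp, by simp, by simp, ?_, by simp, by simp⟩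
        rintro c' i' x a v u ⟨-, rfl, rfl⟩ ha hv rfl
        rw [hF _ _ hv]
        refine ⟨fun ⟨b, hb, h⟩ => ?_, fun h => ⟨a, ha, h⟩⟩
        rwa [hc x a b ha hb])
    intro x a ha
    rw [hmem, hmem]
    exact this.2.2.2.2.1 c i x a _ _ rfl ha rfl rfl
  have desc : ∀ X ∈ cols M, (∃ F ∈ cols W, Descending X F) → ∃ F ∈ cols M, Descending X F := by
    rintro _ ⟨i, rfl⟩ ⟨F, hF, hF1, hF2⟩
    have : InC (cols W) F := ⟨hF⟩
    -- The given descending sequence shows that requirement `⟨5, i⟩` is solvable; column `⟨5, i⟩` of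
    -- `g` then is a descending sequence as well.
    have h5 := sol (pr (num 5) i) (pr_num_ne_zero _ _) (fun x v => pr x v ∈ F) inferInstance
      (fun x => (hF1 x).exists) (fun x v w => (hF1 x).unique)
      (by
        simp only [Op, pr_inj, num_inj]
        refine ⟨by simp, by simp, by simp, by simp, by simp, ?_, by simp⟩
        rintro i' x v w u u' ⟨-, rfl⟩ hv hw rfl rfl
        have := hF2 x v w hv hw
        rw [StrictRel, hmem, hmem, not_not] at this
        exact this)
    -- A column of `M` records only which values are nonzero, so requirement `⟨6, ⟨5, i⟩⟩` provides
    -- the graph of that sequence as a set of `M`.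
    have h6 := solB (pr (num 6) (pr (num 5) i)) (pr_num_ne_zero _ _)
      (fun z => ∃ x y, z = pr x y ∧ g (pr (pr (num 5) i) (x + 1)) = y) inferInstance
      (fun F hF => by
        simp only [Op, pr_inj, num_inj]
        refine ⟨by simp, by simp, by simp, by simp, by simp, by simp, ?_⟩
        rintro i' x y v u ⟨-, rfl⟩ hv rfl
        rw [hF _ _ hv]
        simp [eq_comm])
    have h7 : ∀ x y, pr x y ∈ column M (pr (num 6) (pr (num 5) i)) ↔
        g (pr (pr (num 5) i) (x + 1)) = y := by
      intro x y
      rw [hmem]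
      exact h6.2.2.2.2.2.2 _ x y _ _ rfl rfl rfl
    refine ⟨_, column_mem_cols M (pr (num 6) (pr (num 5) i)), fun n => ?_, fun n y z hy hz => ?_⟩
    · simp only [h7]
      exact ⟨_, rfl, fun y h => h.symm⟩
    · rw [h7] at hy hz
      rw [StrictRel, hmem, hmem, not_not]
      exact h5.2.2.2.2.2.1 i n y z _ _ rfl hy.symm hz.symm rfl rfl
  exact ⟨M, hMW, aca_of_closed (cols_subset (cols_subset hW hMW)) hR base nand ex pull, base, desc⟩

theorem satTI_of_descending {S : Set (Set N)} [hS : ACA S] {W M T : Set N} (hW : W ∈ S)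
    [hWA : ACA (cols W)] (hM : M ∈ cols W) (hTS : T ∈ S) (hT : FullSat M T)
    (desc : ∀ X ∈ cols M, (∃ F ∈ cols W, Descending X F) → ∃ F ∈ cols M, Descending X F) :
    SatTI S M := by
  rintro φ ⟨D, hDS, hD, hφ⟩
  refine ⟨T, isValuation_iff.2 ⟨hTS, D, hDS, hD, hφ, hT.tarskiOn D⟩,
    fun X hX hwo e d he hd hprog j => ?_⟩
  by_contra hj
  -- The full relation `T` need not belong to `W`, but a partial relation covering `φ` does; hence
  -- so does the set of failures.
  obtain ⟨k, hk⟩ := tarski_exists hW hM (φ + 1)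
  have hiff := tarski_unique (cols_subset hW hM) hTS (column_mem hW k)
    (n := φ + 1) (fun c _ => hT c) hk φ (lt_add_one φ) (lt_add_one φ)
  have hA : {j | pr φ (pr (pr j e) d) ∉ column W k} ∈ cols W := comp _
  simp only [← hiff] at hA
  have hXW : X ∈ cols W := by
    obtain ⟨n, rfl⟩ := hX
    exact column_mem hM n
  obtain ⟨F, hF, h1, h2⟩ := exists_descending hXW hA hj (fun j hj => by
    by_contra hc
    push Not at hc
    exact hj (hprog j fun i hi => not_not.1 fun h => hc i h hi))
  obtain ⟨F', hF', h1', h2'⟩ := desc X hX ⟨F, hF, h1, h2⟩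
  exact hwo.2 ⟨F', hF', h1', h2'⟩

theorem omegaModelReflectionTI_of_pi11CAEps {S : Set (Set N)} [hS : ACA S] (h : Pi11CAEps S) :
    OmegaModelReflectionTI S := by
  intro X hX
  obtain ⟨B, hB, hR, -, c, hc⟩ := exists_rich hX hX
  -- One set `X₁` codes both the tree, in column `0`, and `B`, since comprehension in `W` allows a
  -- single set parameter.
  obtain ⟨X₁, hX₁, -, hU, c₁, hc₁⟩ := exists_rich (condTree_opCond_mem hB) hB
  obtain ⟨W, hW, hXW, hWA, hWP⟩ := h X₁ hX₁
  have hWAC : ACA (cols W) := SatACA0.aca hW hWA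
  replace hXW : X₁ ∈ cols W := hXW
  have hBW := column_mem hXW c₁
  rw [hc₁] at hBW
  have hH := extendible_mem_of_pi11 hXW hWP
  rw [hU] at hH
  obtain ⟨M, hM, hMA, hbase, hdesc⟩ := exists_closed_model hW hBW hR hH
  obtain ⟨T, hTS, hT⟩ := exists_fullSat hW hM
  exact ⟨M, cols_subset hW hM, hc ▸ hbase c, satACA0_of_aca (cols_subset hW hM) hTS hT,
    satTI_of_descending hW hM hTS hT hdesc⟩

end TransfiniteInduction

/-! ### The Kleene–Brouwer order and paths through trees -/

section KleeneBrouwer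

variable {N : Type*} [CommSemiring N] [LinearOrder N] [IsStrictOrderedRing N]
  [CanonicallyOrderedAdd N] [hN : ACANumbers N]

/-- The Kleene–Brouwer order of sequences. -/
def KB (s t : N) : Prop :=
  ∃ i v, At s i v ∧ (∀ w, At t i w → v < w) ∧ ∀ j < i, ∀ u, At s j u ↔ At t j u

instance {S : Set (Set N)} [ACA S] {f g : (ℕ → N) → N} [hf : TDef S f] [hg : TDef S g] :
    Def S (fun e => KB (f e) (g e)) :=
  Def.subst₂ hf hg (P := KB) (by unfold KB; infer_instance)

theorem KB.irrefl (s : N) : ¬ KB s s := by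
  rintro ⟨i, v, h, h', -⟩
  exact lt_irrefl _ (h' v h)

theorem KB.trans {r s t : N} (h : KB r s) (h' : KB s t) : KB r t := by
  obtain ⟨i, v, h1, h2, h3⟩ := h
  obtain ⟨j, w, h4, h5, h6⟩ := h'
  rcases lt_trichotomy i j with hij | rfl | hij
  · exact ⟨i, v, h1, fun u hu => h2 u ((h6 i hij u).2 hu),
      fun k hk u => (h3 k hk u).trans (h6 k (hk.trans hij) u)⟩
  · exact ⟨i, v, h1, fun u hu => (h2 w h4).trans (h5 u hu),
      fun k hk u => (h3 k hk u).trans (h6 k hk u)⟩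
  · exact ⟨j, w, (h3 j hij w).2 h4, h5, fun k hk u => (h3 k (hk.trans hij) u).trans (h6 k hk u)⟩

theorem KB.total {s t : N} (hs : IsSeq s) (ht : IsSeq t) : s = t ∨ KB s t ∨ KB t s := by
  obtain ⟨S, hS⟩ := hN.exists_model
  by_cases h : ∃ i, ∃ u, ¬ (At s i u ↔ At t i u)
  · right
    obtain ⟨i, ⟨u, hu⟩, hi⟩ := ACA.exists_least (S := S) _ h
    have hi' : ∀ j < i, ∀ u, At s j u ↔ At t j u := fun j hj u => by
      by_contra h
      exact hi j hj ⟨u, h⟩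
    by_cases h1 : ∃ v, At s i v <;> by_cases h2 : ∃ w, At t i w
    · obtain ⟨v, hv⟩ := h1
      obtain ⟨w, hw⟩ := h2
      rcases lt_trichotomy v w with hvw | rfl | hvw
      · exact Or.inl ⟨i, v, hv, fun w' hw' => at_functional hw hw' ▸ hvw, hi'⟩
      · refine absurd ⟨fun h => ?_, fun h => ?_⟩ hu
        · rwa [at_functional h hv]
        · rwa [at_functional h hw]
      · exact Or.inr ⟨i, w, hw, fun w' hw' => at_functional hv hw' ▸ hvw,
          fun j hj u => (hi' j hj u).symm⟩
    · obtain ⟨v, hv⟩ := h1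
      exact Or.inl ⟨i, v, hv, fun w hw => absurd ⟨w, hw⟩ h2, hi'⟩
    · obtain ⟨w, hw⟩ := h2
      exact Or.inr ⟨i, w, hw, fun v hv => absurd ⟨v, hv⟩ h1, fun j hj u => (hi' j hj u).symm⟩
    · exact absurd ⟨fun h => absurd ⟨u, h⟩ h1, fun h => absurd ⟨u, h⟩ h2⟩ hu
  · left
    push Not at h
    obtain ⟨m, hm⟩ := hs
    obtain ⟨n, hn⟩ := ht
    have hlt : ∀ i, i < m ↔ i < n := fun i => by
      rw [← exists_at_iff hm, ← exists_at_iff hn]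
      exact exists_congr fun v => h i v
    have hmn : m = n := le_antisymm (not_lt.1 fun h' => lt_irrefl _ ((hlt n).1 h'))
      (not_lt.1 fun h' => lt_irrefl _ ((hlt m).2 h'))
    exact seq_ext hm (hmn ▸ hn) fun i v => (h i v).1

/-- At the position after the end of `s` the comparison is vacuous, so extensions are smaller. -/
theorem kb_cons {s : N} (hs : IsSeq s) (v : N) : KB (cons v s) s := by
  obtain ⟨m, hm⟩ := hs
  refine ⟨m, v, at_cons.2 (Or.inl ⟨rfl, hm⟩), fun w hw => absurd (hw.lt hm) (lt_irrefl _),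
    fun j hj u => ?_⟩
  rw [at_cons]
  refine or_iff_right ?_
  rintro ⟨-, h⟩
  exact hj.ne (len_functional h hm)

/-- The Kleene–Brouwer order on the nodes of `U` with first entry `w`. -/
def kbCode (U : Set N) (w : N) : Set N :=
  {z | ∃ s t, z = pr s t ∧ (s ∈ U ∧ At s 0 w) ∧ (t ∈ U ∧ At t 0 w) ∧ (s = t ∨ KB s t)}

theorem kbCode_mem {C : Set (Set N)} [ACA C] {U : Set N} (hU : U ∈ C) (w : N) :
    kbCode U w ∈ C := by
  have : InC C U := ⟨hU⟩
  exact comp _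

theorem pr_mem_kbCode {U : Set N} {w s t : N} : pr s t ∈ kbCode U w ↔
    (s ∈ U ∧ At s 0 w) ∧ (t ∈ U ∧ At t 0 w) ∧ (s = t ∨ KB s t) := by
  constructor
  · rintro ⟨s', t', h, h'⟩
    obtain ⟨rfl, rfl⟩ := pr_inj.1 h
    exact h'
  · exact fun h => ⟨s, t, rfl, h⟩

theorem strictRel_kbCode {U : Set N} {w s t : N} : StrictRel (kbCode U w) s t ↔
    (s ∈ U ∧ At s 0 w) ∧ (t ∈ U ∧ At t 0 w) ∧ KB s t := by
  rw [StrictRel, pr_mem_kbCode, pr_mem_kbCode]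
  constructor
  · rintro ⟨⟨hs, ht, rfl | h⟩, h'⟩
    · exact absurd ⟨ht, hs, Or.inl rfl⟩ h'
    · exact ⟨hs, ht, h⟩
  · rintro ⟨hs, ht, h⟩
    refine ⟨⟨hs, ht, Or.inr h⟩, ?_⟩
    rintro ⟨-, -, rfl | h'⟩
    · exact KB.irrefl _ h
    · exact KB.irrefl _ (h.trans h')

theorem isLinearOrderCode_kbCode (U : Set N) (w : N) : IsLinearOrderCode (kbCode U w) := by
  simp only [IsLinearOrderCode, pr_mem_kbCode]
  refine ⟨fun i j h => by simp [h.1, h.2.1], ?_, ?_, ?_⟩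
  · rintro i j k ⟨hi, -, h⟩ ⟨-, hk, h'⟩
    refine ⟨hi, hk, ?_⟩
    rcases h with rfl | h
    · exact h'
    · rcases h' with rfl | h'
      · exact Or.inr h
      · exact Or.inr (h.trans h')
  · rintro i j ⟨-, -, rfl | h⟩ ⟨-, -, h'⟩
    · rfl
    · rcases h' with rfl | h'
      · rfl
      · exact absurd (h.trans h') (KB.irrefl _)
  · rintro i j ⟨hi, -, -⟩ ⟨hj, -, -⟩
    rcases KB.total hi.2.isSeq hj.2.isSeq with rfl | h | h
    · exact Or.inl ⟨hi, hj, Or.inl rfl⟩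
    · exact Or.inl ⟨hi, hj, Or.inr h⟩
    · exact Or.inr ⟨hj, hi, Or.inr h⟩

/-- A descending sequence in the Kleene–Brouwer order of a tree yields a path. -/
theorem exists_path_of_descending {C : Set (Set N)} [hC : ACA C] {Con : (N → N → Prop) → Prop}
    (hCon : IsClosedCond Con) {F : Set N} (hF : F ∈ C) {w : N}
    (hd : Descending (kbCode (condTree Con) w) F) :
    ∃ P ∈ C, IsPath (condTree Con) P ∧ cons w 0 ∈ P := by
  have : InC C F := ⟨hF⟩
  obtain ⟨hF1, hF2⟩ := hd
  choose s hs using fun n => (hF1 n).exists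
  have hs0 : TDef C (fun e => s (e 0)) := by
    refine ⟨Def.congr (P := fun e => pr (e 1) (e 0) ∈ F) inferInstance fun e => ?_⟩
    exact ⟨fun h => (hF1 _).unique h (hs _), fun h => h ▸ hs _⟩
  have hsi : ∀ (f : (ℕ → N) → N) [TDef C f], TDef C (fun e => s (f e)) :=
    fun f hf => TDef.subst₁ hf hs0
  have hstep := fun n => strictRel_kbCode.1 (hF2 n _ _ (hs n) (hs (n + 1)))
  -- The path consists of the sequences that are eventually initial segments of the members of the
  -- descending sequence.
  have hP : {t | IsSeq t ∧ ∃ n, ∀ m, n ≤ m → ∀ i v, At t i v → At (s m) i v} ∈ C := comp _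
  refine ⟨_, hP, ⟨⟨isSeq_zero, 0, fun m _ i v h => absurd h not_at_zero⟩, ?_, ?_, ?_, ?_⟩,
    isSeq_cons.2 isSeq_zero, 0, fun m _ i v h => ?_⟩
  · rintro t ⟨ht, n, hn⟩
    exact ⟨ht, hCon.mono _ _ (hn n le_rfl) (hstep n).2.1.1.2⟩
  · rintro t ⟨ht, n, hn⟩
    obtain ⟨i, hi⟩ := ht
    -- Once `t` is a common initial segment, a descent cannot happen inside it. Hence the next entry
    -- exists from then on and never increases.
    have key : ∀ m, n ≤ m → ∃ v, At (s (m + 1)) i v ∧ ∀ u, At (s m) i u → v ≤ u := by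
      intro m hm
      obtain ⟨j, v, h1, h2, h3⟩ := (hstep m).2.2
      rcases lt_trichotomy j i with hj | rfl | hj
      · obtain ⟨u, hu⟩ := (exists_at_iff hi j).2 hj
        have hv := at_functional h1 (hn (m + 1) (hm.trans le_self_add) j u hu)
        exact absurd (h2 u (hn m hm j u hu)) (hv ▸ lt_irrefl _)
      · exact ⟨v, h1, fun u hu => (h2 u hu).le⟩
      · obtain ⟨l, hl⟩ := h1.isSeq
        obtain ⟨u, hu⟩ := (exists_at_iff hl i).2 (hj.trans (h1.lt hl))
        exact ⟨u, hu, fun u' hu' => (at_functional ((h3 i hj u).1 hu) hu').le⟩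
    obtain ⟨v₀, hv₀, -⟩ := key n le_rfl
    -- The least value ever attained at position `i` is kept forever, so it extends `t` along the
    -- path.
    obtain ⟨v, ⟨m₀, hm₀, hv⟩, hleast⟩ := ACA.exists_least (S := C)
      (fun v => ∃ m, n ≤ m ∧ At (s m) i v) ⟨v₀, n + 1, le_self_add, hv₀⟩
    have hstab : ∀ m, m₀ ≤ m → At (s m) i v := by
      refine ACA.ind (S := C) (fun m => m₀ ≤ m → At (s m) i v) (fun h => ?_) fun m ih h => ?_
      · rwa [← le_antisymm h zero_le]
      · rcases h.lt_or_eq with h | rfl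
        · have h' := lt_add_one_iff.1 h
          obtain ⟨v', hv', hle⟩ := key m (hm₀.trans h')
          rcases (hle v (ih h')).lt_or_eq with h2 | rfl
          · exact absurd ⟨m + 1, hm₀.trans (h'.trans le_self_add), hv'⟩ (hleast v' h2)
          · exact hv'
        · exact hv
    refine ⟨v, isSeq_cons.2 ⟨i, hi⟩, m₀, fun m hm k u hk => ?_⟩
    rcases at_cons.1 hk with ⟨rfl, h⟩ | h
    · rw [len_functional h hi]
      exact hstab m hm
    · exact hn m (hm₀.trans hm) k u h
  · rintro t v v' ⟨ht, n, hn⟩ ⟨-, n', hn'⟩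
    obtain ⟨i, hi⟩ := isSeq_cons.1 ht
    exact at_functional (hn (n + n') le_self_add i v (at_cons.2 (Or.inl ⟨rfl, hi⟩)))
      (hn' (n + n') le_add_self i v' (at_cons.2 (Or.inl ⟨rfl, hi⟩)))
  · rintro v t ⟨ht, n, hn⟩
    exact ⟨isSeq_cons.1 ht, n, fun m hm i u h => hn m hm i u (at_cons.2 (Or.inr h))⟩
  · rcases at_cons.1 h with ⟨rfl, h1⟩ | h1
    · rw [len_zero.1 h1]
      exact (hstep m).2.1.2
    · exact absurd h1 not_at_zero

end KleeneBrouwer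

/-! ### The tree of refutations of an arithmetical formula -/

section Refutation

variable {N : Type*} [CommSemiring N] [LinearOrder N] [IsStrictOrderedRing N]
  [CanonicallyOrderedAdd N] [hN : ACANumbers N]

/-- The conditions on the truth value `v` of the formula `c` under the assignment `e`, relative to
the other values of the function `R`: a true formula has the value `0`, and a false formula
`∀ x ψ` the value `x + 1` for a counterexample `x`. The set variable with index `0` denotes
`{x | R ⟨1, x⟩ ≠ 0}`, all others denote `X`. -/
def TruthClause (X : Set N) (R : N → N → Prop) (c e v : N) : Prop :=
  (∀ t u, c = cEq t u → (v = 0 ↔ ∃ a, TV t e a ∧ TV u e a)) ∧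
  (∀ t u, c = cLt t u → (v = 0 ↔ ∃ a b, TV t e a ∧ TV u e b ∧ a < b)) ∧
  (∀ t i, c = cMem t i → (¬ ∃ a, TV t e a) → v ≠ 0) ∧
  (∀ t i a, c = cMem t (i + 1) → TV t e a → (v = 0 ↔ a ∈ X)) ∧
  (∀ t a u, c = cMem t 0 → TV t e a → R (pr (num 1) a) u → (v = 0 ↔ u ≠ 0)) ∧
  (∀ ψ u, c = cNot ψ → R (pr (num 2) (pr ψ e)) u → (v = 0 ↔ u ≠ 0)) ∧
  (∀ ψ χ u w, c = cAnd ψ χ → R (pr (num 2) (pr ψ e)) u → R (pr (num 2) (pr χ e)) w →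
    (v = 0 ↔ u = 0 ∧ w = 0)) ∧
  (∀ ψ x u, c = cAll ψ → v = 0 → R (pr (num 2) (pr ψ (pr x e))) u → u = 0) ∧
  (∀ ψ x u, c = cAll ψ → v = x + 1 → R (pr (num 2) (pr ψ (pr x e))) u → u ≠ 0)

/-- The function `R` shows that `θ` is false under `e`, where `R 0 = ⟨θ, e⟩`. -/
def Refutes (X : Set N) (R : N → N → Prop) : Prop :=
  ∀ θ e, R 0 (pr θ e) → (∀ v, R (pr (num 2) (pr θ e)) v → v ≠ 0) ∧
    ∀ c ≤ θ, ∀ e' v, R (pr (num 2) (pr c e')) v → TruthClause X R c e' v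

/-- The value of a false universal formula names a counterexample. Without it the clause would be an
existential demand on `R`, which is not closed. -/
instance isClosedCond_refutes (X : Set N) : IsClosedCond (Refutes X) := by
  unfold Refutes TruthClause
  infer_instance

instance {S : Set (Set N)} [ACA S] {X : Set N} [InC S X] {f : (ℕ → N) → N} [hf : TDef S f] :
    Def S (fun e => Refutes X (At (f e))) :=
  Def.subst hf (P := fun _ x => Refutes X (At x))
    (by unfold Refutes TruthClause cEq cLt cMem cNot cAnd cAll; infer_instance)

theorem condTree_refutes_mem {S : Set (Set N)} [ACA S] {X : Set N} (hX : X ∈ S) :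
    condTree (Refutes X) ∈ S := by
  have : InC S X := ⟨hX⟩
  exact comp _

theorem pathFun_zero {C : Set (Set N)} [ACA C] {U P : Set N} (hPC : P ∈ C) (h : IsPath U P)
    {w : N} : PathFun P 0 w ↔ cons w 0 ∈ P := by
  constructor
  · rintro ⟨t, ht, hl, hw⟩
    rcases len_iff.1 hl with ⟨rfl, -⟩ | ⟨s, m, v, -, -, hm⟩
    · exact hw
    · exact absurd hm.symm (succ_ne_zero' m)
  · exact fun hw => ⟨0, h.1, len_zero.2 rfl, hw⟩

/-- A path through the tree of refutations refutes the formula in its label. -/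
theorem not_mem_of_path {S : Set (Set N)} [hS : ACA S] {V X T D P : Set N} (hV : V ∈ S)
    [hVA : ACA (cols V)] (hTS : T ∈ S) (hT : FullSat V T) (hDS : D ∈ S)
    (hD : SubformulaClosed S D) (hDs : ∀ ψ, cAllSet ψ ∉ D) {θ e d : N} (hθ : θ ∈ D) (hd : Asg d)
    (hdX : ∀ i < θ, ∀ k, TV (cVar i) d k → column V k = X) (hPV : P ∈ cols V)
    (hP : IsPath (condTree (Refutes X)) P) (hw : cons (pr θ e) 0 ∈ P) :
    ∃ k, pr θ (pr e (pr k d)) ∉ T := by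
  have hPS := cols_subset hV hPV
  have : InC (cols V) P := ⟨hPV⟩
  have : InC S P := ⟨hPS⟩
  have : InC S T := ⟨hTS⟩
  have : InC S D := ⟨hDS⟩
  have href := hP.cond hPV (isClosedCond_refutes X) θ e ((pathFun_zero hPV hP).2 hw)
  -- The set witnessing the failure is read off the values at `⟨1, x⟩`.
  have hY : {x | ∃ u, PathFun P (pr (num 1) x) u ∧ u ≠ 0} ∈ cols V := comp _
  obtain ⟨k, hk⟩ := hY
  have htot := hP.fun_total hPV
  -- Since the path function is total, the conditional clauses always apply, and the values agree
  -- with truth by induction on the code.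
  have key : ∀ c, c ∈ D → c ≤ θ → ∀ e' v, PathFun P (pr (num 2) (pr c e')) v →
      (v = 0 ↔ pr c (pr e' (pr k d)) ∈ T) := by
    refine ACA.strong_ind (S := S) (fun c => c ∈ D → c ≤ θ → ∀ e' v,
      PathFun P (pr (num 2) (pr c e')) v → (v = 0 ↔ pr c (pr e' (pr k d)) ∈ T))
      fun c ih hc hle e' v hv => ?_
    obtain ⟨h1, h2, h3, h4, h5, h6, h7, h8, h9⟩ := href.2 c hle e' v hv
    rw [hT]
    rcases hD c hc with ⟨t, u, -, -, rfl⟩ | ⟨t, u, -, -, rfl⟩ | ⟨t, i, -, rfl⟩ | ⟨ψ, h, rfl⟩ |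
      ⟨ψ, h, χ, h', rfl⟩ | ⟨ψ, h, rfl⟩ | ⟨ψ, h, rfl⟩
    · rw [clause_eq]; exact h1 t u rfl
    · rw [clause_lt]; exact h2 t u rfl
    · rw [clause_mem]
      by_cases ha : ∃ a, TV t e' a
      · obtain ⟨a, ha⟩ := ha
        rcases Raw.zero_or_succ hS i with rfl | ⟨i, rfl⟩
        · obtain ⟨u, hu⟩ := htot (pr (num 1) a)
          rw [h5 t a u rfl ha hu]
          have hak : pr a k ∈ V ↔ u ≠ 0 := by
            have : a ∈ column V k ↔ ∃ u, PathFun P (pr (num 1) a) u ∧ u ≠ 0 := by rw [hk]; rfl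
            refine this.trans ⟨fun ⟨u', hu', h⟩ => ?_, fun h => ⟨u, hu, h⟩⟩
            rwa [hP.fun_unique hPV hu hu']
          constructor
          · exact fun h => ⟨a, k, ha, tv_var_zero.2 ⟨_, rfl⟩, hak.2 h⟩
          · rintro ⟨a', k', ha', hk', h⟩
            obtain rfl := tv_functional ha ha'
            obtain rfl := tv_functional (tv_var_zero.2 ⟨_, rfl⟩) hk'
            exact hak.1 h
        · rw [h4 t i a rfl ha]
          obtain ⟨k', hk'⟩ := hd i
          have hi : i < θ := (lt_add_one i).trans ((lt_cMem_right _ _).trans_le hle)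
          have hX := hdX i hi k' hk'
          constructor
          · intro h
            exact ⟨a, k', ha, tv_var_succ.2 ⟨_, _, rfl, hk'⟩, by rw [← hX] at h; exact h⟩
          · rintro ⟨a', k'', ha', hk'', h⟩
            obtain rfl := tv_functional ha ha'
            obtain rfl := tv_functional (tv_var_succ.2 ⟨_, _, rfl, hk'⟩) hk''
            rw [← hX]; exact h
      · refine ⟨fun h => absurd h (h3 t i rfl ha), ?_⟩
        rintro ⟨a, -, h, -⟩
        exact absurd ⟨a, h⟩ ha
    · obtain ⟨u, hu⟩ := htot (pr (num 2) (pr ψ e'))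
      rw [clause_not, h6 ψ u rfl hu, ← ih ψ (lt_cNot _) h ((lt_cNot _).le.trans hle) e' u hu]
    · obtain ⟨u, hu⟩ := htot (pr (num 2) (pr ψ e'))
      obtain ⟨w, hw⟩ := htot (pr (num 2) (pr χ e'))
      rw [clause_and, h7 ψ χ u w rfl hu hw,
        ← ih ψ (lt_cAnd_left _ _) h ((lt_cAnd_left _ _).le.trans hle) e' u hu,
        ← ih χ (lt_cAnd_right _ _) h' ((lt_cAnd_right _ _).le.trans hle) e' w hw]
    · rw [clause_all]
      have ih' := ih ψ (lt_cAll _) h ((lt_cAll _).le.trans hle)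
      constructor
      · intro hv0 x
        obtain ⟨u, hu⟩ := htot (pr (num 2) (pr ψ (pr x e')))
        exact (ih' _ u hu).1 (h8 ψ x u rfl hv0 hu)
      · intro hall
        rcases Raw.zero_or_succ hS v with h0 | ⟨x, hx⟩
        · exact h0
        · obtain ⟨u, hu⟩ := htot (pr (num 2) (pr ψ (pr x e')))
          exact absurd ((ih' _ u hu).2 (hall x)) (h9 ψ x u rfl hx hu)
    · exact absurd hc (hDs ψ)
  obtain ⟨v, hv⟩ := htot (pr (num 2) (pr θ e))
  exact ⟨k, fun h => href.1 v hv ((key θ hθ le_rfl e v hv).2 h)⟩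

/-- If the formula `θ` is false, then its label starts a path through the tree of refutations. -/
theorem exists_path_of_not_mem {S : Set (Set N)} [hS : ACA S] {V X T D : Set N} (hV : V ∈ S)
    [hVA : ACA (cols V)] (hTS : T ∈ S) (hT : FullSat V T) (hDS : D ∈ S)
    (hD : SubformulaClosed S D) (hDs : ∀ ψ, cAllSet ψ ∉ D) {θ e d k : N} (hθ : θ ∈ D) (hd : Asg d)
    (hdX : ∀ i < θ, ∀ k, TV (cVar i) d k → column V k = X) (hX : X ∈ cols V)
    (hk : pr θ (pr e (pr k d)) ∉ T) :
    ∃ P ∈ cols V, IsPath (condTree (Refutes X)) P ∧ cons (pr θ e) 0 ∈ P := by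
  have : InC (cols V) X := ⟨hX⟩
  have : InC S V := ⟨hV⟩
  have : InC S T := ⟨hTS⟩
  have : InC S D := ⟨hDS⟩
  -- Only `X` and the refuting set matter for `θ`, so a two-column model suffices. As a member of
  -- `V` it has partial satisfaction relations in `V`, which `V` itself need not have.
  have hM : {z | ∃ x, (z = pr x 0 ∧ x ∈ X) ∨ (z = pr x 1 ∧ x ∈ column V k)} ∈ cols V := comp _
  obtain ⟨M, hMdef⟩ : ∃ M, M = {z | ∃ x, (z = pr x 0 ∧ x ∈ X) ∨ (z = pr x 1 ∧ x ∈ column V k)} :=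
    ⟨_, rfl⟩
  rw [← hMdef] at hM
  have hM0 : ∀ x, pr x 0 ∈ M ↔ x ∈ X := fun x => by simp [hMdef]
  have hM1 : ∀ x, pr x 1 ∈ M ↔ x ∈ column V k := fun x => by simp [hMdef]
  obtain ⟨j, hj⟩ := tarski_exists hV hM (θ + 1)
  obtain ⟨T', hT'def⟩ : ∃ T', T' = column V j := ⟨_, rfl⟩
  have hT' : InC (cols V) T' := ⟨hT'def ▸ column_mem_cols V j⟩
  have : InC S T' := ⟨cols_subset hV hT'.mem⟩
  rw [← hT'def] at hj
  -- The assignment `⟨1, 0⟩` sends set variable `0` to column `1` and, because `0 = ⟨0, 0⟩`, all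
  -- later ones to column `0`, which is `X`.
  have key : ∀ c, c ∈ D → c ≤ θ → ∀ e', pr c (pr e' (pr 1 0)) ∈ T' ↔
      pr c (pr e' (pr k d)) ∈ T := by
    refine ACA.strong_ind (S := S) (fun c => c ∈ D → c ≤ θ → ∀ e',
      pr c (pr e' (pr 1 0)) ∈ T' ↔ pr c (pr e' (pr k d)) ∈ T) fun c ih hc hle e' => ?_
    rw [hT, hj c (lt_add_one_iff.2 hle)]
    rcases hD c hc with ⟨t, u, -, -, rfl⟩ | ⟨t, u, -, -, rfl⟩ | ⟨t, i, -, rfl⟩ | ⟨ψ, h, rfl⟩ |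
      ⟨ψ, h, χ, h', rfl⟩ | ⟨ψ, h, rfl⟩ | ⟨ψ, h, rfl⟩
    · rw [clause_eq, clause_eq]
    · rw [clause_lt, clause_lt]
    · have hcol : ∃ b b', TV (cVar i) (pr 1 0) b ∧ TV (cVar i) (pr k d) b' ∧
          ∀ a, pr a b ∈ M ↔ pr a b' ∈ V := by
        rcases Raw.zero_or_succ hS i with rfl | ⟨i, rfl⟩
        · exact ⟨1, k, tv_var_zero.2 ⟨_, rfl⟩, tv_var_zero.2 ⟨_, rfl⟩, hM1⟩
        · obtain ⟨k', hk'⟩ := hd i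
          have hi : i < θ := (lt_add_one i).trans ((lt_cMem_right _ _).trans_le hle)
          refine ⟨0, k', tv_var_succ.2 ⟨_, _, rfl, tv_cVar_zero i⟩,
            tv_var_succ.2 ⟨_, _, rfl, hk'⟩, fun a => ?_⟩
          rw [hM0, ← hdX i hi k' hk']
          rfl
      obtain ⟨b, b', hb, hb', hbb⟩ := hcol
      rw [clause_mem, clause_mem]
      constructor
      · rintro ⟨a, b'', ha, hb'', h⟩
        obtain rfl := tv_functional hb hb''
        exact ⟨a, b', ha, hb', (hbb a).1 h⟩
      · rintro ⟨a, b'', ha, hb'', h⟩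
        obtain rfl := tv_functional hb' hb''
        exact ⟨a, b, ha, hb, (hbb a).2 h⟩
    · rw [clause_not, clause_not, ih ψ (lt_cNot _) h ((lt_cNot _).le.trans hle)]
    · rw [clause_and, clause_and, ih ψ (lt_cAnd_left _ _) h ((lt_cAnd_left _ _).le.trans hle),
        ih χ (lt_cAnd_right _ _) h' ((lt_cAnd_right _ _).le.trans hle)]
    · rw [clause_all, clause_all]
      exact forall_congr' fun x => ih ψ (lt_cAll _) h ((lt_cAll _).le.trans hle) _
    · exact absurd hc (hDs ψ)
  -- `Q a v` lists what is expected of the value `v` at position `a`: the label, the refuting set,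
  -- and the Skolemized truth values up to `θ`.
  let Q : N → N → Prop := fun a v => (a = 0 → v = pr θ e) ∧
    (∀ x, a = pr (num 1) x → (v ≠ 0 ↔ x ∈ column V k)) ∧
    ∀ c e', a = pr (num 2) (pr c e') → c ≤ θ → (v = 0 ↔ pr c (pr e' (pr 1 0)) ∈ T') ∧
      ∀ ψ x, c = cAll ψ → v = x + 1 → pr ψ (pr (pr x e') (pr 1 0)) ∉ T'
  have hQ : ∀ a, ∃ v, Q a v := by
    intro a
    by_cases h0 : a = 0
    · subst h0
      exact ⟨pr θ e, fun _ => rfl, fun x hx => absurd hx.symm (pr_num_ne_zero _ _),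
        fun c e' hx => absurd hx.symm (pr_num_ne_zero _ _)⟩
    by_cases h1 : ∃ x, a = pr (num 1) x
    · obtain ⟨x, rfl⟩ := h1
      by_cases hx : x ∈ column V k
      · refine ⟨1, fun h => absurd h h0, fun y hy => ?_, fun c e' h => by simp [num_inj] at h⟩
        rw [← (pr_inj.1 hy).2]
        simp [hx]
      · refine ⟨0, fun h => absurd h h0, fun y hy => ?_, fun c e' h => by simp [num_inj] at h⟩
        rw [← (pr_inj.1 hy).2]
        simp [hx]
    by_cases h2 : ∃ c e', a = pr (num 2) (pr c e') ∧ c ≤ θ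
    · obtain ⟨c, e', rfl, hc⟩ := h2
      suffices h : ∃ v, (v = 0 ↔ pr c (pr e' (pr 1 0)) ∈ T') ∧
          ∀ ψ x, c = cAll ψ → v = x + 1 → pr ψ (pr (pr x e') (pr 1 0)) ∉ T' by
        obtain ⟨v, hv⟩ := h
        refine ⟨v, fun h => absurd h h0, fun y hy => by simp [num_inj] at hy,
          fun c' e'' h _ => ?_⟩
        obtain ⟨rfl, rfl⟩ := pr_inj.1 (pr_inj.1 h).2
        exact hv
      by_cases hc' : pr c (pr e' (pr 1 0)) ∈ T'
      · exact ⟨0, by simp [hc'], fun ψ x _ h => absurd h.symm (succ_ne_zero' x)⟩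
      by_cases hall : ∃ ψ, c = cAll ψ
      · obtain ⟨ψ, rfl⟩ := hall
        have h := hc'
        rw [hj _ (lt_add_one_iff.2 hc), clause_all] at h
        push Not at h
        obtain ⟨x, hx⟩ := h
        refine ⟨x + 1, by simp [hc'], fun ψ' x' h h' => ?_⟩
        rw [← (pr_inj.1 h).2, ← add_right_cancel h']
        exact hx
      · exact ⟨1, by simp [hc'], fun ψ x h => absurd ⟨ψ, h⟩ hall⟩
    · exact ⟨0, fun h => absurd h h0, fun x h => absurd ⟨x, h⟩ h1,
        fun c e' h h' => absurd ⟨c, e', h, h'⟩ h2⟩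
  -- The least admissible value makes the choice of counterexamples definable in `V`.
  let R : N → N → Prop := fun a v => Q a v ∧ ∀ w < v, ¬ Q a w
  have hRdef : Def (cols V) (fun e => R (e 0) (e 1)) := by
    simp only [R, Q, cAll]
    infer_instance
  have hQdef : ∀ a, Def (cols V) (fun e => Q a (e 0)) := fun a => by
    simp only [Q, cAll]
    infer_instance
  have hR1 : ∀ a, ∃ v, R a v := fun a => by
    have := hQdef a
    exact ACA.exists_least (S := cols V) (Q a) (hQ a)
  have hR2 : ∀ a v w, R a v → R a w → v = w := fun a v w hv hw =>
    le_antisymm (not_lt.1 fun h => hv.2 _ h hw.1) (not_lt.1 fun h => hw.2 _ h hv.1)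
  refine ⟨initSegs R, initSegs_mem R, isPath_initSegs hR1 hR2 (isClosedCond_refutes X) ?_, ?_⟩
  · intro θ' e₀ h
    have h' : pr θ' e₀ = pr θ e := h.1.1 rfl
    obtain ⟨rfl, rfl⟩ := pr_inj.1 h'
    have hv2 : ∀ c ≤ θ', ∀ e' v, R (pr (num 2) (pr c e')) v →
        (v = 0 ↔ pr c (pr e' (pr 1 0)) ∈ T') ∧
      ∀ ψ x, c = cAll ψ → v = x + 1 → pr ψ (pr (pr x e') (pr 1 0)) ∉ T' :=
      fun c hc e' v hv => hv.1.2.2 c e' rfl hc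
    refine ⟨fun v hv h0 => hk ?_, fun c hc e' v hv => ?_⟩
    · rw [← key θ' hθ le_rfl]
      exact (hv2 θ' le_rfl _ v hv).1.1 h0
    · obtain ⟨hv0, hvx⟩ := hv2 c hc e' v hv
      have hcl := hj c (lt_add_one_iff.2 hc) e' (pr 1 0)
      rw [hcl] at hv0
      refine ⟨?_, ?_, ?_, ?_, ?_, ?_, ?_, ?_, ?_⟩
      · rintro t u rfl
        rw [hv0, clause_eq]
      · rintro t u rfl
        rw [hv0, clause_lt]
      · rintro t i rfl ha h0
        obtain ⟨a, -, h, -⟩ := clause_mem.1 (hv0.1 h0)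
        exact ha ⟨a, h⟩
      · rintro t i a rfl ha
        rw [hv0, clause_mem]
        have hb := tv_var_succ.2 ⟨1, 0, rfl, tv_cVar_zero i⟩
        constructor
        · rintro ⟨a', b, ha', hb', h⟩
          obtain rfl := tv_functional ha ha'
          obtain rfl := tv_functional hb hb'
          exact (hM0 _).1 h
        · exact fun h => ⟨a, 0, ha, hb, (hM0 a).2 h⟩
      · rintro t a u rfl ha hu
        rw [hv0, clause_mem, hu.1.2.1 a rfl]
        have hb : TV (cVar 0) (pr (1 : N) 0) 1 := tv_var_zero.2 ⟨_, rfl⟩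
        constructor
        · rintro ⟨a', b, ha', hb', h⟩
          obtain rfl := tv_functional ha ha'
          obtain rfl := tv_functional hb hb'
          exact (hM1 _).1 h
        · exact fun h => ⟨a, 1, ha, hb, (hM1 a).2 h⟩
      · rintro ψ u rfl hu
        rw [hv0, clause_not, Ne, (hv2 ψ ((lt_cNot _).le.trans hc) _ u hu).1]
      · rintro ψ χ u w rfl hu hw
        rw [hv0, clause_and, (hv2 ψ ((lt_cAnd_left _ _).le.trans hc) _ u hu).1,
          (hv2 χ ((lt_cAnd_right _ _).le.trans hc) _ w hw).1]
      · rintro ψ x u rfl h0 hu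
        rw [(hv2 ψ ((lt_cAll _).le.trans hc) _ u hu).1]
        exact clause_all.1 (hv0.1 h0) x
      · rintro ψ x u rfl h0 hu
        rw [Ne, (hv2 ψ ((lt_cAll _).le.trans hc) _ u hu).1]
        exact hvx ψ x rfl h0
  · refine ⟨isSeq_cons.2 isSeq_zero, fun i v h => ?_⟩
    rcases at_cons.1 h with ⟨rfl, h1⟩ | h1
    · rw [len_zero.1 h1]
      have h0 : Q 0 (pr θ e) := ⟨fun _ => rfl, fun x hx => absurd hx.symm (pr_num_ne_zero _ _),
        fun c e' hx => absurd hx.symm (pr_num_ne_zero _ _)⟩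
      exact ⟨h0, fun w hw hq => hw.ne (hq.1 rfl)⟩
    · exact absurd h1 not_at_zero

end Refutation

/-! ### The model of all sets definable over a coded model -/

section DefinableModel

variable {N : Type*} [CommSemiring N] [LinearOrder N] [IsStrictOrderedRing N]
  [CanonicallyOrderedAdd N] [hN : ACANumbers N]

/-- The truth of the formula `ψ` at `x` and `p`. -/
def SatAt (T : Set N) (d ψ x p : N) : Prop := pr ψ (pr (pr x (pr p 0)) d) ∈ T

/-- The truth of the formula `ψ` depends on the first two number variables only. -/
def Binary (T : Set N) (d ψ : N) : Prop :=
  Fm True ψ ∧ ∀ x p r, Asg r → (pr ψ (pr (pr x (pr p r)) d) ∈ T ↔ SatAt T d ψ x p)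

/-- The sets that are definable in a coded model with truth set `T` and set parameters `d`. -/
def definableModel (T : Set N) (d : N) : Set N :=
  {z | ∃ x ψ p, z = pr x (pr ψ p) ∧ Binary T d ψ ∧ SatAt T d ψ x p}

theorem definableModel_mem {S : Set (Set N)} [ACA S] {T : Set N} (hT : T ∈ S) (d : N) :
    definableModel T d ∈ S := by
  have : InC S T := ⟨hT⟩
  unfold definableModel Binary SatAt
  exact comp _

theorem mem_column_definableModel {T : Set N} {d ψ p x : N} :
    x ∈ column (definableModel T d) (pr ψ p) ↔ Binary T d ψ ∧ SatAt T d ψ x p := by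
  simp [column, definableModel]

/-- Existential quantification. -/
def Form.ex (φ : Form N) : Form N := .not (.all (.not φ))

theorem Form.holds_ex {W T : Set N} {φ : Form N} {e d : N} :
    φ.ex.Holds W T e d ↔ ∃ x, φ.Holds W T (pr x e) d := by
  simp [Form.ex, Form.Holds]

/-- The formula `∃ p ∃ y (R(y, p, …) ∧ ψ(y, p))`. -/
def Form.app (R : ArithFormula) (ψ : N) : Form N := .ex (.ex (.and (.ofArith R) (.hole ψ)))

theorem Form.ok_app {R : ArithFormula} {ψ : N} (h : Fm True ψ) : (Form.app R ψ).Ok True :=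
  ⟨Form.ok_ofArith _ _, h⟩

theorem Form.holds_app {W T : Set N} {R : ArithFormula} {ψ e d : N} (h : Binary T d ψ)
    (he : Asg e) : (Form.app R ψ).Holds W T e d ↔
      ∃ p y, R.Holds (push y (push p (dec e))) (fun i => column W (dec d i)) ∧
        SatAt T d ψ y p := by
  simp only [Form.app, Form.holds_ex]
  refine exists_congr fun p => exists_congr fun y => ?_
  simp only [Form.Holds, Form.holds_ofArith, dec_pr, h.2 y p e he]

variable {S : Set (Set N)} [hS : ACA S] {W T : Set N} {d : N}

theorem mem_iff_holds (S : Set (Set N)) [ACA S] (hT : FullSat W T) (hd : Asg d) {φ : Form N}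
    (hφ : φ.Ok True) {e : N} (he : Asg e) : pr φ.code (pr e d) ∈ T ↔ φ.Holds W T e d :=
  Form.holds_iff (subformulaClosed_fm S True) (hT.tarskiOn _) φ he hd hφ.fm

/-- Once truth depends only on `x` and `p`, the code of `φ` and the parameter `p` index the column.
Dependence is tested semantically by `Binary`, so no syntactic analysis of nonstandard formulas is
needed. -/
theorem setOf_mem_definableModel (S : Set (Set N)) [ACA S] (hT : FullSat W T) (hd : Asg d)
    {φ : Form N} (hφ : φ.Ok True) {Q : N → N → Prop}
    (h : ∀ x p r, Asg r → (φ.Holds W T (pr x (pr p r)) d ↔ Q x p)) (p : N) :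
    {x | Q x p} ∈ cols (definableModel T d) := by
  have h0 : ∀ x p r, Asg r → (pr φ.code (pr (pr x (pr p r)) d) ∈ T ↔ Q x p) := fun x p r hr =>
    (mem_iff_holds S hT hd hφ hr.pr.pr).trans (h x p r hr)
  have hB : Binary T d φ.code := ⟨hφ.fm, fun x p r hr => by
    rw [SatAt, h0 x p r hr, h0 x p 0 asg_zero]⟩
  refine ⟨pr φ.code p, ?_⟩
  ext x
  rw [mem_column_definableModel, and_iff_right hB]
  exact h0 x p 0 asg_zero

theorem exists_binary (S : Set (Set N)) [ACA S] (hT : FullSat W T) (hd : Asg d) {A : Set N}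
    (hA : A ∈ cols (definableModel T d)) :
    ∃ ψ p, Binary T d ψ ∧ ∀ x, SatAt T d ψ x p ↔ x ∈ A := by
  obtain ⟨n, rfl⟩ := hA
  by_cases hn : ∃ ψ p, n = pr ψ p ∧ Binary T d ψ
  · obtain ⟨ψ, p, rfl, hψ⟩ := hn
    exact ⟨ψ, p, hψ, fun x => by rw [mem_column_definableModel, and_iff_right hψ]⟩
  -- Columns whose index is not a valid pair are empty, and are represented by a false sentence.
  · have hok : (Form.not (.eq .zero .zero) : Form N).Ok True := trivial
    have h0 : ∀ e, Asg e → pr (Form.not (.eq .zero .zero) : Form N).code (pr e d) ∉ T := by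
      intro e he h
      exact (mem_iff_holds S hT hd hok he).1 h rfl
    refine ⟨_, 0, ⟨hok.fm, fun x p r hr => iff_of_false (h0 _ hr.pr.pr) (h0 _ asg_zero.pr.pr)⟩,
      fun x => iff_of_false (h0 _ asg_zero.pr.pr) ?_⟩
    rintro ⟨x', ψ, p, h, hB, -⟩
    exact hn ⟨ψ, p, (pr_inj.1 h).2, hB⟩

theorem columns_mem_definableModel (S : Set (Set N)) [ACA S] (hT : FullSat W T) (hd : Asg d)
    {B : Set N} {c₀ : N} (hB : column (column W (dec d 0)) c₀ = B) (c : N) :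
    column B c ∈ cols (definableModel T d) := by
  have h := setOf_mem_definableModel S hT hd (φ := .ofArith (.ex (.ex (.and
    (.eq (.var 3) (prTm (.var 1) (.var 0)))
    (.mem (prTm (prTm (.var 2) (.var 1)) (.var 0)) 0))))) (Form.ok_ofArith _ _)
    (Q := fun x p => ∃ a b, p = pr a b ∧ pr (pr x a) b ∈ column W (dec d 0))
    (fun x p r hr => by
      simp only [Form.holds_ofArith, ArithFormula.holds_ex, ArithFormula.Holds, val_prTm, Term.val,
        dec_pr, push])
    (pr c c₀)
  convert h using 1
  ext x
  rw [← hB]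
  simp [column]

theorem nand_mem_definableModel (S : Set (Set N)) [ACA S] (hT : FullSat W T) (hd : Asg d)
    {A A' : Set N} (hA : A ∈ cols (definableModel T d)) (hA' : A' ∈ cols (definableModel T d)) :
    {x | ¬ (x ∈ A ∧ x ∈ A')} ∈ cols (definableModel T d) := by
  obtain ⟨ψ, p, hψ, hψA⟩ := exists_binary S hT hd hA
  obtain ⟨χ, q, hχ, hχA⟩ := exists_binary S hT hd hA'
  -- A column has a single number parameter, so the parameters of both formulas are packed as `⟨p,
  -- q⟩` and unpacked inside the formula.
  have h := setOf_mem_definableModel S hT hd (φ := .not (.and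
    (.app (.and (.eq (.var 0) (.var 2)) (.ex (.eq (.var 4) (prTm (.var 2) (.var 0))))) ψ)
    (.app (.and (.eq (.var 0) (.var 2)) (.ex (.eq (.var 4) (prTm (.var 0) (.var 2))))) χ)))
    ⟨Form.ok_app hψ.1, Form.ok_app hχ.1⟩
    (Q := fun x P => ¬ ((∃ p y, (y = x ∧ ∃ b, P = pr p b) ∧ SatAt T d ψ y p) ∧
      ∃ p y, (y = x ∧ ∃ a, P = pr a p) ∧ SatAt T d χ y p))
    (fun x p r hr => by
      simp only [Form.Holds, Form.holds_app hψ hr.pr.pr, Form.holds_app hχ hr.pr.pr,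
        ArithFormula.holds_ex, ArithFormula.Holds, val_prTm, Term.val, dec_pr, push])
    (pr p q)
  convert h using 1
  ext x
  simp [← hψA, ← hχA]

theorem ex_mem_definableModel (S : Set (Set N)) [ACA S] (hT : FullSat W T) (hd : Asg d)
    {A : Set N} (hA : A ∈ cols (definableModel T d)) :
    {x | ∃ z, pr z x ∈ A} ∈ cols (definableModel T d) := by
  obtain ⟨ψ, p, hψ, hψA⟩ := exists_binary S hT hd hA
  have h := setOf_mem_definableModel S hT hd (φ := .ex (.app (.and
    (.eq (.var 0) (prTm (.var 2) (.var 3))) (.eq (.var 1) (.var 4))) ψ)) (Form.ok_app hψ.1)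
    (Q := fun x P => ∃ z p y, (y = pr z x ∧ p = P) ∧ SatAt T d ψ y p)
    (fun x p r hr => by
      simp only [Form.holds_ex, Form.holds_app hψ hr.pr.pr.pr, ArithFormula.Holds, val_prTm,
        Term.val, dec_pr, push])
    p
  convert h using 1
  ext x
  simp [← hψA]

theorem pull_mem_definableModel (S : Set (Set N)) [ACA S] (hT : FullSat W T) (hd : Asg d)
    {B : Set N} {c₀ : N} (hB : column (column W (dec d 0)) c₀ = B) (c : N) {A : Set N}
    (hA : A ∈ cols (definableModel T d)) :
    {x | ∃ a, pr x a ∈ column B c ∧ a ∈ A} ∈ cols (definableModel T d) := by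
  obtain ⟨ψ, p, hψ, hψA⟩ := exists_binary S hT hd hA
  have h := setOf_mem_definableModel S hT hd (φ := .app (.ex (.ex (.and
    (.eq (.var 5) (prTm (.var 3) (prTm (.var 1) (.var 0))))
    (.mem (prTm (prTm (prTm (.var 4) (.var 2)) (.var 1)) (.var 0)) 0)))) ψ) (Form.ok_app hψ.1)
    (Q := fun x P => ∃ p y, (∃ c c₀, P = pr p (pr c c₀) ∧
      pr (pr (pr x y) c) c₀ ∈ column W (dec d 0)) ∧ SatAt T d ψ y p)
    (fun x p r hr => by
      simp only [Form.holds_app hψ hr.pr.pr, ArithFormula.holds_ex, ArithFormula.Holds, val_prTm,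
        Term.val, dec_pr, push])
    (pr p (pr c c₀))
  convert h using 1
  ext x
  rw [← hB]
  simp [← hψA, column]

/-- Lying on a path of `W` is expressed with one set quantifier over `W`; this is where definability
by more than arithmetical formulas is used. -/
theorem extendible_mem_definableModel (S : Set (Set N)) [ACA S] (hT : FullSat W T) (hd : Asg d) :
    extendible (cols W) (column (column W (dec d 0)) 0) ∈ cols (definableModel T d) := by
  have h := setOf_mem_definableModel S hT hd (φ := .not (.allSet (.not (.ofArith pathForm))))
    ⟨trivial, Form.ok_ofArith _ _⟩
    (Q := fun x _ => x ∈ extendible (cols W) (column (column W (dec d 0)) 0))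
    (fun x p r hr => by
      simp only [Form.Holds, Form.holds_ofArith, holds_pathForm, dec_pr, push, not_forall, not_not]
      constructor
      · rintro ⟨k, h⟩
        exact ⟨_, ⟨k, rfl⟩, h⟩
      · rintro ⟨_, ⟨k, rfl⟩, h⟩
        exact ⟨k, h⟩)
    0
  exact h

theorem aca_definableModel (hTS : T ∈ S) (hT : FullSat W T) (hd : Asg d) {B : Set N}
    (hR : Rich B) {c₀ : N} (hB : column (column W (dec d 0)) c₀ = B) :
    ACA (cols (definableModel T d)) := by
  refine aca_of_closed (cols_subset (definableModel_mem hTS d)) hR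
    (columns_mem_definableModel S hT hd hB)
    (fun A hA A' hA' => nand_mem_definableModel S hT hd hA hA')
    (fun A hA => ex_mem_definableModel S hT hd hA)
    fun c hc A hA => ⟨_, pull_mem_definableModel S hT hd hB c hA, fun x a ha => ?_⟩
  exact ⟨fun ⟨b, hb, h⟩ => hc x a b ha hb ▸ h, fun h => ⟨a, ha, h⟩⟩

/-- Transfinite induction for the definable sets. -/
theorem ti_definableModel (hTS : T ∈ S) (hT : FullSat W T) (hd : Asg d) (h : SatTI S W)
    {A X : Set N} (hA : A ∈ cols (definableModel T d)) (hX : X ∈ cols W) (hwo : SatWO W X)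
    (hprog : ∀ j, (∀ i, StrictRel X i j → i ∈ A) → j ∈ A) (j : N) : j ∈ A := by
  obtain ⟨ψ, p, hψ, hψA⟩ := exists_binary S hT hd hA
  obtain ⟨T', hT', hT''⟩ := h ψ hψ.1.isFormula
  obtain ⟨hTS', D, hDS, hD, hφ, hTD⟩ := isValuation_iff.1 hT'
  have heq : ∀ x, pr ψ (pr (pr x (pr p 0)) d) ∈ T' ↔ x ∈ A := fun x => by
    rw [hTD.eq_fullSat hDS hTS' hTS hD hT ψ hφ, ← hψA]
    rfl
  have := hT'' X hX hwo (pr p 0) d (isAssignment_iff.2 asg_zero.pr) (isAssignment_iff.2 hd)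
  simp only [heq] at this
  exact this hprog j

end DefinableModel

/-! ### From transfinite induction to pseudo-comprehension -/

section Main

variable {N : Type*} [CommSemiring N] [LinearOrder N] [IsStrictOrderedRing N]
  [CanonicallyOrderedAdd N] [hN : ACANumbers N]

/-- A tree that has a path in the model of definable sets has a path in the given model of
transfinite induction. -/
theorem exists_path_of_definable {S : Set (Set N)} [hS : ACA S] {W T : Set N} {d : N}
    [hW : ACA (cols W)] (hTS : T ∈ S) (hT : FullSat W T) (hd : Asg d) (h : SatTI S W)
    [hWT : ACA (cols (definableModel T d))] {Con : (N → N → Prop) → Prop}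
    (hCon : IsClosedCond Con) (hU : condTree Con ∈ cols W) {P : Set N}
    (hP : P ∈ cols (definableModel T d)) (hPU : IsPath (condTree Con) P) {w : N}
    (hw : cons w 0 ∈ P) : ∃ P ∈ cols W, IsPath (condTree Con) P ∧ cons w 0 ∈ P := by
  by_contra hno
  have hwo : SatWO W (kbCode (condTree Con) w) := by
    refine ⟨isLinearOrderCode_kbCode _ _, ?_⟩
    rintro ⟨F, hF, hF'⟩
    exact hno (exists_path_of_descending (C := cols W) hCon hF hF')
  have : InC (cols (definableModel T d)) P := ⟨hP⟩
  -- The complement of the path above `w` is progressive: a node of the path has a successor on the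
  -- path, which is smaller in the Kleene–Brouwer order. Induction would then exclude the node `cons
  -- w 0`, which is on the path.
  have hA : {j | ¬ (j ∈ P ∧ At j 0 w)} ∈ cols (definableModel T d) := comp _
  refine ti_definableModel hTS hT hd h hA (kbCode_mem hU w) hwo (fun j hj hjP => ?_) (cons w 0)
    ⟨hw, at_cons.2 (Or.inl ⟨rfl, len_zero.2 rfl⟩)⟩
  obtain ⟨v, hv⟩ := hPU.2.2.1 j hjP.1
  have hat : At (cons v j) 0 w := at_cons.2 (Or.inr hjP.2)
  exact hj (cons v j) (strictRel_kbCode.2 ⟨⟨hPU.2.1 _ hv, hat⟩, ⟨hPU.2.1 _ hjP.1, hjP.2⟩,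
    kb_cons hjP.2.isSeq v⟩) ⟨hv, hat⟩

theorem SubformulaClosed.insert_allSet {S : Set (Set N)} [ACA S] {D : Set N}
    (hD : SubformulaClosed S D) (hDS : D ∈ S) {θ : N} (hθ : θ ∈ D) :
    ∃ D' ∈ S, SubformulaClosed S D' ∧ cAllSet θ ∈ D' := by
  have : InC S D := ⟨hDS⟩
  have h : {c | c ∈ D ∨ c = cAllSet θ} ∈ S := comp _
  refine ⟨_, h, fun c hc => ?_, Or.inr rfl⟩
  rcases hc with hc | rfl
  · rcases hD c hc with h | h | h | ⟨ψ, h, h'⟩ | ⟨ψ, h, χ, h', h''⟩ | ⟨ψ, h, h'⟩ | ⟨ψ, h, h'⟩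
    · exact Or.inl h
    · exact Or.inr (Or.inl h)
    · exact Or.inr (Or.inr (Or.inl h))
    · exact Or.inr (Or.inr (Or.inr (Or.inl ⟨ψ, Or.inl h, h'⟩)))
    · exact Or.inr (Or.inr (Or.inr (Or.inr (Or.inl ⟨ψ, Or.inl h, χ, Or.inl h', h''⟩))))
    · exact Or.inr (Or.inr (Or.inr (Or.inr (Or.inr (Or.inl ⟨ψ, Or.inl h, h'⟩)))))
    · exact Or.inr (Or.inr (Or.inr (Or.inr (Or.inr (Or.inr ⟨ψ, Or.inl h, h'⟩)))))
  · exact Or.inr (Or.inr (Or.inr (Or.inr (Or.inr (Or.inr ⟨θ, Or.inl hθ, rfl⟩)))))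

theorem pi11CAEps_of_omegaModelReflectionTI {S : Set (Set N)} [hS : ACA S]
    (h : OmegaModelReflectionTI S) : Pi11CAEps S := by
  -- By hypothesis every set of `S` lies in a coded model of `ACA₀`, which provides full
  -- satisfaction relations. This is used for `W` and again for `V`.
  have hfull : ∀ M ∈ S, ∃ T ∈ S, FullSat M T := by
    intro M hM
    obtain ⟨V, hV, hMV, hVA, -⟩ := h M hM
    have : ACA (cols V) := SatACA0.aca hV hVA
    exact exists_fullSat hV hMV
  intro X hX
  obtain ⟨B, hB, hR, hBX, -⟩ := exists_rich hX hX
  have hUS := condTree_refutes_mem hX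
  obtain ⟨X₁, hX₁, -, hU, c₀, hc₀⟩ := exists_rich hUS hB
  obtain ⟨W, hW, ⟨k₁, hk₁⟩, hWA, hTI⟩ := h X₁ hX₁
  have hWC : ACA (cols W) := SatACA0.aca hW hWA
  obtain ⟨T, hTS, hT⟩ := hfull W hW
  have hd : Asg (pr k₁ 0) := asg_zero.pr
  have hdec : column W (dec (pr k₁ 0) 0) = X₁ := by rw [dec_pr_zero, hk₁]
  have hBW : column (column W (dec (pr k₁ 0) 0)) c₀ = B := by rw [hdec, hc₀]
  have hVC := aca_definableModel hTS hT hd hR hBW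
  have hH := extendible_mem_definableModel S hT hd
  rw [hdec, hU] at hH
  have hVX := columns_mem_definableModel S hT hd hBW 0
  rw [hBX] at hVX
  have hV := definableModel_mem hTS (pr k₁ 0)
  have hUW : condTree (Refutes X) ∈ cols W := by
    rw [← hU, ← hk₁]
    exact column_mem (column_mem_cols W k₁) 0
  generalize hVdef : definableModel T (pr k₁ 0) = V at *
  obtain ⟨T', hTS', hT'⟩ := hfull V hV
  refine ⟨V, hV, hVX, satACA0_of_aca hV hTS' hT', ?_⟩
  rintro _ ⟨θ, ⟨D, hDS, hD, hDs, hθ⟩, rfl⟩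
  obtain ⟨D', hDS', hD', hθ'⟩ := hD.insert_allSet hDS hθ
  refine ⟨T', isValuation_iff.2 ⟨hTS', D', hDS', hD', hθ', hT'.tarskiOn _⟩,
    fun e d he hd' hdX => ?_⟩
  rw [isAssignment_iff] at hd'
  have hdX' : ∀ i < θ, ∀ k, TV (cVar i) d k → column V k = X := fun i hi k hk =>
    hdX i (hi.trans (lt_cAllSet θ)) k (termVal_iff.2 hk)
  -- Falsity of `∀ Y θ` in `V` amounts to the label starting a path in `W`, so the truth set becomes
  -- arithmetical in the set of extendible nodes.
  have key : ∀ x, pr (cAllSet θ) (pr (pr x e) d) ∈ T' ↔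
      cons (pr θ (pr x e)) 0 ∉ extendible (cols W) (condTree (Refutes X)) := by
    intro x
    rw [hT', clause_allSet]
    constructor
    · rintro hall hex
      -- A path of `W` need not belong to `V`, but the leftmost path is computed from the extendible
      -- nodes and does.
      obtain ⟨P, hP, hPU, hw, -⟩ := exists_leftmost hH (extendible_subset _ _)
        (extendible_subset _ _ ⟨_, hex.choose_spec.1, hex.choose_spec.2.1,
          hex.choose_spec.2.1.1⟩) hex extendible_step
      obtain ⟨k, hk⟩ := not_mem_of_path hV hTS' hT' hDS hD hDs hθ hd' hdX' hP hPU hw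
      exact hk (hall k)
    · intro hex k
      by_contra hk
      obtain ⟨P, hP, hPU, hw⟩ := exists_path_of_not_mem hV hTS' hT' hDS hD hDs hθ hd' hdX' hVX hk
      subst hVdef
      obtain ⟨P', hP', hPU', hw'⟩ := exists_path_of_definable hTS hT hd hTI
        (isClosedCond_refutes X) hUW hP hPU hw
      exact hex ⟨P', hP', hPU', hw'⟩
  simp only [key]
  have : InC (cols V) (extendible (cols W) (condTree (Refutes X))) := ⟨hH⟩
  have hout : {x | cons (pr θ (pr x e)) 0 ∉ extendible (cols W) (condTree (Refutes X))} ∈ cols V :=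
    comp _
  obtain ⟨k, hk⟩ := hout
  exact ⟨k, fun x => by rw [hk]; rfl⟩

end Main

end SOA

/-- `ACA₀` proves that `Π¹₁-CA^ε` is equivalent to the statement that every set is contained in a
coded `ω`-model of `ACA₀ + Π¹_∞-TI`: the equivalence holds in every (possibly nonstandard) model
`(N, S)` of `ACA₀`. -/
theorem proposition2p3 {N : Type*} [Zero N] [One N] [Add N] [Mul N] [LT N] (S : Set (Set N))
    (hS : SOA.ModelACA0 S) : SOA.Pi11CAEps S ↔ SOA.OmegaModelReflectionTI S := by
  have hA : SOA.ACA S := ⟨hS⟩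
  let i1 := SOA.Raw.commSemiring hA
  let i2 := SOA.Raw.linearOrder hA
  have i3 := SOA.Raw.isStrictOrderedRing hA
  have i4 := SOA.Raw.canonicallyOrderedAdd hA
  have i5 : SOA.ACANumbers N := ⟨S, hA⟩
  exact ⟨SOA.omegaModelReflectionTI_of_pi11CAEps (hS := hA),
    SOA.pi11CAEps_of_omegaModelReflectionTI (hS := hA)⟩
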